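/- Let $\mathbb T=\mathbb R/2\pi\mathbb Z$, $-\tfrac12<\alpha<0$, $\nu>0$, $T>0$, $f_0\in L^2(\mathbb T;\mathbb C)$, and let $u\in B^{\alpha}_{1,\infty}(\mathbb T)$ be a real-valued distribution. Consider on $(0,T)\times\mathbb T$ the equation $$\partial_t f+\mathrm i\,u f=\nu\,\partial_y^2 f,\qquad f|_{t=0}=f_0. \tag{1}$$ For $0<\varepsilon<\tfrac12+\alpha$ let $W^{\alpha-\varepsilon,1+\varepsilon}(\mathbb T)$ be the dual of the fractional (Slobodeckij) Sobolev space $W^{-\alpha+\varepsilon,(1+\varepsilon)/\varepsilon}(\mathbb T)$, and let $\langle\cdot,\cdot\rangle$ be the corresponding bilinear pairing, which extends $(v,g)\mapsto\int_{\mathbb T}vg$. A weak solution of (1) is a measurable $f:(0,T)\times\mathbb T\to\mathbb C$ such that, for some such $\varepsilon$, $f\in L^2(0,T;W^{-\alpha+\varepsilon,(1+\varepsilon)/\varepsilon}(\mathbb T))$, and such that, for every smooth $\varphi$ with compact support in $[0,T)\times\mathbb T$, $$\int_0^T\!\!\int_{\mathbb T} f\,(\partial_t\varphi+\nu\,\partial_y^2\varphi)\,dy\,dt+\int_{\mathbb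 T}f_0\,\varphi(0)\,dy=\mathrm i\int_0^T\langle u,f(t)\varphi(t)\rangle\,dt .$$ Then (1) has a weak solution $f$, and it is unique (up to equality almost everywhere). Moreover $f\in L^2(0,T;H^1(\mathbb T))\cap L^\infty(0,T;L^2(\mathbb T))$. The solution is the limit of solutions with smooth velocities: for every $0<\varepsilon<\tfrac12+\alpha$ there are smooth real functions $u^n$ with $u^n\to u$ in $W^{\alpha-\varepsilon,1+\varepsilon}(\mathbb T)$; and for every such sequence, equation (1) with $u^n$ in place of $u$ and the same $f_0$ has a weak solution $f^n$, and any such $f^n$ satisfy $f^n\to f$ in $L^2(0,T;H^1(\mathbb T))$ and in $L^\infty(0,T;L^2(\mathbb T))$. -/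

import Mathlib

open MeasureTheory Filter Topology Set
open scoped ENNReal ContDiff

noncomputable section

namespace RoughShear

/-! ### The torus, smooth functions and distributions -/

instance instFactTwoPiPos : Fact ((0 : ℝ) < 2 * Real.pi) := ⟨Real.two_pi_pos⟩

/-- The one-dimensional torus `ℝ / 2πℤ`. -/
abbrev Torus : Type := AddCircle (2 * Real.pi)

/-- The Haar measure on the torus, of total mass one. All integrals over the torus, all norms and
the identification of functions with distributions refer to it. -/
abbrev haar : Measure Torus := AddCircle.haarAddCircle

/-- The space `C^∞(𝕋; ℂ)`: functions on the torus whose periodic lift to `ℝ` is smooth. -/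
def SmoothFn : Submodule ℂ (Torus → ℂ) where
  carrier := {φ | ContDiff ℝ ∞ (fun y : ℝ => φ (y : Torus))}
  add_mem' {a b} ha hb := by
    have ha' : ContDiff ℝ ∞ (fun y : ℝ => a (y : Torus)) := ha
    have hb' : ContDiff ℝ ∞ (fun y : ℝ => b (y : Torus)) := hb
    exact ha'.add hb'
  zero_mem' := by
    change ContDiff ℝ ∞ (fun _ : ℝ => (0 : ℂ))
    exact contDiff_const
  smul_mem' c a ha := by
    have ha' : ContDiff ℝ ∞ (fun y : ℝ => a (y : Torus)) := ha
    exact contDiff_const.smul ha'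

theorem smoothFn_continuous (φ : SmoothFn) : Continuous (φ : Torus → ℂ) := by
  have h' : ContDiff ℝ ∞ (fun y : ℝ => (φ : Torus → ℂ) (y : Torus)) := φ.2
  exact continuous_coinduced_dom.2 h'.continuous

/-- The exponential `y ↦ exp (i n y)` as a smooth function on the torus. -/
def expFn (n : ℤ) : SmoothFn :=
  ⟨fun x => fourier n x, by
    change ContDiff ℝ ∞ (fun y : ℝ => (fourier n (y : Torus) : ℂ))
    simp only [fourier_coe_apply]
    have h : ContDiff ℝ ∞ (fun y : ℝ => (y : ℂ)) := Complex.ofRealCLM.contDiff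
    exact ((contDiff_const.mul h).div_const _).cexp⟩

/-- A linear functional on `C^∞(𝕋)` is a distribution if it is continuous, i.e. bounded by the
supremum norms of finitely many derivatives. -/
def IsDistribution (u : SmoothFn →ₗ[ℂ] ℂ) : Prop :=
  ∃ (N : ℕ) (C : ℝ), ∀ (φ : SmoothFn) (M : ℝ),
    (∀ k ≤ N, ∀ y : ℝ, ‖iteratedDeriv k (fun z : ℝ => (φ : Torus → ℂ) (z : Torus)) y‖ ≤ M) →
      ‖u φ‖ ≤ C * M

/-- The functional is real: it takes real values on real-valued smooth functions. -/
def IsRealDistribution (u : SmoothFn →ₗ[ℂ] ℂ) : Prop :=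
  ∀ φ : SmoothFn, (∀ x, ((φ : Torus → ℂ) x).im = 0) → (u φ).im = 0

/-- The distribution `φ ↦ ∫ v φ` given by a smooth function `v`. -/
def ofSmooth (v : SmoothFn) : SmoothFn →ₗ[ℂ] ℂ where
  toFun φ := ∫ x, (v : Torus → ℂ) x * (φ : Torus → ℂ) x ∂haar
  map_add' φ ψ := by
    have h (χ : SmoothFn) : Integrable (fun x => (v : Torus → ℂ) x * (χ : Torus → ℂ) x) haar :=
      ((smoothFn_continuous v).mul (smoothFn_continuous χ)).integrable_of_hasCompactSupport
        (HasCompactSupport.of_compactSpace _)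
    rw [← integral_add (h φ) (h ψ)]
    simp [mul_add]
  map_smul' c φ := by
    rw [RingHom.id_apply, smul_eq_mul, ← integral_const_mul]
    simp [mul_left_comm]

/-- The Fourier coefficient `û(n)` of a distribution, `û(n) = u(exp(-i n ·))`. -/
def distCoeff (u : SmoothFn →ₗ[ℂ] ℂ) (n : ℤ) : ℂ := u (expFn (-n))

/-! ### Littlewood-Paley decomposition and Besov spaces -/

/-- A smooth even cut-off function, equal to `1` for `|r| ≤ 1` and to `0` for `|r| ≥ 2`. -/
def cutoff (r : ℝ) : ℝ := Real.smoothTransition (2 - |r|)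

/-- The smooth low-frequency truncation `S_N u = ∑ₙ χ(n / 2^N) û(n) exp(i n ·)`. Since `χ` vanishes
outside `(-2, 2)`, the sum is finite. -/
def lowFreq (u : SmoothFn →ₗ[ℂ] ℂ) (N : ℕ) (x : Torus) : ℂ :=
  ∑ n ∈ Finset.Icc (-(2 ^ (N + 1) : ℤ)) (2 ^ (N + 1)),
    (cutoff ((n : ℝ) / 2 ^ N) : ℂ) * distCoeff u n * fourier n x

/-- The Littlewood-Paley blocks `Δ_j u`, with `S_N u = ∑_{j ≤ N} Δ_j u`: the block `j + 1` has
frequencies `2^j ≤ |n| ≤ 2^(j+2)`. -/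
def lpBlock (u : SmoothFn →ₗ[ℂ] ℂ) : ℕ → Torus → ℂ
  | 0 => lowFreq u 0
  | j + 1 => fun x => lowFreq u (j + 1) x - lowFreq u j x

/-- The norm of the Besov space `B^s_{p,∞}(𝕋)`: the supremum over `j` of
`2^(j s) ‖Δ_j u‖_{L^p}`. -/
def besovNorm (s : ℝ) (p : ℝ≥0∞) (u : SmoothFn →ₗ[ℂ] ℂ) : ℝ≥0∞ :=
  ⨆ j : ℕ, ENNReal.ofReal ((2 : ℝ) ^ ((j : ℝ) * s)) * eLpNorm (lpBlock u j) p haar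

/-- Membership in the Besov space `B^s_{p,∞}(𝕋)`. -/
def MemBesov (s : ℝ) (p : ℝ≥0∞) (u : SmoothFn →ₗ[ℂ] ℂ) : Prop :=
  IsDistribution u ∧ besovNorm s p u < ⊤

/-! ### Fractional Sobolev spaces -/

/-- The norm of the fractional Sobolev space `W^{s,p}(𝕋)` for `0 < s < 1` and `1 < p < ∞`
(Sobolev-Slobodeckij norm). -/
def sobolevNorm (s p : ℝ) (g : Torus → ℂ) : ℝ≥0∞ :=
  ((∫⁻ x, ‖g x‖ₑ ^ p ∂haar) +
    ∫⁻ x, ∫⁻ y, ‖g x - g y‖ₑ ^ p / edist x y ^ (1 + s * p) ∂haar ∂haar) ^ (1 / p)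

/-- The norm of the Sobolev space `W^{s,p}(𝕋)` of negative order, `-1 < s < 0` and `1 < p < ∞`:
the dual norm with respect to `W^{-s,p'}(𝕋)`, where `p' = p / (p - 1)`. -/
def negSobolevNorm (s p : ℝ) (u : SmoothFn →ₗ[ℂ] ℂ) : ℝ≥0∞ :=
  ⨆ (φ : SmoothFn) (_ : sobolevNorm (-s) (p / (p - 1)) (φ : Torus → ℂ) ≤ 1), ‖u φ‖ₑ

/-- The square of the `H¹(𝕋)` norm, `‖g‖²_{L²} + ∑ₙ n² |ĝ(n)|²`. -/
def hOneNormSq (g : Torus → ℂ) : ℝ≥0∞ :=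
  eLpNorm g 2 haar ^ 2 + ∑' n : ℤ, ENNReal.ofReal ((n : ℝ) ^ 2) * ‖fourierCoeff g n‖ₑ ^ 2

/-! ### Functions of time and space -/

/-- The product measure on `(0,T) × 𝕋`. -/
def spaceTime (T : ℝ) : Measure (ℝ × Torus) := (volume.restrict (Ioo 0 T)).prod haar

/-- The norm of `L^∞(0,T;L²(𝕋))`. -/
def normLinftyL2 (T : ℝ) (f : ℝ → Torus → ℂ) : ℝ≥0∞ :=
  essSup (fun t => eLpNorm (f t) 2 haar) (volume.restrict (Ioo 0 T))

/-- The norm of `L²(0,T;H¹(𝕋))`. -/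
def normL2H1 (T : ℝ) (f : ℝ → Torus → ℂ) : ℝ≥0∞ :=
  (∫⁻ t in Ioo 0 T, hOneNormSq (f t)) ^ (1 / 2 : ℝ)

/-- The norm of `L²(0,T;W^{s,p}(𝕋))`. -/
def normL2W (T s p : ℝ) (f : ℝ → Torus → ℂ) : ℝ≥0∞ :=
  (∫⁻ t in Ioo 0 T, sobolevNorm s p (f t) ^ 2) ^ (1 / 2 : ℝ)

/-! ### Weak solutions -/

/-- The duality pairing `⟨u, g⟩` of a distribution with a function, the limit of `∫ (S_N u) g`.
It is `u(g)` for smooth `g`; if `u` lies in a negative Sobolev space in which `S_N u → u`, it is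
the continuous extension of `u` to the predual Sobolev space. -/
def pairing (u : SmoothFn →ₗ[ℂ] ℂ) (g : Torus → ℂ) : ℂ :=
  limUnder atTop (fun N : ℕ => ∫ x, lowFreq u N x * g x ∂haar)

/-- The derivative of a function on the torus. -/
def torusDeriv (g : Torus → ℂ) (x : Torus) : ℂ :=
  deriv (fun h : ℝ => g (x + (h : Torus))) 0

/-- Test functions: smooth functions of time and space, with compact support in `[0,T)` in time. -/
def IsTestFunction (T : ℝ) (φ : ℝ → Torus → ℂ) : Prop :=
  ContDiff ℝ ∞ (fun q : ℝ × ℝ => φ q.1 (q.2 : Torus)) ∧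
    ∃ T' < T, ∀ t, T' ≤ t → ∀ x, φ t x = 0

/-- Weak solutions on `(0,T) × 𝕋` of `∂_t f + i u f = ν ∂_y² f`, `f(0) = f₀`, for a velocity of
Besov regularity `α`. They are taken in a space `L²(0,T;W^{-α+ε,(1+ε)/ε}(𝕋))`, in which the product
`u f` makes sense by the duality with `W^{α-ε,1+ε}(𝕋)`. -/
def IsWeakSolution (α ν T : ℝ) (u : SmoothFn →ₗ[ℂ] ℂ) (f₀ : Torus → ℂ) (f : ℝ → Torus → ℂ) :
    Prop :=
  AEStronglyMeasurable (Function.uncurry f) (spaceTime T) ∧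
  (∃ ε : ℝ, 0 < ε ∧ ε < 1 / 2 + α ∧ normL2W T (-α + ε) ((1 + ε) / ε) f < ⊤) ∧
  ∀ φ : ℝ → Torus → ℂ, IsTestFunction T φ →
    (∫ t in Ioo 0 T, ∫ x, f t x *
        (deriv (fun s => φ s x) t + (ν : ℂ) * torusDeriv (torusDeriv (φ t)) x) ∂haar) +
      (∫ x, f₀ x * φ 0 x ∂haar) =
    Complex.I * ∫ t in Ioo 0 T, pairing u (fun x => f t x * φ t x)

end RoughShear

end

/-!
The equation is linear and its velocity is real, so the transport term does not contribute to the
energy balance; what has to be shown is that multiplication by `u ∈ B^α_{1,∞}`, with `α > -1/2`, is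
dominated by the viscosity. It is bounded from `H¹` into its dual. The reason is that products of
`H¹` functions are bounded and Hölder continuous of every exponent below `1/2`, hence belong to the
spaces `W^{s,q}` with `s < 1/2` (`exists_sobolevNorm_conjMul_le`), while `u` pairs with `W^{s,q}` as
soon as `1/q < s + α` (`exists_pairing_bound`). For the second fact the pairing is decomposed into
Littlewood-Paley blocks. Subtracting from a function `g` its average against a localised kernel of
degree at most `2^j` does not change the pairing of `g` with a block of frequencies above `2^j`; the
difference is of size `2^(-j s)` in `L^q`, and Nikolskii's inequality bounds the block in
`L^{q/(q-1)}` by `2^(j/q)` times its `L¹` norm (`enorm_integral_trig_mul_le`). The block of order `j`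
thus contributes `2^(j (1/q - s - α))`, and the series converges geometrically.

The space `H¹` is modelled by `ℓ²(ℤ)`: a sequence `c` in `Seq` stands for the function `synth c` with
Fourier coefficients `c n / √(1 + n²)`, and the embedding of `H¹` into `L²` becomes the self-adjoint
operator `invJap`. Multiplication by `u` becomes a bounded operator `B` (`exists_isFormOf`), whose form
is Hermitian for real `u` (`IsFormOf.im_inner_self`). The equation becomes a family of scalar integral
equations, one for each Fourier mode (`ModeEq`), coupled by the operator `ellip ν B`. For paths in
`L²(0,T;ℓ²)` the scalar energy identities can be summed over the modes (`energy_identity`), without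
any regularisation in time.

Existence in the sequence model is Lions' projection theorem (`exists_inner_eq_of_norm_le`), applied
in `L²(0,T;ℓ²)` to the space-time form, which is coercive by the Hermitian symmetry of `B`
(`exists_modeEq`). The energy identity gives the bound in `L^∞(0,T;L²)` (`ae_norm_invJap_le`) and
the stability estimate (`stability`): if the operators of two solutions with the same initial value
differ by `η`, then the solutions differ by a multiple of `η` in both norms. Uniqueness is the case
`η = 0`. The convergence of the solutions with smooth velocities follows, since the difference of the
operators is bounded by the norm of the difference of the velocities in the negative Sobolev space
(`exists_norm_inner_sub_le`); the truncations `S_n u` are velocities that converge to `u`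
(`exists_smooth_approx`).

Solutions in the sequence model correspond to weak solutions. In one direction, the weak formulation
is expanded in Fourier series (`isWeakSolution_synth`). In the other, a weak solution `f` is a priori
only in `L²(0,T;W^{s,q})`, which is not contained in `L²(0,T;H¹)`; but multiplication by `H¹` functions
preserves `W^{s,q}`, so that `u f` is a functional on `H¹` of norm square integrable in time
(`exists_dualSeq`). As the right-hand side of the heat equation, it forces `f ∈ L²(0,T;H¹)`
(`mode_estimate`, `exists_modeEq_of_isWeakSolution`).
-/

noncomputable section

namespace RoughShear

/-! ### Primitives of integrable functions of time -/

/-- Product rule for primitives of integrable functions: by Fubini, the square `(0,t)²` is the union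
of two triangles. -/
theorem primitive_mul_primitive {g h : ℝ → ℂ} {t : ℝ}
    (hg : IntegrableOn g (Ioc 0 t)) (hh : IntegrableOn h (Ioc 0 t)) :
    (∫ s in Ioc 0 t, g s) * (∫ s in Ioc 0 t, h s) =
      ∫ s in Ioc 0 t, (g s * (∫ r in (0 : ℝ)..s, h r) + (∫ r in (0 : ℝ)..s, g r) * h s) := by
  set μ := (volume : Measure ℝ).restrict (Ioc 0 t) with hμ
  have hF : Integrable (fun z : ℝ × ℝ => g z.1 * h z.2) (μ.prod μ) := hg.mul_prod hh
  have hS : MeasurableSet {z : ℝ × ℝ | z.2 ≤ z.1} := measurableSet_le measurable_snd measurable_fst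
  have hF1 : Integrable ({z : ℝ × ℝ | z.2 ≤ z.1}.indicator fun z : ℝ × ℝ => g z.1 * h z.2)
      (μ.prod μ) := hF.indicator hS
  have hF2 : Integrable ({z : ℝ × ℝ | z.2 ≤ z.1}ᶜ.indicator fun z : ℝ × ℝ => g z.1 * h z.2)
      (μ.prod μ) := hF.indicator hS.compl
  have h1 : ∀ s ∈ Ioc 0 t, ∫ r, {z : ℝ × ℝ | z.2 ≤ z.1}.indicator
      (fun z : ℝ × ℝ => g z.1 * h z.2) (s, r) ∂μ = g s * ∫ r in (0 : ℝ)..s, h r := by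
    intro s hs
    rw [intervalIntegral.integral_of_le hs.1.le, ← integral_const_mul]
    have : (fun r => {z : ℝ × ℝ | z.2 ≤ z.1}.indicator (fun z : ℝ × ℝ => g z.1 * h z.2) (s, r))
        = (Iic s).indicator (fun r => g s * h r) := by
      ext r; simp [indicator]
    rw [this, integral_indicator measurableSet_Iic, hμ, Measure.restrict_restrict measurableSet_Iic]
    congr 2
    ext r; simp only [mem_inter_iff, mem_Iic, mem_Ioc]
    exact ⟨fun hr => ⟨hr.2.1, hr.1⟩, fun hr => ⟨hr.2, hr.1, hr.2.trans hs.2⟩⟩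
  have h2 : ∀ s ∈ Ioc 0 t, ∫ r, {z : ℝ × ℝ | z.2 ≤ z.1}ᶜ.indicator
      (fun z : ℝ × ℝ => g z.1 * h z.2) (r, s) ∂μ = (∫ r in (0 : ℝ)..s, g r) * h s := by
    intro s hs
    rw [intervalIntegral.integral_of_le hs.1.le, ← integral_mul_const,
      show ∫ r in Ioc 0 s, g r * h s = ∫ r in Ioo 0 s, g r * h s from integral_Ioc_eq_integral_Ioo]
    have : (fun r => {z : ℝ × ℝ | z.2 ≤ z.1}ᶜ.indicator (fun z : ℝ × ℝ => g z.1 * h z.2) (r, s))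
        = (Iio s).indicator (fun r => g r * h s) := by
      ext r; simp [indicator]
    rw [this, integral_indicator measurableSet_Iio, hμ, Measure.restrict_restrict measurableSet_Iio]
    congr 2
    ext r; simp only [mem_inter_iff, mem_Iio, mem_Ioc, mem_Ioo]
    exact ⟨fun hr => ⟨hr.2.1, hr.1⟩, fun hr => ⟨hr.2, hr.1, hr.2.le.trans hs.2⟩⟩
  have e1 : ∀ᵐ s ∂μ, ∫ r, {z : ℝ × ℝ | z.2 ≤ z.1}.indicator
      (fun z : ℝ × ℝ => g z.1 * h z.2) (s, r) ∂μ = g s * ∫ r in (0 : ℝ)..s, h r :=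
    (ae_restrict_iff' measurableSet_Ioc).2 (Eventually.of_forall h1)
  have e2 : ∀ᵐ s ∂μ, ∫ r, {z : ℝ × ℝ | z.2 ≤ z.1}ᶜ.indicator
      (fun z : ℝ × ℝ => g z.1 * h z.2) (r, s) ∂μ = (∫ r in (0 : ℝ)..s, g r) * h s :=
    (ae_restrict_iff' measurableSet_Ioc).2 (Eventually.of_forall h2)
  have i1 := hF1.integral_prod_left.congr e1
  have i2 := hF2.integral_prod_right.congr e2
  rw [integral_add i1 i2, ← integral_congr_ae e1, ← integral_congr_ae e2,
    ← integral_prod _ hF1, ← integral_prod_symm _ hF2, ← integral_prod_mul,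
    ← integral_add hF1 hF2]
  congr 1
  ext z
  exact (congrFun (indicator_self_add_compl {z : ℝ × ℝ | z.2 ≤ z.1}
    (fun z : ℝ × ℝ => g z.1 * h z.2)) z).symm

/-- Product rule for absolutely continuous functions, given by their derivatives. -/
theorem primitive_mul_primitive' {g h : ℝ → ℂ} {t : ℝ} (ht : 0 ≤ t) (a b : ℂ)
    (hg : IntegrableOn g (Ioc 0 t)) (hh : IntegrableOn h (Ioc 0 t)) :
    (a + ∫ s in Ioc 0 t, g s) * (b + ∫ s in Ioc 0 t, h s) = a * b +
      ∫ s in Ioc 0 t, (g s * (b + ∫ r in (0 : ℝ)..s, h r) + (a + ∫ r in (0 : ℝ)..s, g r) * h s) := by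
  have hgc : ContinuousOn (fun s => ∫ r in (0 : ℝ)..s, g r) (uIcc 0 t) := by
    apply intervalIntegral.continuousOn_primitive_interval
    rwa [uIcc_of_le ht, integrableOn_Icc_iff_integrableOn_Ioc]
  have hhc : ContinuousOn (fun s => ∫ r in (0 : ℝ)..s, h r) (uIcc 0 t) := by
    apply intervalIntegral.continuousOn_primitive_interval
    rwa [uIcc_of_le ht, integrableOn_Icc_iff_integrableOn_Ioc]
  rw [uIcc_of_le ht] at hgc hhc
  have i1 : IntegrableOn (fun s => g s * ∫ r in (0 : ℝ)..s, h r) (Ioc 0 t) := by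
    rw [← integrableOn_Icc_iff_integrableOn_Ioc] at hg ⊢
    exact hg.mul_continuousOn hhc isCompact_Icc
  have i2 : IntegrableOn (fun s => (∫ r in (0 : ℝ)..s, g r) * h s) (Ioc 0 t) := by
    rw [← integrableOn_Icc_iff_integrableOn_Ioc] at hh ⊢
    exact hh.continuousOn_mul hgc isCompact_Icc
  have e : (fun s => g s * (b + ∫ r in (0 : ℝ)..s, h r) + (a + ∫ r in (0 : ℝ)..s, g r) * h s) =
      fun s => (g s * b + a * h s) +
        (g s * (∫ r in (0 : ℝ)..s, h r) + (∫ r in (0 : ℝ)..s, g r) * h s) := by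
    ext s; ring
  have e1 : ∫ s in Ioc 0 t, ((g s * b + a * h s) +
        (g s * (∫ r in (0 : ℝ)..s, h r) + (∫ r in (0 : ℝ)..s, g r) * h s)) =
      (∫ s in Ioc 0 t, (g s * b + a * h s)) + ∫ s in Ioc 0 t,
        (g s * (∫ r in (0 : ℝ)..s, h r) + (∫ r in (0 : ℝ)..s, g r) * h s) :=
    integral_add ((hg.mul_const b).add (hh.const_mul a)) (i1.add i2)
  rw [e, e1, ← primitive_mul_primitive hg hh, integral_add (hg.mul_const b) (hh.const_mul a),
    integral_mul_const, integral_const_mul]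
  ring

/-- Integration by parts against a continuously differentiable function vanishing at the final
time. -/
theorem integral_deriv_mul_primitive {T : ℝ} (hT : 0 ≤ T) {θ g : ℝ → ℂ} (a : ℂ)
    (hθ : ContDiff ℝ 1 θ) (hθT : θ T = 0) (hg : IntegrableOn g (Ioo 0 T)) :
    (∫ t in Ioo 0 T, deriv θ t * (a - ∫ s in (0 : ℝ)..t, g s)) + θ 0 * a =
      ∫ t in Ioo 0 T, θ t * g t := by
  rw [← integrableOn_Ioc_iff_integrableOn_Ioo] at hg
  have hd : Continuous (deriv θ) := hθ.continuous_deriv le_rfl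
  have hp : ∀ t, ∫ s in (0 : ℝ)..t, deriv θ s = θ t - θ 0 := fun t =>
    intervalIntegral.integral_eq_sub_of_hasDerivAt
      (fun x _ => (hθ.differentiable one_ne_zero x).hasDerivAt) (hd.intervalIntegrable _ _)
  have hdi : IntegrableOn (deriv θ) (Ioc 0 T) :=
    (hd.continuousOn.integrableOn_Icc).mono_set Ioc_subset_Icc_self
  have key := primitive_mul_primitive' hT (θ 0) a hdi hg.neg
  rw [← intervalIntegral.integral_of_le hT (f := deriv θ), hp T, hθT] at key
  simp only [Pi.neg_apply, intervalIntegral.integral_neg, hp, add_sub_cancel, zero_mul,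
    mul_neg, ← sub_eq_add_neg] at key
  have i2 : IntegrableOn (fun s => θ s * g s) (Ioc 0 T) := by
    rw [← integrableOn_Icc_iff_integrableOn_Ioc] at hg ⊢
    exact hg.continuousOn_mul hθ.continuous.continuousOn isCompact_Icc
  have hgc : ContinuousOn (fun s => a - ∫ r in (0 : ℝ)..s, g r) (Icc 0 T) := by
    refine continuousOn_const.sub ?_
    rw [← uIcc_of_le hT]
    apply intervalIntegral.continuousOn_primitive_interval
    rwa [uIcc_of_le hT, integrableOn_Icc_iff_integrableOn_Ioc]
  have i1 : IntegrableOn (fun s => deriv θ s * (a - ∫ r in (0 : ℝ)..s, g r)) (Ioc 0 T) :=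
    ((hd.continuousOn.mul hgc).integrableOn_Icc).mono_set Ioc_subset_Icc_self
  rw [integral_sub i1 i2] at key
  rw [← integral_Ioc_eq_integral_Ioo, ← integral_Ioc_eq_integral_Ioo]
  linear_combination -key

/-- The real test functions of time on `[0,T)`: smooth functions on `ℝ`, vanishing from some time
before `T` on. -/
def IsTimeTest (T : ℝ) (θ : ℝ → ℝ) : Prop :=
  ContDiff ℝ ∞ θ ∧ ∃ T' < T, ∀ t, T' ≤ t → θ t = 0

/-- A distributional solution of `a' = -g`, `a(0) = a₀` on `[0,T)` is almost everywhere equal to the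
absolutely continuous one. -/
theorem ae_eq_primitive_of_forall_timeTest {T : ℝ} (hT : 0 < T) {a g : ℝ → ℂ} (a₀ : ℂ)
    (ha : IntegrableOn a (Ioo 0 T)) (hg : IntegrableOn g (Ioo 0 T))
    (h : ∀ θ : ℝ → ℝ, IsTimeTest T θ →
      (∫ t in Ioo 0 T, ((deriv θ t : ℝ) : ℂ) * a t) + (θ 0 : ℂ) * a₀ =
        ∫ t in Ioo 0 T, (θ t : ℂ) * g t) :
    ∀ᵐ t ∂(volume.restrict (Ioo 0 T)), a t = a₀ - ∫ s in (0 : ℝ)..t, g s := by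
  have hgc : ContinuousOn (fun s => a₀ - ∫ r in (0 : ℝ)..s, g r) (Icc 0 T) := by
    refine continuousOn_const.sub ?_
    rw [← uIcc_of_le hT.le]
    apply intervalIntegral.continuousOn_primitive_interval
    rwa [uIcc_of_le hT.le, integrableOn_Icc_iff_integrableOn_Ioo]
  have hpi : IntegrableOn (fun s => a₀ - ∫ r in (0 : ℝ)..s, g r) (Ioo 0 T) :=
    hgc.integrableOn_Icc.mono_set Ioo_subset_Icc_self
  set f : ℝ → ℂ := fun t => a t - (a₀ - ∫ s in (0 : ℝ)..t, g s) with hf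
  have hfi : IntegrableOn f (Ioo 0 T) := ha.sub hpi
  have hae := isOpen_Ioo.ae_eq_zero_of_integral_contDiff_smul_eq_zero (μ := (volume : Measure ℝ))
    (f := f) (U := Ioo 0 T) hfi.locallyIntegrableOn ?_
  · rw [ae_restrict_iff' measurableSet_Ioo]
    filter_upwards [hae] with t ht hmem
    exact sub_eq_zero.1 (ht hmem)
  intro ψ hψ hψc hψs
  -- the primitive of `ψ` that vanishes near `T` is an admissible test function
  obtain ⟨T', hT', hT'0⟩ : ∃ T' < T, ∀ t, T' ≤ t → t ≤ T → ψ t = 0 := by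
    have hK : IsCompact (tsupport ψ) := hψc
    rcases (tsupport ψ).eq_empty_or_nonempty with he | hne
    · refine ⟨0, hT, fun t _ _ => image_eq_zero_of_notMem_tsupport (by simp [he])⟩
    · obtain ⟨m, hm, hmax⟩ := hK.exists_isMaxOn hne continuousOn_id
      refine ⟨(m + T) / 2, by linarith [(hψs hm).2], fun t ht _ => ?_⟩
      refine image_eq_zero_of_notMem_tsupport fun hmem => ?_
      have : t ≤ m := hmax hmem
      linarith [(hψs hm).2]
  have hT'1 : ∀ t, T' ≤ t → ψ t = 0 := fun t ht => by
    rcases le_or_gt t T with h1 | h1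
    · exact hT'0 t ht h1
    · exact image_eq_zero_of_notMem_tsupport fun hmem => by linarith [(hψs hmem).2]
  set θ : ℝ → ℝ := fun t => ∫ s in T..t, ψ s with hθ
  have hθd : ∀ t, HasDerivAt θ (ψ t) t := fun t =>
    (intervalIntegral.integral_hasDerivAt_right (hψ.continuous.intervalIntegrable _ _)
      (hψ.continuous.stronglyMeasurableAtFilter _ _) hψ.continuous.continuousAt)
  have hθ' : deriv θ = ψ := funext fun t => (hθd t).deriv
  have hθs : ContDiff ℝ ∞ θ := by
    rw [contDiff_infty_iff_deriv]
    exact ⟨fun t => (hθd t).differentiableAt, hθ' ▸ hψ⟩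
  have hθ0 : ∀ t, T' ≤ t → θ t = 0 := by
    intro t ht
    rw [hθ]
    refine (intervalIntegral.integral_congr (g := fun _ => (0 : ℝ)) fun s hs => ?_).trans (by simp)
    exact hT'1 s ((le_min hT'.le ht).trans hs.1)
  have h1 := h θ ⟨hθs, T', hT', hθ0⟩
  have hθc : ContDiff ℝ 1 (fun t => (θ t : ℂ)) :=
    (Complex.ofRealCLM.contDiff.comp hθs).of_le (by exact_mod_cast le_top)
  have hdc : deriv (fun t => (θ t : ℂ)) = fun t => (ψ t : ℂ) :=
    funext fun t => (hθd t).ofReal_comp.deriv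
  have h2 := integral_deriv_mul_primitive hT.le (θ := fun t => (θ t : ℂ)) a₀ hθc
    (by simp [hθ0 T hT'.le]) hg
  rw [hdc] at h2
  rw [hθ'] at h1
  have hb : ∀ F : ℝ → ℂ, IntegrableOn F (Ioo 0 T) →
      IntegrableOn (fun t => (ψ t : ℂ) * F t) (Ioo 0 T) := fun F hF => by
    rw [← integrableOn_Icc_iff_integrableOn_Ioo] at hF ⊢
    exact hF.continuousOn_mul (Complex.continuous_ofReal.comp hψ.continuous).continuousOn
      isCompact_Icc
  have h3 : ∫ t in Ioo 0 T, (ψ t : ℂ) * f t = 0 := by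
    simp only [hf, mul_sub (ψ _ : ℂ) (a _)]
    rw [integral_sub (hb a ha) (hb _ hpi)]
    linear_combination h1 - h2
  rw [← h3, ← integral_indicator measurableSet_Ioo]
  congr 1
  ext1 t
  by_cases ht : t ∈ Ioo 0 T
  · simp [ht, indicator]
  · rw [indicator_of_notMem ht, image_eq_zero_of_notMem_tsupport (fun hm => ht (hψs hm)), zero_smul]

/-- Energy identity for a scalar equation `a' = -g`. -/
theorem normSq_primitive {t : ℝ} (ht : 0 ≤ t) {g : ℝ → ℂ} (a : ℂ) (hg : IntegrableOn g (Ioc 0 t)) :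
    ‖a - ∫ s in (0 : ℝ)..t, g s‖ ^ 2 = ‖a‖ ^ 2 -
      2 * ∫ s in Ioc 0 t, ((starRingEnd ℂ) (a - ∫ r in (0 : ℝ)..s, g r) * g s).re := by
  have hg' : IntegrableOn (fun s => (starRingEnd ℂ) (g s)) (Ioc 0 t) :=
    (Complex.conjCLE.toContinuousLinearMap.integrable_comp hg)
  have key := primitive_mul_primitive' ht a ((starRingEnd ℂ) a) hg.neg hg'.neg
  have hci : ∀ s, ∫ r in (0 : ℝ)..s, (starRingEnd ℂ) (g r) = (starRingEnd ℂ) (∫ r in (0 : ℝ)..s, g r) := by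
    intro s
    simp only [intervalIntegral, map_sub, integral_conj]
  have hgc : ContinuousOn (fun s => a - ∫ r in (0 : ℝ)..s, g r) (Icc 0 t) := by
    refine continuousOn_const.sub ?_
    rw [← uIcc_of_le ht]
    apply intervalIntegral.continuousOn_primitive_interval
    rwa [uIcc_of_le ht, integrableOn_Icc_iff_integrableOn_Ioc]
  have i1 : IntegrableOn (fun s => (starRingEnd ℂ) (a - ∫ r in (0 : ℝ)..s, g r) * g s) (Ioc 0 t) := by
    rw [← integrableOn_Icc_iff_integrableOn_Ioc] at hg ⊢
    exact hg.continuousOn_mul (Complex.continuous_conj.comp_continuousOn hgc) isCompact_Icc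
  rw [intervalIntegral.integral_of_le ht]
  simp only [Pi.neg_apply, integral_neg, intervalIntegral.integral_neg, hci, integral_conj,
    ← sub_eq_add_neg, ← map_sub, Complex.mul_conj] at key
  have e : ∀ s, -g s * (starRingEnd ℂ) (a - ∫ r in (0 : ℝ)..s, g r) +
      (a - ∫ r in (0 : ℝ)..s, g r) * -(starRingEnd ℂ) (g s) =
      ((-2 * ((starRingEnd ℂ) (a - ∫ r in (0 : ℝ)..s, g r) * g s).re : ℝ) : ℂ) := by
    intro s
    apply Complex.ext <;> simp <;> ring
  simp only [e] at key
  rw [integral_complex_ofReal] at key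
  rw [← Complex.normSq_eq_norm_sq, ← Complex.normSq_eq_norm_sq]
  have := congrArg Complex.re key
  simp only [Complex.ofReal_re, Complex.add_re] at this
  rw [this, integral_const_mul]
  ring

/-! ### Sequence model of the energy space and the energy identity -/

/-- The Hilbert space `ℓ²(ℤ)`. A sequence `c` stands for the function of `H¹(𝕋)` with Fourier
coefficients `c n / √(1 + n²)`, so that the norm of `c` is the `H¹` norm of the function. -/
abbrev Seq : Type := lp (fun _ : ℤ => ℂ) 2

/-- The weight `√(1 + n²)`. -/
def jap (n : ℤ) : ℝ := √(1 + (n : ℝ) ^ 2)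

theorem jap_sq (n : ℤ) : jap n ^ 2 = 1 + (n : ℝ) ^ 2 := Real.sq_sqrt (by positivity)

theorem one_le_jap (n : ℤ) : 1 ≤ jap n := Real.one_le_sqrt.2 (by nlinarith [sq_nonneg (n : ℝ)])

theorem jap_pos (n : ℤ) : 0 < jap n := zero_lt_one.trans_le (one_le_jap n)

theorem jap_ne_zero (n : ℤ) : (jap n : ℂ) ≠ 0 := by exact_mod_cast (jap_pos n).ne'

theorem hasSum_normSq_seq (x : Seq) : HasSum (fun n => ‖x n‖ ^ 2) (‖x‖ ^ 2) := by
  have := lp.hasSum_norm (p := 2) (by simp) x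
  simpa only [ENNReal.toReal_ofNat, Real.rpow_two] using this

theorem memlp_two_iff {f : ℤ → ℂ} : Memℓp f 2 ↔ Summable fun n => ‖f n‖ ^ 2 := by
  rw [memℓp_gen_iff (by simp)]
  simp only [ENNReal.toReal_ofNat, Real.rpow_two]

theorem norm_inv_jap_mul_le (n : ℤ) (z : ℂ) : ‖(jap n : ℂ)⁻¹ * z‖ ≤ ‖z‖ := by
  rw [norm_mul, norm_inv, Complex.norm_real, Real.norm_of_nonneg (jap_pos n).le]
  exact mul_le_of_le_one_left (norm_nonneg _) (inv_le_one_of_one_le₀ (one_le_jap n))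

theorem memlp_inv_jap_mul (x : Seq) : Memℓp (fun n => (jap n : ℂ)⁻¹ * x n) 2 :=
  memlp_two_iff.2 (Summable.of_nonneg_of_le (fun _ => by positivity)
    (fun n => pow_le_pow_left₀ (norm_nonneg _) (norm_inv_jap_mul_le n (x n)) 2)
    (hasSum_normSq_seq x).summable)

theorem norm_inv_jap_mul_seq_le (x : Seq) :
    ‖(⟨fun n => (jap n : ℂ)⁻¹ * x n, memlp_inv_jap_mul x⟩ : Seq)‖ ≤ ‖x‖ := by
  have h1 := hasSum_normSq_seq (⟨fun n => (jap n : ℂ)⁻¹ * x n, memlp_inv_jap_mul x⟩ : Seq)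
  have h2 := hasSum_normSq_seq x
  exact le_of_sq_le_sq (hasSum_le
    (fun n => pow_le_pow_left₀ (norm_nonneg _) (norm_inv_jap_mul_le n (x n)) 2) h1 h2)
    (norm_nonneg _)

/-- Division by the weight, as a linear map. -/
def invJapLin : Seq →ₗ[ℂ] Seq where
  toFun x := ⟨fun n => (jap n : ℂ)⁻¹ * x n, memlp_inv_jap_mul x⟩
  map_add' x y := by ext n; exact mul_add _ _ _
  map_smul' r x := by ext n; exact mul_left_comm _ _ _

/-- Division by the weight: the embedding of `H¹` into `L²` on the Fourier side. -/
def invJap : Seq →L[ℂ] Seq :=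
  invJapLin.mkContinuous 1 fun x => by rw [one_mul]; exact norm_inv_jap_mul_seq_le x

theorem invJap_apply (x : Seq) (n : ℤ) : invJap x n = (jap n : ℂ)⁻¹ * x n := rfl

theorem norm_invJap_le (x : Seq) : ‖invJap x‖ ≤ ‖x‖ := norm_inv_jap_mul_seq_le x

theorem inner_invJap (x y : Seq) : inner ℂ (invJap x) y = inner ℂ x (invJap y) := by
  rw [lp.inner_eq_tsum, lp.inner_eq_tsum]
  congr 1
  ext n
  simp only [invJap_apply, RCLike.inner_apply, map_mul, map_inv₀, Complex.conj_ofReal]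
  ring

/-- The evolution equation `∂ₜ a = -⟨n⟩ Γ`, `a(0) = a₀`, mode by mode, for the Fourier coefficients
`a = ⟨n⟩⁻¹ c`; here `⟨n⟩ = √(1 + n²)`. -/
def ModeEq (T : ℝ) (a₀ : Seq) (c Γ : ℝ → Seq) : Prop :=
  ∀ n, ∀ᵐ t ∂(volume.restrict (Ioo 0 T)),
    invJap (c t) n = a₀ n - ∫ s in (0 : ℝ)..t, (jap n : ℂ) * Γ s n

section Energy

variable {T : ℝ} {a₀ : Seq} {c Γ : ℝ → Seq}

theorem memLp_coord (hc : MemLp c 2 (volume.restrict (Ioo 0 T))) (n : ℤ) :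
    MemLp (fun t => c t n) 2 (volume.restrict (Ioo 0 T)) :=
  hc.continuousLinearMap_comp (lp.evalCLM ℂ (fun _ : ℤ => ℂ) 2 n)

theorem integrable_coord (hc : MemLp c 2 (volume.restrict (Ioo 0 T))) (n : ℤ) :
    IntegrableOn (fun t => c t n) (Ioo 0 T) :=
  (memLp_coord hc n).integrable (by norm_num)

theorem abs_re_conj_mul_le (z w : ℂ) : |((starRingEnd ℂ) z * w).re| ≤ ‖z‖ ^ 2 + ‖w‖ ^ 2 := by
  refine (Complex.abs_re_le_norm _).trans ?_
  rw [norm_mul, RCLike.norm_conj]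
  nlinarith [sq_nonneg (‖z‖ - ‖w‖), sq_nonneg (‖z‖ + ‖w‖)]

theorem integrable_inner (hc : MemLp c 2 (volume.restrict (Ioo 0 T)))
    (hΓ : MemLp Γ 2 (volume.restrict (Ioo 0 T))) :
    IntegrableOn (fun s => (inner ℂ (c s) (Γ s)).re) (Ioo 0 T) := by
  refine Integrable.mono (g := fun s => ‖c s‖ ^ 2 + ‖Γ s‖ ^ 2)
    (hc.integrable_norm_pow'.add hΓ.integrable_norm_pow')
    (Complex.continuous_re.comp_aestronglyMeasurable (hc.1.inner hΓ.1))
    (Eventually.of_forall fun s => ?_)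
  rw [Real.norm_of_nonneg (by positivity : 0 ≤ ‖c s‖ ^ 2 + ‖Γ s‖ ^ 2)]
  refine (Complex.abs_re_le_norm _).trans ((norm_inner_le_norm _ _).trans ?_)
  nlinarith [sq_nonneg (‖c s‖ - ‖Γ s‖), sq_nonneg (‖c s‖ + ‖Γ s‖)]

/-- Summation over the modes of the scalar energy identities, at any time up to the final one. -/
theorem hasSum_energy (hc : MemLp c 2 (volume.restrict (Ioo 0 T)))
    (hΓ : MemLp Γ 2 (volume.restrict (Ioo 0 T))) (h : ModeEq T a₀ c Γ) {t : ℝ} (ht : 0 ≤ t)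
    (htT : t ≤ T) :
    HasSum (fun n => ‖a₀ n - ∫ s in (0 : ℝ)..t, (jap n : ℂ) * Γ s n‖ ^ 2)
      (‖a₀‖ ^ 2 - 2 * ∫ s in Ioo 0 t, (inner ℂ (c s) (Γ s)).re) := by
  have hsub : volume.restrict (Ioo 0 t) ≤ (volume.restrict (Ioo 0 T) : Measure ℝ) :=
    Measure.restrict_mono (Ioo_subset_Ioo_right htT) le_rfl
  have hc' := hc.mono_measure hsub
  have hΓ' := hΓ.mono_measure hsub
  have hmode : ∀ n, ‖a₀ n - ∫ s in (0 : ℝ)..t, (jap n : ℂ) * Γ s n‖ ^ 2 = ‖a₀ n‖ ^ 2 -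
      2 * ∫ s in Ioo 0 t, ((starRingEnd ℂ) (c s n) * Γ s n).re := by
    intro n
    have hi : IntegrableOn (fun s => (jap n : ℂ) * Γ s n) (Ioc 0 t) := by
      rw [integrableOn_Ioc_iff_integrableOn_Ioo]
      exact (integrable_coord hΓ' n).const_mul _
    rw [normSq_primitive ht _ hi, integral_Ioc_eq_integral_Ioo]
    congr 2
    refine integral_congr_ae ?_
    have hn := ae_mono hsub (h n)
    filter_upwards [hn] with s hs
    rw [← hs, invJap_apply, map_mul, map_inv₀, Complex.conj_ofReal]
    congr 1
    have := jap_ne_zero n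
    field_simp
  simp only [hmode]
  refine (hasSum_normSq_seq a₀).sub (HasSum.mul_left 2 ?_)
  have hb : ∀ s, HasSum (fun n => ‖c s n‖ ^ 2 + ‖Γ s n‖ ^ 2) (‖c s‖ ^ 2 + ‖Γ s‖ ^ 2) := fun s =>
    (hasSum_normSq_seq _).add (hasSum_normSq_seq _)
  refine hasSum_integral_of_dominated_convergence (fun n s => ‖c s n‖ ^ 2 + ‖Γ s n‖ ^ 2)
    (fun n => ?_) (fun n => Eventually.of_forall fun s => abs_re_conj_mul_le _ _)
    (Eventually.of_forall fun s => (hb s).summable) ?_ (Eventually.of_forall fun s => ?_)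
  · exact Complex.continuous_re.comp_aestronglyMeasurable
      ((Complex.continuous_conj.comp_aestronglyMeasurable (memLp_coord hc' n).1).mul
        (memLp_coord hΓ' n).1)
  · simp only [(hb _).tsum_eq]
    exact hc'.integrable_norm_pow'.add hΓ'.integrable_norm_pow'
  · have := (lp.hasSum_inner (𝕜 := ℂ) (c s) (Γ s)).mapL Complex.reCLM
    simpa [RCLike.inner_apply, mul_comm] using this

/-- Energy identity: `‖f(t)‖² = ‖f(0)‖² - 2 ∫₀ᵗ Re ⟨f, Γ⟩`, with the `L²` norm of `f` and the pairing of
`H¹` with its dual. -/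
theorem energy_identity (hc : MemLp c 2 (volume.restrict (Ioo 0 T)))
    (hΓ : MemLp Γ 2 (volume.restrict (Ioo 0 T))) (h : ModeEq T a₀ c Γ) :
    ∀ᵐ t ∂(volume.restrict (Ioo 0 T)), ‖invJap (c t)‖ ^ 2 =
      ‖a₀‖ ^ 2 - 2 * ∫ s in Ioo 0 t, (inner ℂ (c s) (Γ s)).re := by
  filter_upwards [ae_all_iff.2 h, ae_restrict_mem measurableSet_Ioo] with t ht hmem
  refine (hasSum_normSq_seq _).unique ?_
  simp only [ht]
  exact hasSum_energy hc hΓ h hmem.1.le hmem.2.le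

/-- Energy inequality at the final time, to which the almost everywhere statement of the energy
identity does not apply. -/
theorem energy_final (hT : 0 ≤ T) (hc : MemLp c 2 (volume.restrict (Ioo 0 T)))
    (hΓ : MemLp Γ 2 (volume.restrict (Ioo 0 T))) (h : ModeEq T a₀ c Γ) :
    2 * ∫ s in Ioo 0 T, (inner ℂ (c s) (Γ s)).re ≤ ‖a₀‖ ^ 2 :=
  sub_nonneg.1 ((hasSum_energy hc hΓ h hT le_rfl).nonneg fun _ => by positivity)

end Energy

/-- The elliptic operator `ν (-∂²) + i B` in the sequence model, where `-∂² = 1 - S²` with the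
embedding `S` of `H¹` into `L²`. -/
def ellip (ν : ℝ) (B : Seq →L[ℂ] Seq) : Seq →L[ℂ] Seq :=
  (ν : ℂ) • (ContinuousLinearMap.id ℂ Seq - invJap ∘L invJap) + Complex.I • B

theorem ellip_apply (ν : ℝ) (B : Seq →L[ℂ] Seq) (x : Seq) :
    ellip ν B x = (ν : ℂ) • (x - invJap (invJap x)) + Complex.I • B x := rfl

/-- The coercivity of the elliptic operator: the transport term, being Hermitian, does not contribute
to the energy, so that no bound on its size is needed. -/
theorem re_inner_ellip (ν : ℝ) {B : Seq →L[ℂ] Seq} (hB : ∀ x, (inner ℂ x (B x)).im = 0) (x : Seq) :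
    (inner ℂ x (ellip ν B x)).re = ν * (‖x‖ ^ 2 - ‖invJap x‖ ^ 2) := by
  rw [ellip_apply, inner_add_right, inner_smul_right, inner_smul_right, inner_sub_right,
    ← inner_invJap, inner_self_eq_norm_sq_to_K, inner_self_eq_norm_sq_to_K]
  simp only [Complex.add_re, Complex.mul_re, Complex.I_re, Complex.I_im, hB]
  simp [← Complex.ofReal_pow]

/-- A solution with skew-symmetric transport stays bounded in `L²`. -/
theorem ae_norm_invJap_le {T ν : ℝ} (hν : 0 ≤ ν) {B : Seq →L[ℂ] Seq}
    (hB : ∀ x, (inner ℂ x (B x)).im = 0) {a₀ : Seq} {c : ℝ → Seq}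
    (hc : MemLp c 2 (volume.restrict (Ioo 0 T))) (h : ModeEq T a₀ c fun t => ellip ν B (c t)) :
    ∀ᵐ t ∂(volume.restrict (Ioo 0 T)), ‖invJap (c t)‖ ≤ ‖a₀‖ := by
  filter_upwards [energy_identity hc (hc.continuousLinearMap_comp (ellip ν B)) h] with t ht
  refine le_of_sq_le_sq ?_ (norm_nonneg _)
  rw [ht]
  have : 0 ≤ ∫ s in Ioo 0 t, (inner ℂ (c s) (ellip ν B (c s))).re := by
    refine integral_nonneg fun s => ?_
    simp only [Pi.zero_apply, re_inner_ellip ν hB]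
    have := pow_le_pow_left₀ (norm_nonneg _) (norm_invJap_le (c s)) 2
    exact mul_nonneg hν (by linarith)
  linarith

/-- The norm of `L²(0,T)` with values in `Seq`; on the function side, the norm of `L²(0,T;H¹)`. -/
def timeNorm (T : ℝ) (c : ℝ → Seq) : ℝ := √(∫ t in Ioo 0 T, ‖c t‖ ^ 2)

theorem timeNorm_sq (T : ℝ) (c : ℝ → Seq) : timeNorm T c ^ 2 = ∫ t in Ioo 0 T, ‖c t‖ ^ 2 :=
  Real.sq_sqrt (integral_nonneg fun _ => by positivity)

theorem integral_norm_mul_norm_le {T : ℝ} {c d : ℝ → Seq}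
    (hc : MemLp c 2 (volume.restrict (Ioo 0 T))) (hd : MemLp d 2 (volume.restrict (Ioo 0 T))) :
    ∫ t in Ioo 0 T, ‖c t‖ * ‖d t‖ ≤ timeNorm T c * timeNorm T d := by
  have := integral_mul_le_Lp_mul_Lq_of_nonneg (μ := volume.restrict (Ioo 0 T))
    (Real.HolderConjugate.two_two) (f := fun t => ‖c t‖) (g := fun t => ‖d t‖)
    (Eventually.of_forall fun _ => norm_nonneg _) (Eventually.of_forall fun _ => norm_nonneg _)
    (by simpa using hc.norm) (by simpa using hd.norm)
  simpa [timeNorm, Real.sqrt_eq_rpow] using this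

/-- Stability: two solutions with the same initial value, whose transport operators differ by at
most `η`, differ by a multiple of `η`. The transport term of the second equation drops out of the
energy identity of the difference. -/
theorem stability {T ν η : ℝ} (hT : 0 < T) (hν : 0 < ν) {B₁ B₂ : Seq →L[ℂ] Seq}
    (hB : ∀ x, (inner ℂ x (B₂ x)).im = 0)
    (hη : ∀ x y, ‖inner ℂ x (B₂ y) - inner ℂ x (B₁ y)‖ ≤ η * (‖x‖ * ‖y‖)) {a₀ : Seq} {c d : ℝ → Seq}
    (hc : MemLp c 2 (volume.restrict (Ioo 0 T))) (hd : MemLp d 2 (volume.restrict (Ioo 0 T)))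
    (hce : ModeEq T a₀ c fun t => ellip ν B₁ (c t))
    (hde : ModeEq T a₀ d fun t => ellip ν B₂ (d t)) :
    timeNorm T (d - c) ≤ (2 * T + ν⁻¹) * (η * timeNorm T c) ∧
    ∀ᵐ t ∂(volume.restrict (Ioo 0 T)),
      ‖invJap ((d - c) t)‖ ^ 2 ≤ 2 * (η * timeNorm T c) * timeNorm T (d - c) := by
  have hη0 : 0 ≤ η := by
    -- the hypothesis on `η`, evaluated at a unit vector
    by_contra hneg
    have h1 := hη (lp.single 2 0 1) (lp.single 2 0 1)
    have h2 : ‖(lp.single 2 0 1 : Seq)‖ = 1 := by rw [lp.norm_single (by norm_num)]; simp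
    rw [h2] at h1
    have := norm_nonneg (inner ℂ (lp.single 2 0 1 : Seq) (B₂ (lp.single 2 0 1)) -
      inner ℂ (lp.single 2 0 1 : Seq) (B₁ (lp.single 2 0 1)))
    linarith
  set w := d - c with hw
  have hwL : MemLp w 2 (volume.restrict (Ioo 0 T)) := hd.sub hc
  set Γ : ℝ → Seq := fun t => ellip ν B₂ (d t) - ellip ν B₁ (c t) with hΓ
  have h1L := hc.continuousLinearMap_comp (ellip ν B₁)
  have h2L := hd.continuousLinearMap_comp (ellip ν B₂)
  have hΓL : MemLp Γ 2 (volume.restrict (Ioo 0 T)) := h2L.sub h1L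
  have hwe : ModeEq T 0 w Γ := by
    intro n
    filter_upwards [hce n, hde n, ae_restrict_mem measurableSet_Ioo] with t h1 h2 ht
    have i : ∀ {f : ℝ → Seq}, MemLp f 2 (volume.restrict (Ioo 0 T)) →
        IntervalIntegrable (fun s => (jap n : ℂ) * f s n) volume 0 t := fun hf => by
      rw [intervalIntegrable_iff_integrableOn_Ioo_of_le ht.1.le]
      exact IntegrableOn.mono_set ((integrable_coord hf n).const_mul _)
        (Ioo_subset_Ioo_right ht.2.le)
    simp only [hw, hΓ, Pi.sub_apply, map_sub, lp.coeFn_sub, h1, h2, mul_sub]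
    rw [intervalIntegral.integral_sub (i h2L) (i h1L)]
    simp
  have hre : ∀ s, ν * (‖w s‖ ^ 2 - ‖invJap (w s)‖ ^ 2) - η * (‖c s‖ * ‖w s‖) ≤
      (inner ℂ (w s) (Γ s)).re := by
    intro s
    have e : Γ s = ellip ν B₂ (w s) + Complex.I • (B₂ (c s) - B₁ (c s)) := by
      simp only [hΓ, hw, Pi.sub_apply, ellip_apply, map_sub, smul_sub]
      abel
    rw [e, inner_add_right, Complex.add_re, re_inner_ellip ν hB, inner_smul_right, inner_sub_right]
    have h1 := (Complex.abs_re_le_norm (Complex.I * (inner ℂ (w s) (B₂ (c s)) -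
      inner ℂ (w s) (B₁ (c s)))))
    rw [norm_mul, Complex.norm_I, one_mul] at h1
    have h2 := neg_abs_le (Complex.I * (inner ℂ (w s) (B₂ (c s)) - inner ℂ (w s) (B₁ (c s)))).re
    have h3 := hη (w s) (c s)
    rw [mul_comm ‖w s‖] at h3
    linarith
  have hcw : IntegrableOn (fun s => ‖c s‖ * ‖w s‖) (Ioo 0 T) := hc.norm.integrable_mul hwL.norm
  have hw2 : IntegrableOn (fun s => ‖w s‖ ^ 2) (Ioo 0 T) := hwL.integrable_norm_pow'
  have hSw : MemLp (fun s => invJap (w s)) 2 (volume.restrict (Ioo 0 T)) :=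
    hwL.continuousLinearMap_comp invJap
  have hSw2 : IntegrableOn (fun s => ‖invJap (w s)‖ ^ 2) (Ioo 0 T) := hSw.integrable_norm_pow'
  have hdiff : IntegrableOn (fun s => ‖w s‖ ^ 2 - ‖invJap (w s)‖ ^ 2) (Ioo 0 T) := hw2.sub hSw2
  have hin := integrable_inner hwL hΓL
  have hCS := integral_norm_mul_norm_le hc hwL
  have hsup : ∀ᵐ t ∂(volume.restrict (Ioo 0 T)),
      ‖invJap (w t)‖ ^ 2 ≤ 2 * (η * timeNorm T c) * timeNorm T w := by
    filter_upwards [energy_identity hwL hΓL hwe, ae_restrict_mem measurableSet_Ioo] with t ht hmem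
    rw [ht]
    have hs : Ioo 0 t ⊆ Ioo 0 T := Ioo_subset_Ioo_right hmem.2.le
    have h1 : ∫ s in Ioo 0 t, -(η * (‖c s‖ * ‖w s‖)) ≤ ∫ s in Ioo 0 t, (inner ℂ (w s) (Γ s)).re := by
      refine integral_mono ((hcw.mono_set hs).const_mul η).neg (hin.mono_set hs) fun s => ?_
      have := pow_le_pow_left₀ (norm_nonneg _) (norm_invJap_le (w s)) 2
      refine le_trans ?_ (hre s)
      nlinarith
    have h2 : ∫ s in Ioo 0 t, ‖c s‖ * ‖w s‖ ≤ ∫ s in Ioo 0 T, ‖c s‖ * ‖w s‖ :=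
      setIntegral_mono_set hcw (Eventually.of_forall fun _ => by positivity)
        (Eventually.of_forall hs)
    rw [integral_neg, integral_const_mul] at h1
    have h3 := mul_le_mul_of_nonneg_left (h2.trans hCS) hη0
    simp only [norm_zero]
    nlinarith
  refine ⟨?_, hsup⟩
  -- the energy identity controls the derivative only; integrating the bound `hsup` on the `L²` norm
  -- over `(0,T)` gives the rest of the `H¹` norm, which accounts for the summand `2 * T`
  have hfin := energy_final hT.le hwL hΓL hwe
  have h1 : ∫ s in Ioo 0 T, (ν * (‖w s‖ ^ 2 - ‖invJap (w s)‖ ^ 2) - η * (‖c s‖ * ‖w s‖)) ≤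
      ∫ s in Ioo 0 T, (inner ℂ (w s) (Γ s)).re :=
    integral_mono ((hdiff.const_mul ν).sub (hcw.const_mul η)) hin hre
  rw [integral_sub (hdiff.const_mul ν) (hcw.const_mul η), integral_const_mul,
    integral_const_mul, integral_sub hw2 hSw2, ← timeNorm_sq] at h1
  have h2 : ∫ s in Ioo 0 T, ‖invJap (w s)‖ ^ 2 ≤ T * (2 * (η * timeNorm T c) * timeNorm T w) := by
    have := integral_mono_ae hSw2 (integrable_const _) hsup
    simpa [hT.le] using this
  have h3 := mul_le_mul_of_nonneg_left hCS hη0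
  have hY : 0 ≤ timeNorm T w := Real.sqrt_nonneg _
  have hN : 0 ≤ timeNorm T c := Real.sqrt_nonneg _
  simp only [norm_zero] at hfin
  have h4 : timeNorm T w ^ 2 ≤ (2 * T + ν⁻¹) * (η * timeNorm T c) * timeNorm T w := by
    have h5 : ν * timeNorm T w ^ 2 ≤ ν * (T * (2 * (η * timeNorm T c) * timeNorm T w)) +
        η * (timeNorm T c * timeNorm T w) := by
      have := mul_le_mul_of_nonneg_left h2 hν.le
      nlinarith
    have h6 := mul_le_mul_of_nonneg_left h5 (inv_pos.2 hν).le
    rw [← mul_assoc, inv_mul_cancel₀ hν.ne', one_mul, mul_add, ← mul_assoc ν⁻¹ ν,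
      inv_mul_cancel₀ hν.ne', one_mul] at h6
    linarith
  rcases hY.eq_or_lt with h0 | h0
  · rw [← h0]; positivity
  · rw [pow_two] at h4
    exact le_of_mul_le_mul_right h4 h0

/-! ### Existence for abstract evolution equations: Lions' projection theorem -/

/-- Lions' projection theorem: if `‖R φ‖ ≤ C ‖K φ‖` on a space `Φ` of test objects, then the equation
`⟪K φ, f⟫ = ⟪R φ, h⟫` for all `φ` has a solution `f`. -/
theorem exists_inner_eq_of_norm_le {Φ F H : Type*} [AddCommGroup Φ] [Module ℂ Φ]
    [NormedAddCommGroup F] [InnerProductSpace ℂ F] [CompleteSpace F]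
    [NormedAddCommGroup H] [InnerProductSpace ℂ H]
    (K : Φ →ₗ[ℂ] F) (R : Φ →ₗ[ℂ] H) (C : ℝ) (hC : ∀ φ, ‖R φ‖ ≤ C * ‖K φ‖) (h : H) :
    ∃ f : F, ∀ φ, inner ℂ (K φ) f = inner ℂ (R φ) h := by
  set ℓ : Φ →ₗ[ℂ] ℂ := (innerSL ℂ h : H →ₗ[ℂ] ℂ) ∘ₗ R with hℓ
  have hℓa : ∀ φ, ℓ φ = inner ℂ h (R φ) := fun φ => rfl
  have hker : LinearMap.ker K ≤ LinearMap.ker ℓ := by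
    intro φ hφ
    have h1 := hC φ
    rw [LinearMap.mem_ker.1 hφ, norm_zero, mul_zero, norm_le_zero_iff] at h1
    rw [LinearMap.mem_ker, hℓa, h1, inner_zero_right]
  set g : LinearMap.range K →ₗ[ℂ] ℂ :=
    ((LinearMap.ker K).liftQ ℓ hker) ∘ₗ (K.quotKerEquivRange.symm : _ →ₗ[ℂ] _) with hg
  have hga : ∀ φ, g ⟨K φ, LinearMap.mem_range_self K φ⟩ = ℓ φ := by
    intro φ
    have : K.quotKerEquivRange.symm ⟨K φ, LinearMap.mem_range_self K φ⟩ =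
        (LinearMap.ker K).mkQ φ := K.quotKerEquivRange_symm_apply_image φ _
    simp [hg, this]
  have hgb : ∀ y, ‖g y‖ ≤ ‖h‖ * C * ‖y‖ := by
    rintro ⟨y, φ, rfl⟩
    rw [hga, hℓa]
    refine (norm_inner_le_norm _ _).trans ?_
    rw [mul_assoc]
    exact mul_le_mul_of_nonneg_left (hC φ) (norm_nonneg _)
  obtain ⟨G, hG, -⟩ := exists_extension_norm_eq (LinearMap.range K) (g.mkContinuous _ hgb)
  refine ⟨(InnerProductSpace.toDual ℂ F).symm G, fun φ => ?_⟩
  have h1 : inner ℂ ((InnerProductSpace.toDual ℂ F).symm G) (K φ) = G (K φ) :=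
    InnerProductSpace.toDual_symm_apply
  have h2 : G (K φ) = ℓ φ := (hG ⟨K φ, LinearMap.mem_range_self K φ⟩).trans (hga φ)
  rw [← inner_conj_symm, h1, h2, hℓa, inner_conj_symm]

section Evolution

variable {H : Type*} [NormedAddCommGroup H] [InnerProductSpace ℂ H]

/-- Test functions of time with values in `H`: continuously differentiable functions that vanish
from some time before `T` on. -/
def timeTestSpace (H : Type*) [NormedAddCommGroup H] [InnerProductSpace ℂ H] (T : ℝ) :
    Submodule ℂ (ℝ → H) where
  carrier := {ψ | ContDiff ℝ 1 ψ ∧ ∃ T' < T, ∀ t, T' ≤ t → ψ t = 0}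
  add_mem' := by
    rintro ψ χ ⟨h1, T₁, hT₁, h2⟩ ⟨h3, T₂, hT₂, h4⟩
    refine ⟨h1.add h3, max T₁ T₂, max_lt hT₁ hT₂, fun t ht => ?_⟩
    rw [Pi.add_apply, h2 t ((le_max_left _ _).trans ht), h4 t ((le_max_right _ _).trans ht),
      add_zero]
  zero_mem' := ⟨contDiff_const, T - 1, by linarith, fun _ _ => rfl⟩
  smul_mem' := by
    rintro r ψ ⟨h1, T₁, hT₁, h2⟩
    exact ⟨contDiff_const.smul h1, T₁, hT₁, fun t ht => by rw [Pi.smul_apply, h2 t ht, smul_zero]⟩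

theorem memLp_of_continuous {E : Type*} [NormedAddCommGroup E] {T : ℝ} {f : ℝ → E}
    (hf : Continuous f) (p : ℝ≥0∞) : MemLp f p (volume.restrict (Ioo 0 T)) := by
  obtain ⟨C, hC⟩ := isCompact_Icc.exists_bound_of_continuousOn (s := Icc (0 : ℝ) T)
    hf.continuousOn
  refine MemLp.of_bound hf.aestronglyMeasurable C ?_
  filter_upwards [ae_restrict_mem measurableSet_Ioo] with t ht
  exact hC t (Ioo_subset_Icc_self ht)

variable [CompleteSpace H]

/-- The space-time operator `ψ ↦ -S² ψ' + S² ψ + A* ψ` on test functions, the formal adjoint of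
`c ↦ (S² c)' + S² c + A c`. -/
def evolAdj (S A : H →L[ℂ] H) (ψ : ℝ → H) (t : ℝ) : H :=
  -S (S (deriv ψ t)) + S (S (ψ t)) + A.adjoint (ψ t)

theorem continuous_evolAdj (S A : H →L[ℂ] H) {ψ : ℝ → H} (hψ : ContDiff ℝ 1 ψ) :
    Continuous (evolAdj S A ψ) := by
  have h1 : Continuous (deriv ψ) := hψ.continuous_deriv le_rfl
  have h2 := hψ.continuous
  unfold evolAdj
  fun_prop

/-- The space-time operator as a map into `L²(0,T;H)`. -/
def evolAdjLp (T : ℝ) (S A : H →L[ℂ] H) :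
    timeTestSpace H T →ₗ[ℂ] Lp H 2 (volume.restrict (Ioo 0 T)) where
  toFun ψ := (memLp_of_continuous (continuous_evolAdj S A ψ.2.1) 2).toLp _
  map_add' ψ χ := by
    rw [← MemLp.toLp_add]
    congr 1
    ext t
    have h1 := (ψ.2.1.differentiable one_ne_zero t)
    have h2 := (χ.2.1.differentiable one_ne_zero t)
    simp only [evolAdj, Submodule.coe_add, Pi.add_apply, deriv_add h1 h2, map_add]
    abel
  map_smul' r ψ := by
    rw [RingHom.id_apply, ← MemLp.toLp_const_smul]
    congr 1
    ext t
    have h1 := (ψ.2.1.differentiable one_ne_zero t)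
    simp only [evolAdj, Submodule.coe_smul, Pi.smul_apply, deriv_const_smul r h1, map_smul,
      smul_add, smul_neg]

theorem inner_evolAdjLp {T : ℝ} (S A : H →L[ℂ] H) (ψ : timeTestSpace H T)
    (f : Lp H 2 (volume.restrict (Ioo 0 T))) :
    inner ℂ (evolAdjLp T S A ψ) f = ∫ t in Ioo 0 T, inner ℂ (evolAdj S A ψ t) (f t) := by
  rw [L2.inner_def]
  refine integral_congr_ae ?_
  filter_upwards [(memLp_of_continuous (T := T) (continuous_evolAdj S A ψ.2.1) 2).coeFn_toLp]
    with t ht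
  rw [← ht]
  rfl

/-- Coercivity of the space-time form on test functions. The time derivative contributes
`-∫₀ᵀ (‖S ψ‖²)' / 2 = ‖S ψ(0)‖² / 2`, since `ψ` vanishes at time `T`. -/
theorem coercive_evolAdj {T : ℝ} (hT : 0 ≤ T) (S A : H →L[ℂ] H)
    (hS : ∀ x y, inner ℂ (S x) y = inner ℂ x (S y)) {κ : ℝ}
    (hA : ∀ x, κ * ‖x‖ ^ 2 ≤ (inner ℂ x (A x)).re + ‖S x‖ ^ 2) {ψ : ℝ → H}
    (hψ : ψ ∈ timeTestSpace H T) :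
    ‖S (ψ 0)‖ ^ 2 / 2 + κ * ∫ t in Ioo 0 T, ‖ψ t‖ ^ 2 ≤
      ∫ t in Ioo 0 T, (inner ℂ (evolAdj S A ψ t) (ψ t)).re := by
  obtain ⟨hψ1, T', hT', hψ0⟩ := hψ
  have hψc := hψ1.continuous
  have hdc : Continuous (deriv ψ) := hψ1.continuous_deriv le_rfl
  have hKc := continuous_evolAdj S A hψ1
  have hd : ∀ t, HasDerivAt (fun t => (inner ℂ (S (ψ t)) (S (ψ t))).re)
      (2 * (inner ℂ (S (deriv ψ t)) (S (ψ t))).re) t := by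
    intro t
    have h1 : HasDerivAt (fun t => S (ψ t)) (S (deriv ψ t)) t :=
      (S.restrictScalars ℝ).hasFDerivAt.comp_hasDerivAt t
        (hψ1.differentiable one_ne_zero t).hasDerivAt
    have h2 := Complex.reCLM.hasFDerivAt.comp_hasDerivAt t (h1.inner ℂ h1)
    convert! h2 using 1
    rw [Complex.reCLM_apply, Complex.add_re, ← inner_conj_symm (S (ψ t)), Complex.conj_re]
    ring
  have hftc := intervalIntegral.integral_eq_sub_of_hasDerivAt (a := 0) (b := T)
    (fun t _ => hd t) (Continuous.intervalIntegrable (by fun_prop) _ _)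
  have hn : ∀ x : H, (inner ℂ (S x) (S x)).re = ‖S x‖ ^ 2 := fun x => by
    rw [inner_self_eq_norm_sq_to_K]; simp [← Complex.ofReal_pow]
  rw [hψ0 T hT'.le, map_zero, inner_zero_left, hn, intervalIntegral.integral_of_le hT,
    integral_Ioc_eq_integral_Ioo, integral_const_mul] at hftc
  have hpt : ∀ t, -(inner ℂ (S (deriv ψ t)) (S (ψ t))).re + κ * ‖ψ t‖ ^ 2 ≤
      (inner ℂ (evolAdj S A ψ t) (ψ t)).re := by
    intro t
    have h1 := hA (ψ t)
    rw [evolAdj, inner_add_left, inner_add_left, inner_neg_left, hS (S (deriv ψ t)) (ψ t),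
      hS (S (ψ t)) (ψ t),
      ContinuousLinearMap.adjoint_inner_left, Complex.add_re, Complex.add_re, Complex.neg_re, hn]
    linarith
  have i1 : IntegrableOn (fun t => (inner ℂ (S (deriv ψ t)) (S (ψ t))).re) (Ioo 0 T) :=
    (memLp_of_continuous (by fun_prop) 1).integrable le_rfl
  have i2 : IntegrableOn (fun t => ‖ψ t‖ ^ 2) (Ioo 0 T) :=
    (memLp_of_continuous (by fun_prop) 1).integrable le_rfl
  have i3 : IntegrableOn (fun t => (inner ℂ (evolAdj S A ψ t) (ψ t)).re) (Ioo 0 T) :=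
    (memLp_of_continuous (by fun_prop) 1).integrable le_rfl
  have key := integral_mono (i1.neg.add (i2.const_mul κ)) i3 hpt
  have e : ∫ t in Ioo 0 T, ((-fun t => (inner ℂ (S (deriv ψ t)) (S (ψ t))).re) +
      fun t => κ * ‖ψ t‖ ^ 2) t = -(∫ t in Ioo 0 T, (inner ℂ (S (deriv ψ t)) (S (ψ t))).re) +
      κ * ∫ t in Ioo 0 T, ‖ψ t‖ ^ 2 := by
    rw [integral_add' i1.neg (i2.const_mul κ), integral_neg', integral_const_mul]
  rw [e] at key
  simp only [Complex.zero_re] at hftc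
  linarith

/-- Existence for the evolution equation `(S² c)' + A c = 0`, `S c(0) = a₀`, in weak form, when
`A + S²` is coercive. After the substitution `c = eᵗ c̃` this is the projection theorem in
`L²(0,T;H)`, the coercivity being that of the space-time form. -/
theorem exists_weak_evolution {T : ℝ} (hT : 0 ≤ T) (S A : H →L[ℂ] H)
    (hS : ∀ x y, inner ℂ (S x) y = inner ℂ x (S y)) {κ : ℝ} (hκ : 0 < κ)
    (hA : ∀ x, κ * ‖x‖ ^ 2 ≤ (inner ℂ x (A x)).re + ‖S x‖ ^ 2) (a₀ : H) :
    ∃ c : ℝ → H, MemLp c 2 (volume.restrict (Ioo 0 T)) ∧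
      ∀ θ : ℝ → ℝ, IsTimeTest T θ → ∀ x : H,
        (∫ t in Ioo 0 T, ((deriv θ t : ℝ) : ℂ) * inner ℂ x (S (S (c t)))) +
          (θ 0 : ℂ) * inner ℂ (S x) a₀ =
        ∫ t in Ioo 0 T, (θ t : ℂ) * inner ℂ x (A (c t)) := by
  set R : timeTestSpace H T →ₗ[ℂ] H :=
    (S : H →ₗ[ℂ] H) ∘ₗ (LinearMap.proj (0 : ℝ)) ∘ₗ (timeTestSpace H T).subtype with hR
  have hRa : ∀ ψ : timeTestSpace H T, R ψ = S ((ψ : ℝ → H) 0) := fun ψ => rfl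
  have hbound : ∀ ψ, ‖R ψ‖ ≤ √(2 / κ) * ‖evolAdjLp T S A ψ‖ := by
    intro ψ
    have hψL : MemLp (ψ : ℝ → H) 2 (volume.restrict (Ioo 0 T)) :=
      memLp_of_continuous ψ.2.1.continuous 2
    set J := hψL.toLp (ψ : ℝ → H) with hJ
    have hco := coercive_evolAdj hT S A hS hA ψ.2
    have h1 : ‖J‖ ^ 2 = ∫ t in Ioo 0 T, ‖(ψ : ℝ → H) t‖ ^ 2 := by
      rw [← @inner_self_eq_norm_sq ℂ, L2.inner_def, ← integral_re (L2.integrable_inner _ _)]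
      refine integral_congr_ae ?_
      filter_upwards [hψL.coeFn_toLp] with t ht
      rw [ht, inner_self_eq_norm_sq]
    have h2 : ∫ t in Ioo 0 T, (inner ℂ (evolAdj S A ψ t) ((ψ : ℝ → H) t)).re =
        (inner ℂ (evolAdjLp T S A ψ) J).re := by
      rw [L2.inner_def]
      refine Eq.trans (integral_congr_ae ?_)
        (integral_re (L2.integrable_inner (𝕜 := ℂ) (evolAdjLp T S A ψ) J))
      filter_upwards [hψL.coeFn_toLp,
        (memLp_of_continuous (T := T) (continuous_evolAdj S A ψ.2.1) 2).coeFn_toLp] with t ht ht'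
      rw [ht, ← ht']
      rfl
    rw [← h1, h2] at hco
    have h3 := (Complex.abs_re_le_norm _).trans
      (norm_inner_le_norm (𝕜 := ℂ) (evolAdjLp T S A ψ) J)
    have h4 := (le_abs_self _).trans h3
    set k := ‖evolAdjLp T S A ψ‖ with hk
    have hk0 : 0 ≤ k := norm_nonneg _
    have hJ0 : 0 ≤ ‖J‖ := norm_nonneg _
    have hJk : κ * ‖J‖ ≤ k := by
      rcases hJ0.eq_or_lt with h0 | h0
      · rw [← h0]; simpa using hk0
      · refine le_of_mul_le_mul_right ?_ h0
        nlinarith [sq_nonneg ‖S ((ψ : ℝ → H) 0)‖]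
    refine le_of_sq_le_sq ?_ (by positivity)
    rw [mul_pow, Real.sq_sqrt (by positivity), hRa]
    have h5 : ‖S ((ψ : ℝ → H) 0)‖ ^ 2 ≤ 2 * (k * ‖J‖) := by
      nlinarith [mul_nonneg hκ.le (sq_nonneg ‖J‖)]
    rw [div_mul_eq_mul_div, le_div_iff₀ hκ]
    nlinarith
  obtain ⟨f, hf⟩ := exists_inner_eq_of_norm_le (evolAdjLp T S A) R _ hbound a₀
  have hfL : MemLp (f : ℝ → H) 2 (volume.restrict (Ioo 0 T)) := Lp.memLp f
  have hcL : MemLp (fun t => ((Real.exp t : ℝ) : ℂ) • (f : ℝ → H) t) 2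
      (volume.restrict (Ioo 0 T)) := by
    refine hfL.of_le_mul (c := Real.exp T) ?_ ?_
    · exact (Continuous.aestronglyMeasurable (by fun_prop)).smul hfL.1
    · filter_upwards [ae_restrict_mem measurableSet_Ioo] with t ht
      rw [norm_smul, Complex.norm_real, Real.norm_of_nonneg (Real.exp_pos _).le]
      exact mul_le_mul_of_nonneg_right (Real.exp_le_exp.2 ht.2.le) (norm_nonneg _)
  refine ⟨_, hcL, fun θ hθ x => ?_⟩
  obtain ⟨hθ1, T', hT', hθ0⟩ := hθ
  have hθc : ContDiff ℝ 1 θ := hθ1.of_le (by exact_mod_cast le_top)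
  have hec : ContDiff ℝ 1 fun t : ℝ => ((Real.exp t * θ t : ℝ) : ℂ) :=
    Complex.ofRealCLM.contDiff.comp (Real.contDiff_exp.mul hθc)
  set ψ : timeTestSpace H T := ⟨fun t => ((Real.exp t * θ t : ℝ) : ℂ) • x,
    hec.smul contDiff_const, T', hT', fun t ht => by simp [hθ0 t ht]⟩ with hψ
  have hψd : ∀ t, deriv (ψ : ℝ → H) t = ((Real.exp t * θ t + Real.exp t * deriv θ t : ℝ) : ℂ) • x := by
    intro t
    have h1 := ((Real.hasDerivAt_exp t).mul
      (hθc.differentiable one_ne_zero t).hasDerivAt).ofReal_comp.smul_const x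
    exact h1.deriv
  have hdc : Continuous (deriv θ) := hθc.continuous_deriv le_rfl
  have hint : ∀ (B : H →L[ℂ] H) (g : ℝ → ℝ), Continuous g → IntegrableOn (fun t => (g t : ℂ) *
      inner ℂ x (B (((Real.exp t : ℝ) : ℂ) • (f : ℝ → H) t))) (Ioo 0 T) := by
    intro B g hg
    have h1 : IntegrableOn (fun t => inner ℂ x (B (((Real.exp t : ℝ) : ℂ) • (f : ℝ → H) t)))
        (Ioo 0 T) :=
      ((hcL.continuousLinearMap_comp B).const_inner x).integrable (by norm_num)
    exact MemLp.integrable_mul (p := ⊤) (q := 1)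
      (memLp_of_continuous (Complex.continuous_ofReal.comp hg) ⊤) (memLp_one_iff_integrable.2 h1)
  have key := hf ψ
  rw [inner_evolAdjLp] at key
  have e : ∀ t, inner ℂ (evolAdj S A ψ t) ((f : ℝ → H) t) =
      (θ t : ℂ) * inner ℂ x (A (((Real.exp t : ℝ) : ℂ) • (f : ℝ → H) t)) -
      ((deriv θ t : ℝ) : ℂ) * inner ℂ x (S (S (((Real.exp t : ℝ) : ℂ) • (f : ℝ → H) t))) := by
    intro t
    rw [evolAdj, hψd]
    simp only [hψ, map_smul, inner_add_left, inner_neg_left, inner_smul_left, inner_smul_right,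
      ContinuousLinearMap.adjoint_inner_left, hS, Complex.conj_ofReal]
    push_cast
    ring
  simp only [e] at key
  have i2 : IntegrableOn (fun t => ((deriv θ t : ℝ) : ℂ) *
      inner ℂ x (S (S (((Real.exp t : ℝ) : ℂ) • (f : ℝ → H) t)))) (Ioo 0 T) := hint (S ∘L S) _ hdc
  rw [integral_sub (hint A θ hθ1.continuous) i2, hRa] at key
  simp only [hψ, Real.exp_zero, one_mul, map_smul, inner_smul_left, Complex.conj_ofReal] at key
  simp only [map_smul]
  linear_combination -key

end Evolution

theorem inner_single_one (n : ℤ) (y : Seq) : inner ℂ (lp.single 2 n (1 : ℂ) : Seq) y = y n := by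
  rw [lp.inner_single_left]; simp

/-- Existence of a solution of the evolution equation in the sequence model. -/
theorem exists_modeEq {T ν : ℝ} (hT : 0 < T) (hν : 0 < ν) {B : Seq →L[ℂ] Seq}
    (hB : ∀ x, (inner ℂ x (B x)).im = 0) (a₀ : Seq) :
    ∃ c : ℝ → Seq, MemLp c 2 (volume.restrict (Ioo 0 T)) ∧
      ModeEq T a₀ c fun t => ellip ν B (c t) := by
  obtain ⟨c, hc, hw⟩ := exists_weak_evolution hT.le invJap (ellip ν B) inner_invJap
    (lt_min one_pos hν) (fun x => by
      rw [re_inner_ellip ν hB]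
      have h1 := pow_le_pow_left₀ (norm_nonneg _) (norm_invJap_le x) 2
      have h2 := min_le_left 1 ν
      have h3 := min_le_right 1 ν
      nlinarith [mul_nonneg (sub_nonneg.2 h2) (sq_nonneg ‖invJap x‖),
        mul_nonneg (sub_nonneg.2 h3) (sub_nonneg.2 h1)]) a₀
  refine ⟨c, hc, fun n => ?_⟩
  have h1 := integrable_coord (hc.continuousLinearMap_comp invJap) n
  have h2 := (integrable_coord (hc.continuousLinearMap_comp (ellip ν B)) n).const_mul (jap n : ℂ)
  refine ae_eq_primitive_of_forall_timeTest hT (a₀ n) h1 h2 fun θ hθ => ?_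
  have key := hw θ hθ (lp.single 2 n 1)
  have hj := jap_ne_zero n
  simp only [inner_single_one, inner_invJap, invJap_apply] at key
  have e1 : ∀ t, ((deriv θ t : ℝ) : ℂ) * ((jap n : ℂ)⁻¹ * ((jap n : ℂ)⁻¹ * c t n)) =
      (jap n : ℂ)⁻¹ * (((deriv θ t : ℝ) : ℂ) * invJap (c t) n) := fun t => by
    rw [invJap_apply]; ring
  have e2 : ∀ t, (θ t : ℂ) * ((jap n : ℂ) * ellip ν B (c t) n) =
      (jap n : ℂ) * ((θ t : ℂ) * ellip ν B (c t) n) := fun t => by ring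
  simp only [e1, integral_const_mul] at key
  simp only [e2, integral_const_mul, ← key]
  field_simp

/-! ### A localised trigonometric kernel -/

theorem exists_coe_eq_norm (y : Torus) : ∃ r : ℝ, (r : Torus) = y ∧ ‖y‖ = |r| ∧ |r| ≤ Real.pi := by
  have h2 : (2 * Real.pi) ≠ 0 := Real.two_pi_pos.ne'
  have h : y ∈ ((↑) : ℝ → Torus) '' Icc (-Real.pi) (-Real.pi + 2 * Real.pi) := by
    rw [AddCircle.coe_image_Icc_eq]; trivial
  obtain ⟨r, hr, rfl⟩ := h
  have hr' : |r| ≤ Real.pi := abs_le.2 ⟨hr.1, by linarith [hr.2]⟩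
  refine ⟨r, rfl, ?_, hr'⟩
  rw [AddCircle.norm_coe_eq_abs_iff _ h2, abs_of_pos Real.two_pi_pos]
  linarith

theorem fourier_coe_eq_exp (n : ℤ) (r : ℝ) :
    (fourier n (r : Torus) : ℂ) = Complex.exp (Complex.I * ((n * r : ℝ) : ℂ)) := by
  rw [fourier_coe_apply]
  congr 1
  have : (Real.pi : ℂ) ≠ 0 := by exact_mod_cast Real.pi_ne_zero
  push_cast
  field_simp

theorem norm_fourier_apply (n : ℤ) (x : Torus) : ‖(fourier n x : ℂ)‖ = 1 := by
  rw [fourier_apply]; exact Circle.norm_coe _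

theorem fourier_add_apply (n : ℤ) (x y : Torus) :
    (fourier n (x + y) : ℂ) = fourier n x * fourier n y := by
  simp [fourier_apply, AddCircle.toCircle_add]

theorem norm_fourier_sub_one_le (n : ℤ) (y : Torus) : ‖(fourier n y : ℂ) - 1‖ ≤ |(n : ℝ)| * ‖y‖ := by
  obtain ⟨r, rfl, h, -⟩ := exists_coe_eq_norm y
  rw [fourier_coe_eq_exp, h, ← abs_mul]
  exact Real.norm_exp_I_mul_ofReal_sub_one_le

theorem norm_fourier_sub_le (n : ℤ) (x y : Torus) :
    ‖(fourier n x : ℂ) - fourier n y‖ ≤ |(n : ℝ)| * dist x y := by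
  have h : (fourier n x : ℂ) - fourier n y = fourier n y * (fourier n (x - y) - 1) := by
    rw [mul_sub, ← fourier_add_apply, add_sub_cancel, mul_one]
  rw [h, norm_mul, norm_fourier_apply, one_mul, dist_eq_norm]
  exact norm_fourier_sub_one_le n (x - y)

theorem le_norm_fourier_one_sub_one (y : Torus) :
    2 / Real.pi * ‖y‖ ≤ ‖(fourier 1 y : ℂ) - 1‖ := by
  obtain ⟨r, rfl, h, hr⟩ := exists_coe_eq_norm y
  rw [fourier_coe_eq_exp, h, Complex.norm_exp_I_mul_ofReal_sub_one]
  have h1 := Real.mul_le_sin (x := |r| / 2) (by positivity) (by linarith)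
  have h2 : |Real.sin (r / 2)| = Real.sin (|r| / 2) := by
    rcases abs_cases r with ⟨h3, h4⟩ | ⟨h3, h4⟩
    · rw [h3, abs_of_nonneg (Real.sin_nonneg_of_nonneg_of_le_pi (by linarith)
        (by linarith [Real.pi_pos]))]
    · rw [h3, neg_div, Real.sin_neg, abs_of_nonpos (Real.sin_nonpos_of_nonpos_of_neg_pi_le
        (by linarith) (by linarith [Real.pi_pos]))]
  rw [Int.cast_one, one_mul, norm_mul, Real.norm_ofNat, Real.norm_eq_abs, h2]
  linarith

/-- The one-sided Dirichlet kernel `∑_{k < m} exp (i k y)`. -/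
def dirichlet (m : ℕ) (y : Torus) : ℂ := ∑ i ∈ Finset.range m, fourier (i : ℤ) y

theorem continuous_dirichlet (m : ℕ) : Continuous (dirichlet m) := by
  unfold dirichlet; fun_prop

theorem norm_dirichlet_le (m : ℕ) (y : Torus) : ‖dirichlet m y‖ ≤ m := by
  refine (norm_sum_le _ _).trans (le_of_eq ?_)
  simp only [norm_fourier_apply, Finset.sum_const, Finset.card_range, nsmul_eq_mul, mul_one]

/-- Decay of the Dirichlet kernel, from the formula for a geometric sum. -/
theorem norm_dirichlet_mul_norm_le (m : ℕ) (y : Torus) : ‖dirichlet m y‖ * ‖y‖ ≤ Real.pi := by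
  have h1 : dirichlet m y * ((fourier 1 y : ℂ) - 1) = fourier (m : ℤ) y - 1 := by
    have e : ∀ i : ℕ, (fourier (i : ℤ) y : ℂ) = (fourier 1 y : ℂ) ^ i := by
      intro i
      simp [fourier_apply, AddCircle.toCircle_nsmul]
    simp only [dirichlet, e]
    exact geom_sum_mul _ _
  have h2 : ‖dirichlet m y‖ * ‖(fourier 1 y : ℂ) - 1‖ ≤ 2 := by
    rw [← norm_mul, h1]
    refine (norm_sub_le _ _).trans ?_
    rw [norm_fourier_apply, norm_one]; norm_num
  have h3 := mul_le_mul_of_nonneg_left (le_norm_fourier_one_sub_one y) (norm_nonneg (dirichlet m y))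
  have h4 := h3.trans h2
  have hp := Real.pi_pos
  rw [div_mul_eq_mul_div, mul_div_assoc', div_le_iff₀ hp] at h4
  linarith

/-- The Dirichlet kernel is of size `m` on a ball of radius `1 / m`, where all its summands are close
to `1`. -/
theorem half_le_norm_dirichlet {m : ℕ} {y : Torus} (hy : m * ‖y‖ ≤ 1) :
    (m : ℝ) / 2 ≤ ‖dirichlet m y‖ := by
  have h1 : ‖dirichlet m y - m‖ ≤ m / 2 := by
    have e : dirichlet m y - m = ∑ i ∈ Finset.range m, ((fourier (i : ℤ) y : ℂ) - 1) := by
      simp [dirichlet]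
    rw [e]
    have hs : ∑ i ∈ Finset.range m, ((i : ℕ) : ℝ) ≤ (m : ℝ) * m / 2 := by
      have := Finset.sum_range_id_mul_two m
      have h2 : ((∑ i ∈ Finset.range m, i : ℕ) : ℝ) * 2 = ((m * (m - 1) : ℕ) : ℝ) := by
        exact_mod_cast this
      push_cast at h2
      have h3 : ((m - 1 : ℕ) : ℝ) ≤ m := by exact_mod_cast Nat.sub_le m 1
      nlinarith [Nat.cast_nonneg (α := ℝ) m]
    refine (norm_sum_le _ _).trans ((Finset.sum_le_sum fun (i : ℕ) _ =>
      (norm_fourier_sub_one_le (i : ℤ) y)).trans ?_)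
    simp only [Int.cast_natCast, Nat.abs_cast]
    rw [← Finset.sum_mul]
    have := mul_le_mul_of_nonneg_right hs (norm_nonneg y)
    nlinarith [Nat.cast_nonneg (α := ℝ) m]
  have h2 := norm_sub_norm_le (m : ℂ) (dirichlet m y)
  rw [norm_sub_rev, Complex.norm_natCast] at h2
  linarith

theorem haar_closedBall {r : ℝ} (hr : r ≤ Real.pi) (x : Torus) :
    haar (Metric.closedBall x r) = ENNReal.ofReal (r / Real.pi) := by
  have h1 := AddCircle.volume_closedBall (T := 2 * Real.pi) (x := x) r
  rw [AddCircle.volume_eq_smul_haarAddCircle, Measure.smul_apply, smul_eq_mul,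
    min_eq_right (by linarith)] at h1
  have hp := Real.pi_pos
  rw [← ENNReal.mul_right_inj (a := ENNReal.ofReal (2 * Real.pi)) (by simpa using hp)
    ENNReal.ofReal_ne_top, h1, ← ENNReal.ofReal_mul (by positivity)]
  congr 1
  field_simp

/-- The unnormalised kernel `|D_m|^(2k)`. -/
def kernelNum (m k : ℕ) (y : Torus) : ℝ := ‖dirichlet m y‖ ^ (2 * k)

/-- The localised kernel `|D_m|^(2k) / ∫ |D_m|^(2k)`, a trigonometric polynomial of degree
`k (m - 1)`; it decays at distance `d` like `m (m d)^(-2k)`. -/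
def kernel (m k : ℕ) (y : Torus) : ℝ := kernelNum m k y / ∫ z, kernelNum m k z ∂haar

theorem continuous_kernelNum (m k : ℕ) : Continuous (kernelNum m k) :=
  (continuous_dirichlet m).norm.pow _

theorem kernelNum_nonneg (m k : ℕ) (y : Torus) : 0 ≤ kernelNum m k y := by
  unfold kernelNum; positivity

theorem integrable_of_continuous {E : Type*} [NormedAddCommGroup E] {f : Torus → E}
    (hf : Continuous f) : Integrable f haar :=
  hf.integrable_of_hasCompactSupport (HasCompactSupport.of_compactSpace _)

theorem le_integral_kernelNum {m : ℕ} (hm : 0 < m) (k : ℕ) :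
    ((m : ℝ) / 2) ^ (2 * k) * (1 / (Real.pi * m)) ≤ ∫ z, kernelNum m k z ∂haar := by
  have hm' : (0 : ℝ) < m := by exact_mod_cast hm
  have hp := Real.pi_pos
  have hr : 1 / (m : ℝ) ≤ Real.pi := by
    rw [div_le_iff₀ hm']
    have : (1 : ℝ) ≤ m := by exact_mod_cast hm
    nlinarith [Real.pi_gt_three]
  set b := Metric.closedBall (0 : Torus) (1 / m) with hb
  have h1 : ∫ z, b.indicator (fun _ => ((m : ℝ) / 2) ^ (2 * k)) z ∂haar ≤
      ∫ z, kernelNum m k z ∂haar := by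
    refine integral_mono ((integrable_const _).indicator Metric.isClosed_closedBall.measurableSet)
      (integrable_of_continuous (continuous_kernelNum m k)) fun z => ?_
    by_cases hz : z ∈ b
    · rw [indicator_of_mem hz]
      refine pow_le_pow_left₀ (by positivity) (half_le_norm_dirichlet ?_) _
      rw [hb, mem_closedBall_zero_iff, le_div_iff₀ hm'] at hz
      linarith
    · rw [indicator_of_notMem hz]
      exact kernelNum_nonneg m k z
  rw [integral_indicator_const _ Metric.isClosed_closedBall.measurableSet, measureReal_def,
    haar_closedBall hr, ENNReal.toReal_ofReal (by positivity), smul_eq_mul] at h1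
  refine le_trans (le_of_eq ?_) h1
  rw [div_div, mul_comm (m : ℝ), mul_comm]

theorem integral_kernelNum_pos {m : ℕ} (hm : 0 < m) (k : ℕ) :
    0 < ∫ z, kernelNum m k z ∂haar := by
  have hm' : (0 : ℝ) < m := by exact_mod_cast hm
  have := Real.pi_pos
  exact lt_of_lt_of_le (by positivity) (le_integral_kernelNum hm k)

theorem continuous_kernel (m k : ℕ) : Continuous (kernel m k) :=
  (continuous_kernelNum m k).div_const _

theorem kernel_nonneg (m k : ℕ) (y : Torus) : 0 ≤ kernel m k y :=
  div_nonneg (kernelNum_nonneg m k y) (integral_nonneg fun z => kernelNum_nonneg m k z)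

theorem integral_kernel {m : ℕ} (hm : 0 < m) (k : ℕ) : ∫ z, kernel m k z ∂haar = 1 := by
  simp only [kernel]
  rw [integral_div, div_self (integral_kernelNum_pos hm k).ne']

/-- Decay of the kernel: interpolation between `|D_m| ≤ m` and `|D_m(y)| ≤ π / |y|`, divided by the
lower bound `m^(2k-1)`, up to constants, for the integral of `|D_m|^(2k)`. -/
theorem kernel_mul_rpow_le {m : ℕ} (hm : 0 < m) {k : ℕ} {τ : ℝ} (hτ : 0 ≤ τ) (hτk : τ ≤ 2 * k)
    (y : Torus) :
    kernel m k y * ‖y‖ ^ τ ≤ Real.pi ^ (τ + 1) * 2 ^ (2 * k) * (m : ℝ) ^ (1 - τ) := by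
  have hm' : (0 : ℝ) < m := by exact_mod_cast hm
  have hp := Real.pi_pos
  have hZ := le_integral_kernelNum hm k
  have h1 : kernelNum m k y * ‖y‖ ^ τ ≤ (m : ℝ) ^ (2 * k - τ) * Real.pi ^ τ := by
    have e : kernelNum m k y = ‖dirichlet m y‖ ^ (2 * k - τ) * ‖dirichlet m y‖ ^ τ := by
      rw [kernelNum, ← Real.rpow_natCast, ← Real.rpow_add_of_nonneg (norm_nonneg _) (by linarith) hτ]
      push_cast
      congr 1
      ring
    rw [e, mul_assoc, ← Real.mul_rpow (norm_nonneg _) (norm_nonneg _)]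
    exact mul_le_mul
      (Real.rpow_le_rpow (norm_nonneg _) (norm_dirichlet_le m y) (by linarith))
      (Real.rpow_le_rpow (by positivity) (norm_dirichlet_mul_norm_le m y) hτ)
      (by positivity) (by positivity)
  rw [kernel, div_mul_eq_mul_div, div_le_iff₀ (integral_kernelNum_pos hm k)]
  refine h1.trans ?_
  refine le_trans (le_of_eq ?_) (mul_le_mul_of_nonneg_left hZ (by positivity))
  rw [div_pow, Real.rpow_sub hm', Real.rpow_sub hm', Real.rpow_add hp, Real.rpow_one, Real.rpow_one,
    ← Nat.cast_ofNat (n := 2), ← Nat.cast_mul, Real.rpow_natCast]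
  have := Real.rpow_pos_of_pos hm' τ
  field_simp

/-- Continuous functions with Fourier coefficients supported in `[-M, M]`. -/
def BandLimited (M : ℕ) (f : Torus → ℂ) : Prop :=
  Continuous f ∧ ∀ n : ℤ, M < n.natAbs → fourierCoeff f n = 0

theorem fourierCoeff_fourier_mul (f : Torus → ℂ) (i n : ℤ) :
    fourierCoeff (fun x => (fourier i x : ℂ) * f x) n = fourierCoeff f (n - i) := by
  unfold fourierCoeff
  congr 1
  ext x
  rw [smul_eq_mul, smul_eq_mul, ← mul_assoc, ← fourier_add, neg_sub, ← sub_eq_neg_add]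

theorem BandLimited.fourier_mul {M r : ℕ} {f : Torus → ℂ} (hf : BandLimited M f) {i : ℤ}
    (hi : i.natAbs ≤ r) : BandLimited (M + r) fun x => (fourier i x : ℂ) * f x :=
  ⟨(map_continuous _).mul hf.1, fun n hn => by
    rw [fourierCoeff_fourier_mul]
    exact hf.2 _ (by omega)⟩

theorem BandLimited.sum {ι : Type*} {M : ℕ} (s : Finset ι) {f : ι → Torus → ℂ}
    (hf : ∀ i ∈ s, BandLimited M (f i)) : BandLimited M fun x => ∑ i ∈ s, f i x := by
  refine ⟨continuous_finsetSum _ fun i hi => (hf i hi).1, fun n hn => ?_⟩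
  have h := fourierCoeff.sum (T := 2 * Real.pi) s f fun i hi => integrable_of_continuous (hf i hi).1
  have e : (fun x => ∑ i ∈ s, f i x) = ∑ i ∈ s, f i := by ext x; simp
  rw [e, h, Finset.sum_apply]
  exact Finset.sum_eq_zero fun i hi => (hf i hi).2 n hn

theorem bandLimited_kernelNum (m k : ℕ) :
    BandLimited (k * (m - 1)) fun y => (kernelNum m k y : ℂ) := by
  induction k with
  | zero =>
    refine ⟨Complex.continuous_ofReal.comp (continuous_kernelNum m 0), fun n hn => ?_⟩
    have h1 : (fun y => (kernelNum m 0 y : ℂ)) = (fourier 0 : C(Torus, ℂ)) := by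
      ext y; simp [kernelNum]
    rw [h1, fourierCoeff_fourier, Pi.single_apply, if_neg]
    rintro rfl; simp at hn
  | succ k ih =>
    have e : (fun y => (kernelNum m (k + 1) y : ℂ)) = fun y => ∑ i ∈ Finset.range m,
        ∑ l ∈ Finset.range m, (fourier ((i : ℤ) - l) y : ℂ) * (kernelNum m k y : ℂ) := by
      ext y
      simp only [kernelNum, ← Finset.sum_mul]
      have h1 : ∑ i ∈ Finset.range m, ∑ l ∈ Finset.range m, (fourier ((i : ℤ) - l) y : ℂ) =
          dirichlet m y * (starRingEnd ℂ) (dirichlet m y) := by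
        simp only [dirichlet, map_sum, Finset.sum_mul_sum, sub_eq_add_neg, fourier_add, fourier_neg]
      rw [h1, Complex.mul_conj, Complex.normSq_eq_norm_sq]
      push_cast
      ring
    rw [e, Nat.succ_mul]
    refine BandLimited.sum _ fun i hi => BandLimited.sum _ fun l hl => ih.fourier_mul ?_
    rw [Finset.mem_range] at hi hl
    omega

theorem fourierCoeff_kernel {m k : ℕ} {n : ℤ} (hn : k * (m - 1) < n.natAbs) :
    fourierCoeff (fun y => (kernel m k y : ℂ)) n = 0 := by
  have e : (fun y => (kernel m k y : ℂ)) = fun y =>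
      ((∫ z, kernelNum m k z ∂haar : ℝ) : ℂ)⁻¹ * (kernelNum m k y : ℂ) := by
    ext y; rw [kernel]; push_cast; rw [div_eq_inv_mul]
  rw [e, fourierCoeff.const_mul, (bandLimited_kernelNum m k).2 n hn, mul_zero]

/-- Frequencies above the degree of the kernel are annihilated by convolution with it. -/
theorem integral_fourier_mul_kernel {m k : ℕ} {n : ℤ} (hn : k * (m - 1) < n.natAbs) (z : Torus) :
    ∫ x, (fourier n x : ℂ) * (kernel m k (x - z) : ℂ) ∂haar = 0 := by
  have h1 := integral_add_right_eq_self (μ := haar)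
    (fun x => (fourier n x : ℂ) * (kernel m k (x - z) : ℂ)) z
  have h2 := fourierCoeff_kernel (m := m) (k := k) (n := -n) (by simpa using hn)
  rw [fourierCoeff] at h2
  rw [← h1]
  simp only [add_sub_cancel_right, fourier_add_apply, neg_neg, smul_eq_mul] at h2 ⊢
  have e : ∀ x : Torus, (fourier n x : ℂ) * fourier n z * (kernel m k x : ℂ) =
      fourier n z * (fourier n x * (kernel m k x : ℂ)) := fun x => by ring
  simp only [e]
  rw [integral_const_mul, h2, mul_zero]

/-! ### Pairing a frequency block with a Sobolev function -/

/-- The trigonometric polynomial with coefficients `c n`, `|n| ≤ M`. -/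
def trig (c : ℤ → ℂ) (M : ℕ) (x : Torus) : ℂ :=
  ∑ n ∈ Finset.Icc (-(M : ℤ)) M, c n * fourier n x

theorem continuous_trig (c : ℤ → ℂ) (M : ℕ) : Continuous (trig c M) := by
  unfold trig; fun_prop

theorem fourierCoeff_trig (c : ℤ → ℂ) (M : ℕ) (n : ℤ) :
    fourierCoeff (trig c M) n = if n ∈ Finset.Icc (-(M : ℤ)) M then c n else 0 := by
  have h := fourierCoeff.sum (T := 2 * Real.pi) (Finset.Icc (-(M : ℤ)) M)
    (fun n x => c n * (fourier n x : ℂ)) fun i _ => integrable_of_continuous (by fun_prop)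
  have e : trig c M = ∑ n ∈ Finset.Icc (-(M : ℤ)) M, fun x => c n * (fourier n x : ℂ) := by
    ext x; simp [trig]
  rw [e, h, Finset.sum_apply]
  simp only [fourierCoeff.const_mul, fourierCoeff_fourier, Pi.single_apply, mul_ite, mul_one,
    mul_zero]
  exact Finset.sum_ite_eq _ _ _

theorem norm_fourierCoeff_le (f : Torus → ℂ) (n : ℤ) : ‖fourierCoeff f n‖ ≤ ∫ x, ‖f x‖ ∂haar := by
  refine (norm_integral_le_integral_norm _).trans (le_of_eq ?_)
  simp only [smul_eq_mul, norm_mul, norm_fourier_apply, one_mul]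

/-- Nikolskii's inequality between the supremum and the `L¹` norm. -/
theorem norm_trig_le (c : ℤ → ℂ) (M : ℕ) (x : Torus) :
    ‖trig c M x‖ ≤ (2 * M + 1) * ∫ y, ‖trig c M y‖ ∂haar := by
  have h : ∀ n ∈ Finset.Icc (-(M : ℤ)) M, ‖c n * (fourier n x : ℂ)‖ ≤
      ∫ y, ‖trig c M y‖ ∂haar := by
    intro n hn
    have := norm_fourierCoeff_le (trig c M) n
    rw [fourierCoeff_trig, if_pos hn] at this
    rwa [norm_mul, norm_fourier_apply, mul_one]
  refine (norm_sum_le_of_le _ h).trans (le_of_eq ?_)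
  rw [Finset.sum_const, Int.card_Icc, nsmul_eq_mul]
  have : ((M : ℤ) + 1 - -(M : ℤ)).toNat = 2 * M + 1 := by omega
  rw [this]
  push_cast
  ring

/-- Nikolskii's inequality between the `L^p` and the `L¹` norm, by interpolation with the supremum. -/
theorem lintegral_trig_rpow_le (c : ℤ → ℂ) (M : ℕ) {p q : ℝ} (hpq : p.HolderConjugate q) :
    (∫⁻ x, ‖trig c M x‖ₑ ^ p ∂haar) ^ (1 / p) ≤
      ENNReal.ofReal ((2 * M + 1) ^ (1 / q)) * ∫⁻ x, ‖trig c M x‖ₑ ∂haar := by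
  set N := ∫⁻ x, ‖trig c M x‖ₑ ∂haar with hN
  have hNr : ENNReal.ofReal (∫ y, ‖trig c M y‖ ∂haar) = N :=
    ofReal_integral_norm_eq_lintegral_enorm (integrable_of_continuous (continuous_trig c M))
  have hsup : ∀ x, ‖trig c M x‖ₑ ≤ ENNReal.ofReal (2 * M + 1) * N := fun x => by
    rw [← hNr, ← ENNReal.ofReal_mul (by positivity), ← ofReal_norm]
    exact ENNReal.ofReal_le_ofReal (norm_trig_le c M x)
  have hp := hpq.pos
  have hp1 := hpq.sub_one_pos
  have hsplit : ∀ a : ℝ≥0∞, a ^ (p - 1) * a = a ^ p := fun a => by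
    have := ENNReal.rpow_add_of_nonneg (x := a) (p - 1) 1 hp1.le zero_le_one
    rw [sub_add_cancel, ENNReal.rpow_one] at this
    exact this.symm
  have h1 : ∫⁻ x, ‖trig c M x‖ₑ ^ p ∂haar ≤ (ENNReal.ofReal (2 * M + 1) * N) ^ (p - 1) * N := by
    rw [hN, ← lintegral_const_mul _ (by exact (continuous_trig c M).measurable.enorm), ← hN]
    refine lintegral_mono fun x => ?_
    rw [← hsplit]
    gcongr
    exact hsup x
  refine (ENNReal.rpow_le_rpow h1 (by positivity)).trans (le_of_eq ?_)
  have e2 : (ENNReal.ofReal (2 * M + 1) * N) ^ (p - 1) * N =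
      ENNReal.ofReal (2 * M + 1) ^ (p - 1) * N ^ p := by
    rw [ENNReal.mul_rpow_of_nonneg _ _ hp1.le, mul_assoc, hsplit]
  rw [e2, ENNReal.mul_rpow_of_nonneg _ _ (by positivity), ← ENNReal.rpow_mul, ← ENNReal.rpow_mul,
    mul_one_div_cancel hp.ne', ENNReal.rpow_one, ENNReal.ofReal_rpow_of_nonneg (by positivity)
      (by have := hpq.symm.pos; positivity)]
  congr 3
  have := hpq.inv_add_inv_eq_one
  field_simp at this ⊢
  linarith

/-- The Gagliardo seminorm to the power `q`. -/
def gagliardo (s q : ℝ) (g : Torus → ℂ) : ℝ≥0∞ :=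
  ∫⁻ x, ∫⁻ y, ‖g x - g y‖ₑ ^ q / edist x y ^ (1 + s * q) ∂haar ∂haar

theorem gagliardo_le_sobolevNorm {s q : ℝ} (hq : 0 < q) (g : Torus → ℂ) :
    gagliardo s q g ^ (1 / q) ≤ sobolevNorm s q g :=
  ENNReal.rpow_le_rpow le_add_self (by positivity)

theorem lintegral_rpow_le_sobolevNorm {s q : ℝ} (hq : 0 < q) (g : Torus → ℂ) :
    (∫⁻ x, ‖g x‖ₑ ^ q ∂haar) ^ (1 / q) ≤ sobolevNorm s q g :=
  ENNReal.rpow_le_rpow le_self_add (by positivity)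

theorem eLpNorm_le_sobolevNorm {s q : ℝ} (hq : 0 < q) (g : Torus → ℂ) :
    eLpNorm g (ENNReal.ofReal q) haar ≤ sobolevNorm s q g := by
  rw [eLpNorm_eq_lintegral_rpow_enorm_toReal (by simpa using hq) ENNReal.ofReal_ne_top,
    ENNReal.toReal_ofReal hq.le]
  exact lintegral_rpow_le_sobolevNorm hq g

theorem memLp_of_sobolevNorm {s q : ℝ} (hq : 0 < q) {g : Torus → ℂ}
    (hg : AEStronglyMeasurable g haar) (h : sobolevNorm s q g < ⊤) :
    MemLp g (ENNReal.ofReal q) haar :=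
  ⟨hg, (eLpNorm_le_sobolevNorm hq g).trans_lt h⟩

theorem integrable_of_sobolevNorm {s q : ℝ} (hq : 1 ≤ q) {g : Torus → ℂ}
    (hg : AEStronglyMeasurable g haar) (h : sobolevNorm s q g < ⊤) : Integrable g haar :=
  (memLp_of_sobolevNorm (by linarith) hg h).integrable (by simpa using hq)

/-- Averages of differences against the kernel are controlled by the Gagliardo seminorm. -/
theorem lintegral_kernel_le {s q : ℝ} (hs : 0 < s) (hq : 1 < q) {m : ℕ} (hm : 0 < m) {k : ℕ}
    (hk : 1 + s * q ≤ 2 * k) (g : Torus → ℂ) :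
    ∫⁻ x, ∫⁻ z, ENNReal.ofReal (kernel m k (x - z)) * ‖g x - g z‖ₑ ^ q ∂haar ∂haar ≤
      ENNReal.ofReal (Real.pi ^ (s * q + 2) * 2 ^ (2 * k) * (m : ℝ) ^ (-(s * q))) *
        gagliardo s q g := by
  have hsq : 0 < s * q := by positivity
  rw [gagliardo, ← lintegral_const_mul' _ _ ENNReal.ofReal_ne_top]
  refine lintegral_mono fun x => ?_
  rw [← lintegral_const_mul' _ _ ENNReal.ofReal_ne_top]
  refine lintegral_mono fun z => ?_
  rcases eq_or_ne x z with rfl | hxz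
  · simp [show 0 < q by linarith]
  have hd : 0 < dist x z := dist_pos.2 hxz
  have hk := kernel_mul_rpow_le hm (τ := 1 + s * q) (by linarith) hk (x - z)
  rw [← dist_eq_norm, show 1 + s * q + 1 = s * q + 2 by ring,
    show 1 - (1 + s * q) = -(s * q) by ring] at hk
  set A := Real.pi ^ (s * q + 2) * 2 ^ (2 * k) * (m : ℝ) ^ (-(s * q))
  have h2 : kernel m k (x - z) ≤ A / dist x z ^ (1 + s * q) := by
    rwa [le_div_iff₀ (by positivity)]
  rw [edist_dist, ENNReal.ofReal_rpow_of_pos hd, div_eq_mul_inv (‖g x - g z‖ₑ ^ q),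
    mul_left_comm, mul_comm (ENNReal.ofReal (kernel m k (x - z)))]
  gcongr
  rw [← div_eq_mul_inv, ← ENNReal.ofReal_div_of_pos (by positivity)]
  exact ENNReal.ofReal_le_ofReal h2

theorem lintegral_kernel_eq_one {m : ℕ} (hm : 0 < m) (k : ℕ) (x : Torus) :
    ∫⁻ z, ENNReal.ofReal (kernel m k (x - z)) ∂haar = 1 := by
  rw [← ofReal_integral_eq_lintegral_ofReal, integral_sub_left_eq_self (kernel m k) haar x,
    integral_kernel hm, ENNReal.ofReal_one]
  · exact integrable_of_continuous ((continuous_kernel m k).comp (by fun_prop))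
  · exact Eventually.of_forall fun z => kernel_nonneg m k _

/-- Subtracting from `g` its average against the kernel does not change the pairing with frequencies
above the degree of the kernel. -/
theorem integral_trig_mul_eq {c : ℤ → ℂ} {M m k : ℕ} (hm : 0 < m)
    (hc : ∀ n : ℤ, n.natAbs ≤ k * (m - 1) → c n = 0) {g : Torus → ℂ} (hg : Integrable g haar) :
    ∫ x, trig c M x * g x ∂haar = ∫ z : Torus × Torus,
      trig c M z.1 * (kernel m k (z.1 - z.2) : ℂ) * (g z.1 - g z.2) ∂(haar.prod haar) := by
  have hQ := continuous_trig c M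
  have hK := continuous_kernel m k
  have hF : Continuous fun z : Torus × Torus => trig c M z.1 * (kernel m k (z.1 - z.2) : ℂ) := by
    fun_prop
  obtain ⟨C, hC⟩ := isCompact_univ.exists_bound_of_continuousOn hF.continuousOn
  have hC' : ∀ z : Torus × Torus, ‖trig c M z.1 * (kernel m k (z.1 - z.2) : ℂ)‖ ≤ C :=
    fun z => hC z trivial
  have i1 : Integrable (fun z : Torus × Torus =>
      trig c M z.1 * (kernel m k (z.1 - z.2) : ℂ) * g z.1) (haar.prod haar) :=
    (hg.comp_fst haar).bdd_mul hF.aestronglyMeasurable (Eventually.of_forall hC')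
  have i2 : Integrable (fun z : Torus × Torus =>
      trig c M z.1 * (kernel m k (z.1 - z.2) : ℂ) * g z.2) (haar.prod haar) :=
    (hg.comp_snd haar).bdd_mul hF.aestronglyMeasurable (Eventually.of_forall hC')
  simp only [mul_sub]
  rw [integral_sub i1 i2, integral_prod _ i1, integral_prod_symm _ i2]
  have e1 : ∀ x, ∫ z, trig c M x * (kernel m k (x - z) : ℂ) * g x ∂haar = trig c M x * g x := by
    intro x
    have : ∫ z, (kernel m k (x - z) : ℂ) ∂haar = 1 := by
      rw [integral_complex_ofReal, integral_sub_left_eq_self (kernel m k) haar x, integral_kernel hm,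
        Complex.ofReal_one]
    rw [integral_mul_const, integral_const_mul, this, mul_one]
  have e2 : ∀ z, ∫ x, trig c M x * (kernel m k (x - z) : ℂ) * g z ∂haar = 0 := by
    intro z
    rw [integral_mul_const]
    have : ∫ x, trig c M x * (kernel m k (x - z) : ℂ) ∂haar = 0 := by
      simp only [trig, Finset.sum_mul]
      rw [integral_finsetSum _ fun n _ => integrable_of_continuous (by fun_prop)]
      refine Finset.sum_eq_zero fun n _ => ?_
      simp only [mul_assoc]
      rw [integral_const_mul]
      by_cases hn : n.natAbs ≤ k * (m - 1)
      · rw [hc n hn, zero_mul]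
      · rw [integral_fourier_mul_kernel (not_le.1 hn), mul_zero]
    rw [this, zero_mul]
  simp only [e1, e2, integral_zero, sub_zero]

/-- Pairing of a trigonometric polynomial `Q` with frequencies above `k (m - 1)` with a Sobolev
function `g`. The pairing is a double integral of `Q(x) K(x - z) (g(x) - g(z))`; by Hölder's
inequality with respect to the measure `K(x - z) dx dz` it is at most `‖Q‖_{L^p}` times an average of
`|g(x) - g(z)|^q`, which the Gagliardo seminorm controls. -/
theorem enorm_integral_trig_mul_le {s q : ℝ} (hs : 0 < s) (hq : 1 < q) {c : ℤ → ℂ} {M m k : ℕ}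
    (hm : 0 < m) (hk : 1 + s * q ≤ 2 * k) (hc : ∀ n : ℤ, n.natAbs ≤ k * (m - 1) → c n = 0)
    {g : Torus → ℂ} (hgm : AEStronglyMeasurable g haar) (hg : sobolevNorm s q g < ⊤) :
    ‖∫ x, trig c M x * g x ∂haar‖ₑ ≤
      ENNReal.ofReal ((2 * M + 1) ^ (1 / q) *
        (Real.pi ^ (s * q + 2) * 2 ^ (2 * k) * (m : ℝ) ^ (-(s * q))) ^ (1 / q)) *
      (∫⁻ x, ‖trig c M x‖ₑ ∂haar) * sobolevNorm s q g := by
  have hpq : (q / (q - 1)).HolderConjugate q :=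
    (Real.HolderConjugate.conjExponent hq).symm
  set p := q / (q - 1)
  have hq0 : 0 < q := by linarith
  have hQ := continuous_trig c M
  have hK := continuous_kernel m k
  rw [integral_trig_mul_eq hm hc (integrable_of_sobolevNorm hq.le hgm hg)]
  set κ : Torus × Torus → ℝ≥0∞ := fun z => ENNReal.ofReal (kernel m k (z.1 - z.2)) with hκ
  have hκm : Measurable κ := by
    refine ENNReal.measurable_ofReal.comp (Continuous.measurable ?_)
    fun_prop
  have hdm : AEMeasurable (fun z : Torus × Torus => ‖g z.1 - g z.2‖ₑ) (haar.prod haar) :=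
    (hgm.comp_fst.sub hgm.comp_snd).enorm
  have hQm : Measurable fun z : Torus × Torus => ‖trig c M z.1‖ₑ :=
    (hQ.measurable.comp measurable_fst).enorm
  have hFm : AEMeasurable (fun z : Torus × Torus => ‖trig c M z.1‖ₑ * κ z ^ (1 / p))
      (haar.prod haar) := (hQm.mul (hκm.pow_const _)).aemeasurable
  have hGm : AEMeasurable (fun z : Torus × Torus => κ z ^ (1 / q) * ‖g z.1 - g z.2‖ₑ)
      (haar.prod haar) := (hκm.pow_const (1 / q)).aemeasurable.mul hdm
  have h1 : ‖∫ z : Torus × Torus, trig c M z.1 * (kernel m k (z.1 - z.2) : ℂ) * (g z.1 - g z.2)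
      ∂(haar.prod haar)‖ₑ ≤ ∫⁻ z, ((fun z : Torus × Torus => ‖trig c M z.1‖ₑ * κ z ^ (1 / p)) *
        fun z => κ z ^ (1 / q) * ‖g z.1 - g z.2‖ₑ) z ∂(haar.prod haar) := by
    refine (enorm_integral_le_lintegral_enorm _).trans (lintegral_mono fun z => le_of_eq ?_)
    have hz : ‖(kernel m k (z.1 - z.2) : ℂ)‖ₑ = κ z ^ (1 / p) * κ z ^ (1 / q) := by
      have hpq1 : 1 / p + 1 / q = 1 := by
        rw [one_div, one_div]; exact hpq.inv_add_inv_eq_one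
      rw [← ENNReal.rpow_add_of_nonneg _ _ (by have := hpq.pos; positivity) (by positivity),
        hpq1, ENNReal.rpow_one, ← ofReal_norm,
        Complex.norm_real, Real.norm_of_nonneg (kernel_nonneg m k _)]
    rw [enorm_mul, enorm_mul, hz, Pi.mul_apply]
    ring
  have h2 := ENNReal.lintegral_mul_le_Lp_mul_Lq (haar.prod haar) hpq hFm hGm
  refine h1.trans (h2.trans ?_)
  have h3 : ∫⁻ z, (‖trig c M z.1‖ₑ * κ z ^ (1 / p)) ^ p ∂(haar.prod haar) =
      ∫⁻ x, ‖trig c M x‖ₑ ^ p ∂haar := by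
    have hp := hpq.pos
    rw [lintegral_prod _ (hFm.pow_const p)]
    refine lintegral_congr fun x => ?_
    simp only [ENNReal.mul_rpow_of_nonneg _ _ hp.le, ← ENNReal.rpow_mul,
      one_div_mul_cancel hp.ne', ENNReal.rpow_one]
    rw [lintegral_const_mul' _ _ (ENNReal.rpow_ne_top_of_nonneg hp.le enorm_ne_top)]
    rw [lintegral_kernel_eq_one hm, mul_one]
  have h4 : ∫⁻ z, (κ z ^ (1 / q) * ‖g z.1 - g z.2‖ₑ) ^ q ∂(haar.prod haar) ≤
      ENNReal.ofReal (Real.pi ^ (s * q + 2) * 2 ^ (2 * k) * (m : ℝ) ^ (-(s * q))) *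
        gagliardo s q g := by
    rw [lintegral_prod _ (hGm.pow_const q)]
    simp only [ENNReal.mul_rpow_of_nonneg _ _ hq0.le, ← ENNReal.rpow_mul,
      one_div_mul_cancel hq0.ne', ENNReal.rpow_one]
    exact lintegral_kernel_le hs hq hm hk g
  rw [h3]
  refine (mul_le_mul' (lintegral_trig_rpow_le c M hpq)
    (ENNReal.rpow_le_rpow h4 (by positivity : 0 ≤ 1 / q))).trans ?_
  rw [ENNReal.mul_rpow_of_nonneg _ _ (by positivity), ENNReal.ofReal_rpow_of_nonneg
    (by positivity) (by positivity), ENNReal.ofReal_mul (by positivity)]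
  have h5 := gagliardo_le_sobolevNorm (s := s) hq0 g
  calc _ = ENNReal.ofReal ((2 * M + 1) ^ (1 / q)) * ENNReal.ofReal
        ((Real.pi ^ (s * q + 2) * 2 ^ (2 * k) * (m : ℝ) ^ (-(s * q))) ^ (1 / q)) *
        (∫⁻ x, ‖trig c M x‖ₑ ∂haar) * gagliardo s q g ^ (1 / q) := by ring
    _ ≤ _ := by gcongr

/-! ### The duality pairing with a Besov distribution -/

theorem cutoff_of_abs_le_one {r : ℝ} (hr : |r| ≤ 1) : cutoff r = 1 :=
  Real.smoothTransition.one_of_one_le (by linarith)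

theorem cutoff_of_two_le_abs {r : ℝ} (hr : 2 ≤ |r|) : cutoff r = 0 :=
  Real.smoothTransition.zero_of_nonpos (by linarith)

theorem cutoff_nonneg (r : ℝ) : 0 ≤ cutoff r := Real.smoothTransition.nonneg _

theorem cutoff_le_one (r : ℝ) : cutoff r ≤ 1 := Real.smoothTransition.le_one _

theorem cutoff_neg (r : ℝ) : cutoff (-r) = cutoff r := by rw [cutoff, cutoff, abs_neg]

theorem abs_div_two_pow (n : ℤ) (N : ℕ) : |(n : ℝ) / 2 ^ N| = n.natAbs / 2 ^ N := by
  rw [abs_div, abs_of_pos (by positivity : (0 : ℝ) < 2 ^ N), Nat.cast_natAbs, Int.cast_abs]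

theorem cutoff_div_eq_one {n : ℤ} {N : ℕ} (h : n.natAbs ≤ 2 ^ N) : cutoff ((n : ℝ) / 2 ^ N) = 1 := by
  refine cutoff_of_abs_le_one ?_
  rw [abs_div_two_pow, div_le_one (by positivity)]
  exact_mod_cast h

theorem cutoff_div_eq_zero {n : ℤ} {N : ℕ} (h : 2 ^ (N + 1) ≤ n.natAbs) :
    cutoff ((n : ℝ) / 2 ^ N) = 0 := by
  refine cutoff_of_two_le_abs ?_
  rw [abs_div_two_pow, le_div_iff₀ (by positivity)]
  have : ((2 ^ (N + 1) : ℕ) : ℝ) ≤ n.natAbs := by exact_mod_cast h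
  push_cast at this
  rw [pow_succ] at this
  linarith

theorem lowFreq_eq_trig (u : SmoothFn →ₗ[ℂ] ℂ) {N M : ℕ} (hM : 2 ^ (N + 1) ≤ M) :
    lowFreq u N = trig (fun n => (cutoff ((n : ℝ) / 2 ^ N) : ℂ) * distCoeff u n) M := by
  ext x
  rw [lowFreq, trig]
  have hM' : ((2 : ℤ) ^ (N + 1)) ≤ M := by exact_mod_cast hM
  refine Finset.sum_subset (Finset.Icc_subset_Icc (by omega) hM') fun n _ hn => ?_
  rw [cutoff_div_eq_zero, Complex.ofReal_zero, zero_mul, zero_mul]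
  rw [Finset.mem_Icc, not_and_or] at hn
  have : ((2 ^ (N + 1) : ℕ) : ℤ) ≤ n.natAbs := by
    rw [Int.natCast_natAbs]
    push_cast
    rcases hn with hn | hn
    · exact le_abs.2 (Or.inr (by linarith [not_le.1 hn]))
    · exact le_abs.2 (Or.inl (not_le.1 hn).le)
  exact_mod_cast this

theorem continuous_lowFreq (u : SmoothFn →ₗ[ℂ] ℂ) (N : ℕ) : Continuous (lowFreq u N) := by
  rw [lowFreq_eq_trig u le_rfl]; exact continuous_trig _ _

/-- The coefficients of the Littlewood-Paley block `j + 1`. -/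
def blockCoeff (u : SmoothFn →ₗ[ℂ] ℂ) (j : ℕ) (n : ℤ) : ℂ :=
  (cutoff ((n : ℝ) / 2 ^ (j + 1)) - cutoff ((n : ℝ) / 2 ^ j)) * distCoeff u n

theorem blockCoeff_eq_zero (u : SmoothFn →ₗ[ℂ] ℂ) {j : ℕ} {n : ℤ} (h : n.natAbs ≤ 2 ^ j) :
    blockCoeff u j n = 0 := by
  rw [blockCoeff, cutoff_div_eq_one h, cutoff_div_eq_one (h.trans (Nat.pow_le_pow_right two_pos
    j.le_succ)), sub_self, zero_mul]

theorem lpBlock_succ_eq_trig (u : SmoothFn →ₗ[ℂ] ℂ) (j : ℕ) :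
    lpBlock u (j + 1) = trig (blockCoeff u j) (2 ^ (j + 2)) := by
  ext x
  rw [lpBlock, lowFreq_eq_trig u (le_refl (2 ^ (j + 1 + 1))), lowFreq_eq_trig u
    (Nat.pow_le_pow_right two_pos (by omega) : 2 ^ (j + 1) ≤ 2 ^ (j + 2))]
  simp only [trig, ← Finset.sum_sub_distrib, blockCoeff]
  refine Finset.sum_congr rfl fun n _ => ?_
  ring

theorem continuous_lpBlock (u : SmoothFn →ₗ[ℂ] ℂ) (j : ℕ) : Continuous (lpBlock u j) := by
  cases j with
  | zero => exact continuous_lowFreq u 0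
  | succ j => rw [lpBlock_succ_eq_trig]; exact continuous_trig _ _

theorem lowFreq_eq_sum (u : SmoothFn →ₗ[ℂ] ℂ) (N : ℕ) (x : Torus) :
    lowFreq u N x = ∑ j ∈ Finset.range (N + 1), lpBlock u j x := by
  induction N with
  | zero => simp [lpBlock]
  | succ N ih => rw [Finset.sum_range_succ, ← ih, lpBlock]; ring

theorem lintegral_lpBlock_le {α : ℝ} (u : SmoothFn →ₗ[ℂ] ℂ) (j : ℕ) :
    ∫⁻ x, ‖lpBlock u j x‖ₑ ∂haar ≤
      ENNReal.ofReal ((2 : ℝ) ^ (-((j : ℝ) * α))) * besovNorm α 1 u := by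
  have h1 : ENNReal.ofReal ((2 : ℝ) ^ ((j : ℝ) * α)) * eLpNorm (lpBlock u j) 1 haar ≤
      besovNorm α 1 u := le_iSup (fun j : ℕ => ENNReal.ofReal ((2 : ℝ) ^ ((j : ℝ) * α)) *
        eLpNorm (lpBlock u j) 1 haar) j
  rw [eLpNorm_one_eq_lintegral_enorm] at h1
  have h2 := mul_le_mul_right h1 (ENNReal.ofReal ((2 : ℝ) ^ (-((j : ℝ) * α))))
  rw [← mul_assoc, ← ENNReal.ofReal_mul (by positivity), ← Real.rpow_add two_pos, neg_add_cancel,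
    Real.rpow_zero, ENNReal.ofReal_one, one_mul] at h2
  exact h2

/-- The range of exponents in which the pairing of `B^α_{1,∞}` and `W^{s,q}` is defined, and in which
`W^{s,q}` is a module over `H¹`. The inequality `1/q < s + α` makes the block of frequency `2^j` of the
pairing, of size `2^(j (1/q - s - α))`, summable; `s < 1/2` is the Hölder regularity of `H¹`. -/
structure Admissible (α s q : ℝ) : Prop where
  s_pos : 0 < s
  s_lt : s < 1 / 2
  two_le : 2 ≤ q
  gap : 1 / q < s + α

theorem admissible_of_pos {α ε : ℝ} (hα : α < 0) (hε : 0 < ε) (h : ε < 1 / 2 + α) :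
    Admissible α (-α + ε) ((1 + ε) / ε) where
  s_pos := by linarith
  s_lt := by linarith
  two_le := by rw [le_div_iff₀ hε]; linarith
  gap := by
    rw [one_div, inv_div, div_lt_iff₀ (by linarith)]
    nlinarith

/-- The pairing of one block: the loss `2^(j/q)` comes from the passage from `L¹` to `L^{q/(q-1)}` for
the block, the gain `2^(-js)` from the regularity of `g`, and `2^(-jα)` from the Besov norm. -/
theorem norm_integral_lpBlock_succ_le {α s q : ℝ} (h : Admissible α s q) :
    ∃ C : ℝ, 0 ≤ C ∧ ∀ u : SmoothFn →ₗ[ℂ] ℂ, ∀ g : Torus → ℂ,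
      AEStronglyMeasurable g haar → sobolevNorm s q g < ⊤ → ∀ j : ℕ,
      ‖∫ x, lpBlock u (j + 1) x * g x ∂haar‖ₑ ≤ ENNReal.ofReal (C * (2 ^ (1 / q - s - α)) ^ j) *
        besovNorm α 1 u * sobolevNorm s q g := by
  obtain ⟨hs, -, hq2, -⟩ := h
  have hq : 1 < q := by linarith
  have hq0 : 0 < q := by linarith
  obtain ⟨k, hk⟩ := exists_nat_ge (1 + s * q)
  have hsq : 0 < s * q := by positivity
  have hk0 : (0 : ℝ) < k := by linarith
  have hk0' : 0 < k := by exact_mod_cast hk0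
  refine ⟨2 ^ (-α) * (9 ^ (1 / q) * ((Real.pi ^ (s * q + 2) * 2 ^ (2 * k)) ^ (1 / q) * k ^ s)),
    by have := Real.pi_pos; positivity, fun u g hgm hg j => ?_⟩
  rw [lpBlock_succ_eq_trig]
  -- the power `k` of the kernel is fixed; `m` of order `2^j / k` is the largest choice for which the
  -- kernel has degree at most `2^j`, hence annihilates the block
  have hm1 : k * (2 ^ j / k + 1 - 1) ≤ 2 ^ j := by
    rw [Nat.add_sub_cancel]; exact Nat.mul_div_le _ _
  have h1 := enorm_integral_trig_mul_le hs hq (c := blockCoeff u j) (M := 2 ^ (j + 2))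
    (m := 2 ^ j / k + 1) (k := k) (Nat.succ_pos _) (by linarith)
    (fun n hn => blockCoeff_eq_zero u (hn.trans hm1)) hgm hg
  have h2 := lintegral_lpBlock_le (α := α) u (j + 1)
  rw [lpBlock_succ_eq_trig] at h2
  refine h1.trans ?_
  have hm2 : (2 : ℝ) ^ j / k ≤ ((2 ^ j / k + 1 : ℕ) : ℝ) := by
    rw [div_le_iff₀ hk0]
    have : 2 ^ j ≤ (2 ^ j / k + 1) * k := by
      have := Nat.div_add_mod (2 ^ j) k
      have h3 := Nat.mod_lt (2 ^ j) hk0'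
      nlinarith
    exact_mod_cast this
  have hpi := Real.pi_pos
  have e1 : ((2 : ℝ) * ((2 ^ (j + 2) : ℕ) : ℝ) + 1) ^ (1 / q) ≤ 9 ^ (1 / q) * ((2 : ℝ) ^ j) ^ (1 / q) := by
    rw [← Real.mul_rpow (by norm_num) (by positivity)]
    refine Real.rpow_le_rpow (by positivity) ?_ (by positivity)
    push_cast
    have : (1 : ℝ) ≤ 2 ^ j := one_le_pow₀ (by norm_num)
    rw [pow_add]
    linarith
  have e2 : (Real.pi ^ (s * q + 2) * 2 ^ (2 * k) *
      ((2 ^ j / k + 1 : ℕ) : ℝ) ^ (-(s * q))) ^ (1 / q) ≤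
      (Real.pi ^ (s * q + 2) * 2 ^ (2 * k)) ^ (1 / q) * (k ^ s * ((2 : ℝ) ^ j) ^ (-s)) := by
    rw [Real.mul_rpow (by positivity) (by positivity), ← Real.rpow_mul (by positivity)]
    have h3 : -(s * q) * (1 / q) = -s := by field_simp
    rw [h3]
    refine mul_le_mul_of_nonneg_left ?_ (by positivity)
    refine (Real.rpow_le_rpow_of_nonpos (by positivity) hm2 (by linarith)).trans (le_of_eq ?_)
    rw [Real.div_rpow (by positivity) hk0.le, Real.rpow_neg hk0.le, div_inv_eq_mul, mul_comm]
  have e3 : (2 : ℝ) ^ (-(((j + 1 : ℕ) : ℝ) * α)) = 2 ^ (-α) * ((2 : ℝ) ^ j) ^ (-α) := by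
    rw [← Real.rpow_natCast 2 j, ← Real.rpow_mul (by norm_num), ← Real.rpow_add two_pos]
    push_cast
    congr 1; ring
  have e4 : ((2 : ℝ) ^ (1 / q - s - α)) ^ j =
      ((2 : ℝ) ^ j) ^ (1 / q) * ((2 : ℝ) ^ j) ^ (-s) * ((2 : ℝ) ^ j) ^ (-α) := by
    rw [← Real.rpow_add (by positivity), ← Real.rpow_add (by positivity), ← Real.rpow_natCast 2 j,
      ← Real.rpow_natCast (2 ^ _) j, ← Real.rpow_mul (by norm_num), ← Real.rpow_mul (by norm_num)]
    congr 1; ring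
  rw [e3] at h2
  refine (mul_le_mul' (mul_le_mul' (ENNReal.ofReal_le_ofReal
    (mul_le_mul e1 e2 (by positivity) (by positivity))) h2) le_rfl).trans (le_of_eq ?_)
  rw [← mul_assoc (ENNReal.ofReal _) (ENNReal.ofReal _), ← ENNReal.ofReal_mul (by positivity), e4]
  congr 3
  ring

theorem integral_norm_le_sobolevNorm {s q : ℝ} (hq : 1 ≤ q) {g : Torus → ℂ}
    (hgm : AEStronglyMeasurable g haar) (hg : sobolevNorm s q g < ⊤) :
    ∫ x, ‖g x‖ ∂haar ≤ (sobolevNorm s q g).toReal := by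
  rw [integral_norm_eq_lintegral_enorm hgm]
  refine ENNReal.toReal_mono hg.ne ?_
  rw [← eLpNorm_one_eq_lintegral_enorm]
  exact (eLpNorm_le_eLpNorm_of_exponent_le (by simpa using hq) hgm).trans
    (eLpNorm_le_sobolevNorm (by linarith) g)

/-- Geometric decay of the pairing of a Besov distribution, block by block, with a Sobolev
function. -/
theorem norm_integral_lpBlock_le {α s q : ℝ} (h : Admissible α s q) :
    ∃ C r : ℝ, 0 ≤ C ∧ 0 ≤ r ∧ r < 1 ∧ ∀ u : SmoothFn →ₗ[ℂ] ℂ, besovNorm α 1 u < ⊤ →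
      ∀ g : Torus → ℂ, AEStronglyMeasurable g haar → sobolevNorm s q g < ⊤ → ∀ j : ℕ,
      ‖∫ x, lpBlock u j x * g x ∂haar‖ ≤
        C * (besovNorm α 1 u).toReal * (sobolevNorm s q g).toReal * r ^ j := by
  obtain ⟨C, hC, hb⟩ := norm_integral_lpBlock_succ_le h
  have hq1 : 1 ≤ q := by linarith [h.two_le]
  set r : ℝ := 2 ^ (1 / q - s - α) with hr
  have hr0 : 0 < r := by positivity
  have hr1 : r < 1 := Real.rpow_lt_one_of_one_lt_of_neg (by norm_num) (by linarith [h.gap])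
  refine ⟨max 5 (C / r), r, by positivity, hr0.le, hr1, fun u hu g hgm hg j => ?_⟩
  set B := (besovNorm α 1 u).toReal
  set X := (sobolevNorm s q g).toReal
  cases j with
  | zero =>
    -- the lowest block has frequencies `|n| ≤ 2`, whence the factor `5 = 2 * 2 + 1`
    have hi := integrable_of_sobolevNorm hq1 hgm hg
    have h1 : ∫ x, ‖lpBlock u 0 x‖ ∂haar ≤ B := by
      rw [integral_norm_eq_lintegral_enorm (continuous_lpBlock u 0).aestronglyMeasurable]
      refine ENNReal.toReal_mono hu.ne ?_
      simpa using lintegral_lpBlock_le (α := α) u 0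
    have h2 : ∀ x, ‖lpBlock u 0 x‖ ≤ 5 * B := by
      intro x
      have e : lpBlock u 0 = trig _ (2 ^ 1) := lowFreq_eq_trig u (N := 0) le_rfl
      have h3 := norm_trig_le (fun n => (cutoff ((n : ℝ) / 2 ^ 0) : ℂ) * distCoeff u n) (2 ^ 1) x
      rw [← e] at h3
      push_cast at h3
      linarith
    have hB : 0 ≤ B := ENNReal.toReal_nonneg
    have hX : 0 ≤ X := ENNReal.toReal_nonneg
    have h4 : ‖∫ x, lpBlock u 0 x * g x ∂haar‖ ≤ ∫ x, 5 * B * ‖g x‖ ∂haar := by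
      refine norm_integral_le_of_norm_le (hi.norm.const_mul _) (Eventually.of_forall fun x => ?_)
      rw [norm_mul]
      exact mul_le_mul_of_nonneg_right (h2 x) (norm_nonneg _)
    rw [integral_const_mul] at h4
    have h5 := integral_norm_le_sobolevNorm hq1 hgm hg
    rw [pow_zero, mul_one]
    calc _ ≤ 5 * B * X := h4.trans (mul_le_mul_of_nonneg_left h5 (by positivity))
      _ ≤ _ := by gcongr; exact le_max_left _ _
  | succ j =>
    have h1 := hb u g hgm hg j
    rw [← ofReal_norm] at h1
    have h2 := ENNReal.toReal_mono (ENNReal.mul_ne_top (ENNReal.mul_ne_top ENNReal.ofReal_ne_top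
      hu.ne) hg.ne) h1
    rw [ENNReal.toReal_ofReal (norm_nonneg _), ENNReal.toReal_mul, ENNReal.toReal_mul,
      ENNReal.toReal_ofReal (by positivity)] at h2
    have hB : 0 ≤ B := ENNReal.toReal_nonneg
    have hX : 0 ≤ X := ENNReal.toReal_nonneg
    calc _ ≤ C * r ^ j * B * X := h2
      _ = C / r * B * X * r ^ (j + 1) := by rw [pow_succ]; field_simp
      _ ≤ _ := by gcongr; exact le_max_right _ _

theorem integral_lowFreq_mul (u : SmoothFn →ₗ[ℂ] ℂ) (N : ℕ) {g : Torus → ℂ}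
    (hg : Integrable g haar) :
    ∫ x, lowFreq u N x * g x ∂haar =
      ∑ j ∈ Finset.range (N + 1), ∫ x, lpBlock u j x * g x ∂haar := by
  simp only [lowFreq_eq_sum, Finset.sum_mul]
  refine integral_finsetSum _ fun j _ => ?_
  obtain ⟨C, hC⟩ := isCompact_univ.exists_bound_of_continuousOn (continuous_lpBlock u j).continuousOn
  exact hg.bdd_mul (continuous_lpBlock u j).aestronglyMeasurable
    (Eventually.of_forall fun x => hC x trivial)

/-- The pairing of `u ∈ B^α_{1,∞}` with a function in `W^{s,q}` is the limit of its approximations,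
with a quantitative rate. -/
theorem exists_pairing_bound {α s q : ℝ} (h : Admissible α s q) :
    ∃ C r : ℝ, 0 ≤ C ∧ 0 ≤ r ∧ r < 1 ∧ ∀ u : SmoothFn →ₗ[ℂ] ℂ, besovNorm α 1 u < ⊤ →
      ∀ g : Torus → ℂ, AEStronglyMeasurable g haar → sobolevNorm s q g < ⊤ →
      Tendsto (fun N => ∫ x, lowFreq u N x * g x ∂haar) atTop (𝓝 (pairing u g)) ∧
      ‖pairing u g‖ ≤ C * (besovNorm α 1 u).toReal * (sobolevNorm s q g).toReal ∧
      ∀ N, ‖∫ x, lowFreq u N x * g x ∂haar - pairing u g‖ ≤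
        C * (besovNorm α 1 u).toReal * (sobolevNorm s q g).toReal * r ^ N := by
  obtain ⟨C, r, hC, hr0, hr1, hb⟩ := norm_integral_lpBlock_le h
  have hr : 0 < 1 - r := by linarith
  refine ⟨C / (1 - r), r, by positivity, hr0, hr1, fun u hu g hgm hg => ?_⟩
  have hbj := hb u hu g hgm hg
  set K := C * (besovNorm α 1 u).toReal * (sobolevNorm s q g).toReal with hK
  have hK0 : 0 ≤ K := by positivity
  have hsum : Summable fun j => ∫ x, lpBlock u j x * g x ∂haar :=
    Summable.of_norm_bounded ((summable_geometric_of_lt_one hr0 hr1).mul_left K) hbj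
  have hlow := fun N => integral_lowFreq_mul u N
    (integrable_of_sobolevNorm (by linarith [h.two_le]) hgm hg)
  have ht : Tendsto (fun N => ∫ x, lowFreq u N x * g x ∂haar) atTop
      (𝓝 (∑' j, ∫ x, lpBlock u j x * g x ∂haar)) := by
    simp only [hlow]
    exact (tendsto_add_atTop_iff_nat 1).2 hsum.hasSum.tendsto_sum_nat
  have hp : pairing u g = ∑' j, ∫ x, lpBlock u j x * g x ∂haar := ht.limUnder_eq
  have hKe : ∀ x : ℝ, C / (1 - r) * (besovNorm α 1 u).toReal * (sobolevNorm s q g).toReal * x =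
      K * x / (1 - r) := fun x => by rw [hK]; field_simp
  refine ⟨hp ▸ ht, ?_, fun N => ?_⟩
  · have h1 := tsum_of_norm_bounded ((hasSum_geometric_of_lt_one hr0 hr1).mul_left K) hbj
    have h2 := hKe 1
    rw [mul_one, mul_one] at h2
    rw [hp, h2, div_eq_mul_inv]
    exact h1
  · have h3 := dist_le_of_le_geometric_of_tendsto r K hr1
      (f := fun N => ∑ j ∈ Finset.range N, ∫ x, lpBlock u j x * g x ∂haar) (fun n => by
        rw [dist_eq_norm, Finset.sum_range_succ, norm_sub_rev, add_sub_cancel_left]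
        exact hbj n) hsum.hasSum.tendsto_sum_nat (N + 1)
    rw [dist_eq_norm, ← hlow N, ← hp] at h3
    rw [hKe]
    refine h3.trans ?_
    rw [pow_succ]
    have : r ^ N * r ≤ r ^ N := mul_le_of_le_one_right (pow_nonneg hr0 N) hr1.le
    gcongr

/-! ### Smooth functions and their Fourier series -/

theorem smoothFn_contDiff (φ : SmoothFn) :
    ContDiff ℝ ∞ fun y : ℝ => (φ : Torus → ℂ) (y : Torus) := φ.2

theorem torusDeriv_coe (g : Torus → ℂ) (y : ℝ) :
    torusDeriv g (y : Torus) = deriv (fun z : ℝ => g (z : Torus)) y := by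
  have h := deriv_comp_const_add (fun z : ℝ => g (z : Torus)) y 0
  rw [add_zero] at h
  rw [torusDeriv, ← h]
  simp only [AddCircle.coe_add]

/-- The derivative of a smooth function. -/
def smoothDeriv (φ : SmoothFn) : SmoothFn :=
  ⟨torusDeriv φ, by
    change ContDiff ℝ ∞ fun y : ℝ => torusDeriv φ (y : Torus)
    simp only [torusDeriv_coe]
    exact (contDiff_infty_iff_deriv.1 (smoothFn_contDiff φ)).2⟩

/-- The product of two smooth functions. -/
def smoothMul (φ ψ : SmoothFn) : SmoothFn :=
  ⟨fun x => (φ : Torus → ℂ) x * (ψ : Torus → ℂ) x, ContDiff.mul (smoothFn_contDiff φ) (smoothFn_contDiff ψ)⟩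

theorem integral_haar (f : Torus → ℂ) :
    ∫ x, f x ∂haar = ((2 * Real.pi)⁻¹ : ℝ) • ∫ y in (0 : ℝ)..(2 * Real.pi), f (y : Torus) := by
  have h := AddCircle.intervalIntegral_preimage (2 * Real.pi) 0 f
  rw [zero_add] at h
  rw [h, AddCircle.integral_haarAddCircle]

theorem integral_smoothDeriv (φ : SmoothFn) : ∫ x, (smoothDeriv φ : Torus → ℂ) x ∂haar = 0 := by
  rw [integral_haar]
  have h1 : ∀ y : ℝ, (smoothDeriv φ : Torus → ℂ) (y : Torus) =
      deriv (fun z : ℝ => (φ : Torus → ℂ) (z : Torus)) y := fun y => torusDeriv_coe _ _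
  simp only [h1]
  rw [intervalIntegral.integral_deriv_eq_sub]
  · have : ((2 * Real.pi : ℝ) : Torus) = ((0 : ℝ) : Torus) := by
      rw [AddCircle.coe_period]; rfl
    rw [this, sub_self, smul_zero]
  · intro y _
    exact (smoothFn_contDiff φ).differentiable (by simp) y
  · exact ((smoothFn_contDiff φ).continuous_deriv (by simp)).intervalIntegrable _ _

theorem torusDeriv_fourier (n : ℤ) (x : Torus) :
    torusDeriv (fun x => (fourier n x : ℂ)) x = Complex.I * n * fourier n x := by
  obtain ⟨y, rfl, -⟩ := exists_coe_eq_norm x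
  rw [torusDeriv_coe, (hasDerivAt_fourier (2 * Real.pi) n y).deriv]
  have : (Real.pi : ℂ) ≠ 0 := by exact_mod_cast Real.pi_ne_zero
  push_cast
  field_simp

theorem fourierCoeff_smoothDeriv (φ : SmoothFn) (n : ℤ) :
    fourierCoeff (smoothDeriv φ : Torus → ℂ) n = Complex.I * n * fourierCoeff (φ : Torus → ℂ) n := by
  have h := integral_smoothDeriv (smoothMul (expFn (-n)) φ)
  have e : ∀ x, (smoothDeriv (smoothMul (expFn (-n)) φ) : Torus → ℂ) x =
      (fourier (-n) x : ℂ) * (smoothDeriv φ : Torus → ℂ) x -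
      Complex.I * n * ((fourier (-n) x : ℂ) * (φ : Torus → ℂ) x) := by
    intro x
    obtain ⟨y, rfl, -⟩ := exists_coe_eq_norm x
    have h1 := torusDeriv_fourier (-n) (y : Torus)
    rw [torusDeriv_coe] at h1
    have h2 : (smoothDeriv φ : Torus → ℂ) (y : Torus) =
      deriv (fun z : ℝ => (φ : Torus → ℂ) (z : Torus)) y := torusDeriv_coe _ _
    have h3 : (smoothDeriv (smoothMul (expFn (-n)) φ) : Torus → ℂ) (y : Torus) =
      deriv ((fun z : ℝ => (fourier (-n) (z : Torus) : ℂ)) *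
        (fun z : ℝ => (φ : Torus → ℂ) (z : Torus))) y := torusDeriv_coe _ _
    have d1 : DifferentiableAt ℝ (fun z : ℝ => (fourier (-n) (z : Torus) : ℂ)) y :=
      (smoothFn_contDiff (expFn (-n))).differentiable (by simp) y
    have d2 : DifferentiableAt ℝ (fun z : ℝ => (φ : Torus → ℂ) (z : Torus)) y :=
      (smoothFn_contDiff φ).differentiable (by simp) y
    rw [h3, h2, deriv_mul d1 d2, h1]
    push_cast
    ring
  have i1 : Integrable (fun x => (fourier (-n) x : ℂ) * (smoothDeriv φ : Torus → ℂ) x) haar :=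
    integrable_of_continuous ((map_continuous _).mul (smoothFn_continuous _))
  have i2 : Integrable (fun x => (fourier (-n) x : ℂ) * (φ : Torus → ℂ) x) haar :=
    integrable_of_continuous ((map_continuous _).mul (smoothFn_continuous _))
  simp only [e] at h
  rw [integral_sub i1 (i2.const_mul _), integral_const_mul] at h
  simp only [fourierCoeff, smul_eq_mul]
  linear_combination h

theorem fourierCoeff_iterate_smoothDeriv (φ : SmoothFn) (k : ℕ) (n : ℤ) :
    fourierCoeff (smoothDeriv^[k] φ : Torus → ℂ) n =
      (Complex.I * n) ^ k * fourierCoeff (φ : Torus → ℂ) n := by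
  induction k with
  | zero => simp
  | succ k ih => rw [Function.iterate_succ_apply', fourierCoeff_smoothDeriv, ih]; ring

theorem iterate_smoothDeriv_coe (φ : SmoothFn) (k : ℕ) (y : ℝ) :
    (smoothDeriv^[k] φ : Torus → ℂ) (y : Torus) =
      iteratedDeriv k (fun z : ℝ => (φ : Torus → ℂ) (z : Torus)) y := by
  induction k generalizing y with
  | zero => simp
  | succ k ih =>
    rw [Function.iterate_succ_apply', iteratedDeriv_succ]
    have h : (smoothDeriv (smoothDeriv^[k] φ) : Torus → ℂ) (y : Torus) = deriv (fun z : ℝ =>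
      (smoothDeriv^[k] φ : Torus → ℂ) (z : Torus)) y := torusDeriv_coe _ _
    rw [h]
    congr 1
    ext z
    exact ih z

theorem abs_le_jap (n : ℤ) : |(n : ℝ)| ≤ jap n := by
  rw [jap, ← Real.sqrt_sq_eq_abs]
  exact Real.sqrt_le_sqrt (by linarith)

theorem summable_jap_rpow {τ : ℝ} (hτ : 1 < τ) : Summable fun n : ℤ => jap n ^ (-τ) := by
  have h1 : Summable fun n : ℤ => |(n : ℝ)| ^ (-τ) := Real.summable_abs_int_rpow hτ
  have h2 : Summable fun n : ℤ => if n = 0 then (1 : ℝ) else 0 :=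
    (hasSum_ite_eq (0 : ℤ) (1 : ℝ)).summable
  refine Summable.of_nonneg_of_le (fun n => Real.rpow_nonneg (jap_pos n).le _) (fun n => ?_)
    (h1.add h2)
  rcases eq_or_ne n 0 with rfl | hn
  · simp [jap, Real.zero_rpow (by linarith : -τ ≠ 0)]
  · rw [if_neg hn, add_zero]
    exact Real.rpow_le_rpow_of_nonpos (by positivity) (abs_le_jap n) (by linarith)

theorem summable_jap_zpow_neg_two : Summable fun n : ℤ => (jap n ^ 2)⁻¹ := by
  refine (summable_jap_rpow (τ := 2) (by norm_num)).congr fun n => ?_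
  rw [Real.rpow_neg (jap_pos n).le, Real.rpow_two]

/-- Rapid decay of the Fourier coefficients of a smooth function. -/
theorem exists_fourierCoeff_decay (φ : SmoothFn) (k : ℕ) :
    ∃ C : ℝ, ∀ n : ℤ, jap n ^ (2 * k) * ‖fourierCoeff (φ : Torus → ℂ) n‖ ≤ C := by
  induction k generalizing φ with
  | zero => exact ⟨_, fun n => by simpa using norm_fourierCoeff_le (φ : Torus → ℂ) n⟩
  | succ k ih =>
    obtain ⟨C, hC⟩ := ih φ
    obtain ⟨D, hD⟩ := ih (smoothDeriv^[2] φ)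
    refine ⟨C + D, fun n => le_trans (le_of_eq ?_) (add_le_add (hC n) (hD n))⟩
    rw [fourierCoeff_iterate_smoothDeriv, norm_mul, norm_pow, norm_mul, Complex.norm_I, one_mul,
      Complex.norm_intCast, sq_abs, mul_add, pow_add, mul_one, jap_sq]
    ring

theorem summable_jap_pow_mul_fourierCoeff (φ : SmoothFn) (k : ℕ) :
    Summable fun n : ℤ => jap n ^ k * ‖fourierCoeff (φ : Torus → ℂ) n‖ := by
  obtain ⟨C, hC⟩ := exists_fourierCoeff_decay φ (k + 1)
  refine Summable.of_nonneg_of_le (fun n => by have := jap_pos n; positivity) (fun n => ?_)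
    (summable_jap_zpow_neg_two.mul_left C)
  rw [← div_eq_mul_inv, le_div_iff₀ (by have := jap_pos n; positivity)]
  refine le_trans ?_ (hC n)
  rw [mul_right_comm, ← pow_add]
  exact mul_le_mul_of_nonneg_right (pow_le_pow_right₀ (one_le_jap n) (by omega)) (norm_nonneg _)

theorem summable_fourierCoeff (φ : SmoothFn) : Summable (fourierCoeff (φ : Torus → ℂ)) :=
  Summable.of_norm (by simpa using summable_jap_pow_mul_fourierCoeff φ 0)

theorem hasSum_fourier_smooth (φ : SmoothFn) (x : Torus) :
    HasSum (fun n => fourierCoeff (φ : Torus → ℂ) n * fourier n x) ((φ : Torus → ℂ) x) := by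
  have h := has_pointwise_sum_fourier_series_of_summable
    (f := (⟨φ, smoothFn_continuous φ⟩ : C(Torus, ℂ))) (summable_fourierCoeff φ) x
  simp only [smul_eq_mul] at h
  exact h

theorem norm_iteratedDeriv_le (φ : SmoothFn) (k : ℕ) (y : ℝ) :
    ‖iteratedDeriv k (fun z : ℝ => (φ : Torus → ℂ) (z : Torus)) y‖ ≤
      ∑' n : ℤ, jap n ^ k * ‖fourierCoeff (φ : Torus → ℂ) n‖ := by
  rw [← iterate_smoothDeriv_coe]
  have h := hasSum_fourier_smooth (smoothDeriv^[k] φ) (y : Torus)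
  refine (h.norm_le_of_bounded (summable_jap_pow_mul_fourierCoeff φ k).hasSum fun n => ?_)
  rw [norm_mul, norm_fourier_apply, mul_one, fourierCoeff_iterate_smoothDeriv, norm_mul, norm_pow,
    norm_mul, Complex.norm_I, one_mul, Complex.norm_intCast]
  exact mul_le_mul_of_nonneg_right (pow_le_pow_left₀ (abs_nonneg _) (abs_le_jap n) k)
    (norm_nonneg _)

/-- A trigonometric polynomial as a smooth function. -/
def smoothTrig (c : ℤ → ℂ) (M : ℕ) : SmoothFn :=
  ∑ n ∈ Finset.Icc (-(M : ℤ)) M, c n • expFn n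

theorem smoothTrig_coe (c : ℤ → ℂ) (M : ℕ) : (smoothTrig c M : Torus → ℂ) = trig c M := by
  ext x
  simp [smoothTrig, trig, expFn]

theorem sum_Icc_neg (M : ℕ) (f : ℤ → ℂ) :
    ∑ n ∈ Finset.Icc (-(M : ℤ)) M, f (-n) = ∑ n ∈ Finset.Icc (-(M : ℤ)) M, f n :=
  Finset.sum_equiv (Equiv.neg ℤ) (fun n => by
    simp only [Finset.mem_Icc, Equiv.neg_apply]; omega) fun n _ => rfl

theorem integral_trig_mul (c : ℤ → ℂ) (M : ℕ) {g : Torus → ℂ} (hg : Integrable g haar) :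
    ∫ x, trig c M x * g x ∂haar = ∑ n ∈ Finset.Icc (-(M : ℤ)) M, c n * fourierCoeff g (-n) := by
  simp only [trig, Finset.sum_mul, mul_assoc]
  rw [integral_finsetSum]
  · refine Finset.sum_congr rfl fun n _ => ?_
    rw [integral_const_mul, fourierCoeff, neg_neg]
    rfl
  · intro n _
    exact (hg.bdd_mul (c := 1) (map_continuous _).aestronglyMeasurable
      (Eventually.of_forall fun x => (norm_fourier_apply n x).le)).const_mul _

/-- The pairing with a smooth function is the value of the distribution: the approximations `S_N u`
converge to `u` on smooth functions. -/
theorem tendsto_integral_lowFreq {u : SmoothFn →ₗ[ℂ] ℂ} (hu : IsDistribution u) (φ : SmoothFn) :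
    Tendsto (fun N => ∫ x, lowFreq u N x * (φ : Torus → ℂ) x ∂haar) atTop (𝓝 (u φ)) := by
  obtain ⟨K, C, hK⟩ := hu
  set a := fourierCoeff (φ : Torus → ℂ) with ha
  set c : ℕ → ℤ → ℂ := fun N n => (cutoff ((n : ℝ) / 2 ^ N) : ℂ) * a n with hc
  set ψ : ℕ → SmoothFn := fun N => smoothTrig (c N) (2 ^ (N + 1)) with hψ
  have h1 : ∀ N, ∫ x, lowFreq u N x * (φ : Torus → ℂ) x ∂haar = u (ψ N) := by
    intro N
    rw [lowFreq_eq_trig u le_rfl, integral_trig_mul _ _ (integrable_of_continuous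
      (smoothFn_continuous φ)), show u (ψ N) = _ from map_sum u _ _,
      ← sum_Icc_neg (2 ^ (N + 1)) fun n => u (c N n • expFn n)]
    refine Finset.sum_congr rfl fun n _ => ?_
    rw [map_smul, smul_eq_mul]
    simp only [hc]
    rw [Int.cast_neg, neg_div, cutoff_neg, distCoeff]
    ring
  have hcoef : ∀ N n, fourierCoeff ((φ - ψ N : SmoothFn) : Torus → ℂ) n =
      (1 - (cutoff ((n : ℝ) / 2 ^ N) : ℂ)) * a n := by
    intro N n
    have e : ((φ - ψ N : SmoothFn) : Torus → ℂ) =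
        (φ : Torus → ℂ) + (fun x => (-1 : ℂ) * (ψ N : Torus → ℂ) x) := by
      ext x; simp [sub_eq_add_neg]
    rw [e, fourierCoeff.add (integrable_of_continuous (smoothFn_continuous φ))
      ((integrable_of_continuous (smoothFn_continuous (ψ N))).const_mul _), Pi.add_apply,
      fourierCoeff.const_mul, hψ, smoothTrig_coe, fourierCoeff_trig]
    split_ifs with hn
    · rw [hc]; ring
    · rw [cutoff_div_eq_zero]
      · simp [ha]
      · rw [Finset.mem_Icc, not_and_or] at hn
        omega
  set m : ℕ → ℝ := fun N => ∑' n : ℤ, jap n ^ K * ‖(1 - (cutoff ((n : ℝ) / 2 ^ N) : ℂ)) * a n‖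
    with hm
  have hcut : ∀ (N : ℕ) (n : ℤ), ‖(1 - (cutoff ((n : ℝ) / 2 ^ N) : ℂ)) * a n‖ ≤ ‖a n‖ := by
    intro N n
    have e : (1 - (cutoff ((n : ℝ) / 2 ^ N) : ℂ)) = ((1 - cutoff ((n : ℝ) / 2 ^ N) : ℝ) : ℂ) := by
      push_cast; rfl
    rw [norm_mul, e, Complex.norm_real, Real.norm_eq_abs]
    refine mul_le_of_le_one_left (norm_nonneg _) (abs_le.2 ⟨?_, ?_⟩)
    · linarith [cutoff_le_one ((n : ℝ) / 2 ^ N)]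
    · linarith [cutoff_nonneg ((n : ℝ) / 2 ^ N)]
  have hm0 : Tendsto m atTop (𝓝 0) := by
    have h2 := tendsto_tsum_of_dominated_convergence (𝓕 := atTop)
      (f := fun N (n : ℤ) => jap n ^ K * ‖(1 - (cutoff ((n : ℝ) / 2 ^ N) : ℂ)) * a n‖)
      (g := fun _ => (0 : ℝ)) (summable_jap_pow_mul_fourierCoeff φ K) (fun n => ?_)
      (Eventually.of_forall fun N n => ?_)
    · rw [tsum_zero] at h2
      exact h2
    · refine tendsto_const_nhds.congr' ?_
      filter_upwards [eventually_ge_atTop n.natAbs] with N hN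
      rw [cutoff_div_eq_one (hN.trans N.lt_two_pow_self.le)]
      simp
    · rw [Real.norm_of_nonneg (by have := jap_pos n; positivity)]
      exact mul_le_mul_of_nonneg_left (hcut N n) (by have := jap_pos n; positivity)
  have hbound : ∀ N, ‖u (φ - ψ N)‖ ≤ C * m N := by
    intro N
    refine hK _ _ fun k hk y => (norm_iteratedDeriv_le _ k y).trans ?_
    simp only [hcoef, hm]
    have hs : Summable fun n : ℤ => jap n ^ K * ‖(1 - (cutoff ((n : ℝ) / 2 ^ N) : ℂ)) * a n‖ :=
      Summable.of_nonneg_of_le (fun n => by have := jap_pos n; positivity)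
        (fun n => mul_le_mul_of_nonneg_left (hcut N n) (by have := jap_pos n; positivity))
        (summable_jap_pow_mul_fourierCoeff φ K)
    have hle : ∀ n : ℤ, jap n ^ k * ‖(1 - (cutoff ((n : ℝ) / 2 ^ N) : ℂ)) * a n‖ ≤
        jap n ^ K * ‖(1 - (cutoff ((n : ℝ) / 2 ^ N) : ℂ)) * a n‖ := fun n =>
      mul_le_mul_of_nonneg_right (pow_le_pow_right₀ (one_le_jap n) hk) (norm_nonneg _)
    exact Summable.tsum_le_tsum hle (Summable.of_nonneg_of_le
      (fun n => by have := jap_pos n; positivity) hle hs) hs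
  simp only [h1]
  rw [tendsto_iff_norm_sub_tendsto_zero]
  refine squeeze_zero (fun _ => norm_nonneg _) (fun N => ?_) (by simpa using hm0.const_mul C)
  rw [norm_sub_rev, ← map_sub]
  exact hbound N

theorem isDistribution_ofSmooth (v : SmoothFn) : IsDistribution (ofSmooth v) := by
  refine ⟨0, ∫ x, ‖(v : Torus → ℂ) x‖ ∂haar, fun φ M hM => ?_⟩
  have h : ∀ x, ‖(φ : Torus → ℂ) x‖ ≤ M := fun x => by
    obtain ⟨y, rfl, -⟩ := exists_coe_eq_norm x
    simpa using hM 0 le_rfl y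
  rw [← integral_mul_const]
  refine norm_integral_le_of_norm_le
    ((integrable_of_continuous (smoothFn_continuous v)).norm.mul_const _)
    (Eventually.of_forall fun x => ?_)
  rw [norm_mul]
  exact mul_le_mul_of_nonneg_left (h x) (norm_nonneg _)

theorem distCoeff_ofSmooth (v : SmoothFn) (n : ℤ) :
    distCoeff (ofSmooth v) n = fourierCoeff (v : Torus → ℂ) n := by
  change ∫ x, (v : Torus → ℂ) x * (fourier (-n) x : ℂ) ∂haar = _
  rw [fourierCoeff]
  simp only [smul_eq_mul, mul_comm]

/-- Smooth functions belong to every Besov space of negative order. -/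
theorem memBesov_ofSmooth {α : ℝ} (hα : α < 0) (v : SmoothFn) : MemBesov α 1 (ofSmooth v) := by
  refine ⟨isDistribution_ofSmooth v, ?_⟩
  have hsum : Summable fun n : ℤ => ‖fourierCoeff (v : Torus → ℂ) n‖ := (summable_fourierCoeff v).norm
  set A := ∑' n : ℤ, ‖fourierCoeff (v : Torus → ℂ) n‖ with hA
  have hlow : ∀ N x, ‖lowFreq (ofSmooth v) N x‖ ≤ A := by
    intro N x
    rw [lowFreq_eq_trig _ le_rfl, trig]
    refine (norm_sum_le _ _).trans ((Finset.sum_le_sum fun n _ => ?_).trans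
      (hsum.sum_le_tsum _ fun n _ => norm_nonneg _))
    rw [norm_mul, norm_mul, norm_fourier_apply, mul_one, distCoeff_ofSmooth, Complex.norm_real,
      Real.norm_of_nonneg (cutoff_nonneg _)]
    exact mul_le_of_le_one_left (norm_nonneg _) (cutoff_le_one _)
  have hblock : ∀ j x, ‖lpBlock (ofSmooth v) j x‖ ≤ 2 * A := by
    intro j x
    have hA0 : 0 ≤ A := (norm_nonneg _).trans (hlow 0 x)
    cases j with
    | zero => exact (hlow 0 x).trans (by linarith)
    | succ j => exact (norm_sub_le _ _).trans (by linarith [hlow (j + 1) x, hlow j x])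
  refine lt_of_le_of_lt (iSup_le fun j => ?_) (ENNReal.ofReal_lt_top (r := 2 * A))
  have h1 : ENNReal.ofReal ((2 : ℝ) ^ ((j : ℝ) * α)) ≤ 1 := by
    rw [← ENNReal.ofReal_one]
    refine ENNReal.ofReal_le_ofReal (Real.rpow_le_one_of_one_le_of_nonpos (by norm_num) ?_)
    exact mul_nonpos_of_nonneg_of_nonpos (Nat.cast_nonneg j) hα.le
  refine (mul_le_mul' h1 (eLpNorm_le_of_ae_bound (Eventually.of_forall (hblock j)))).trans ?_
  simp

/-- The approximations of a real distribution are real. -/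
theorem im_lowFreq {u : SmoothFn →ₗ[ℂ] ℂ} (hu : IsRealDistribution u) (N : ℕ) (x : Torus) :
    (lowFreq u N x).im = 0 := by
  have hco : ∀ n, distCoeff u (-n) = (starRingEnd ℂ) (distCoeff u n) := by
    intro n
    set p : SmoothFn := expFn n + expFn (-n) with hp
    set m : SmoothFn := Complex.I • (expFn n - expFn (-n)) with hm
    have h1 : (u p).im = 0 := hu p fun x => by
      change ((fourier n x : ℂ) + fourier (-n) x).im = 0
      rw [fourier_neg]; simp
    have h2 : (u m).im = 0 := hu m fun x => by
      change (Complex.I * ((fourier n x : ℂ) - fourier (-n) x)).im = 0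
      rw [fourier_neg]; simp
    rw [hp, map_add] at h1
    rw [hm, map_smul, map_sub] at h2
    simp only [distCoeff, neg_neg]
    simp only [Complex.add_im, smul_eq_mul, Complex.mul_im, Complex.I_re, Complex.I_im,
      Complex.sub_re, Complex.sub_im] at h1 h2
    apply Complex.ext
    · rw [Complex.conj_re]; linarith
    · rw [Complex.conj_im]; linarith
  have hconj : (starRingEnd ℂ) (lowFreq u N x) = lowFreq u N x := by
    rw [lowFreq_eq_trig u le_rfl]
    conv_rhs => rw [trig, ← sum_Icc_neg]
    rw [trig, map_sum]
    refine Finset.sum_congr rfl fun n _ => ?_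
    rw [map_mul, map_mul, Complex.conj_ofReal, ← hco, ← fourier_neg, Int.cast_neg, neg_div,
      cutoff_neg]
  exact Complex.conj_eq_iff_im.1 hconj

theorem isRealDistribution_ofSmooth {v : SmoothFn} (hv : ∀ x, ((v : Torus → ℂ) x).im = 0) :
    IsRealDistribution (ofSmooth v) := by
  intro φ hφ
  change (∫ x, (v : Torus → ℂ) x * (φ : Torus → ℂ) x ∂haar).im = 0
  have e : ∀ x, (v : Torus → ℂ) x * (φ : Torus → ℂ) x =
      ((((v : Torus → ℂ) x).re * ((φ : Torus → ℂ) x).re : ℝ) : ℂ) := fun x => by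
    apply Complex.ext <;> simp [hv, hφ]
  simp only [e]
  rw [integral_complex_ofReal, Complex.ofReal_im]

/-! ### Hölder continuous multipliers of fractional Sobolev spaces -/

/-- The singularity `|y|^τ` is integrable for `τ > -1`. -/
theorem lintegral_enorm_rpow_lt_top {τ : ℝ} (hτ : -1 < τ) : ∫⁻ y : Torus, ‖y‖ₑ ^ τ ∂haar < ⊤ := by
  set F : ℝ → ℝ≥0∞ := (Ioc 0 Real.pi).indicator fun a => ENNReal.ofReal (a ^ τ) with hF
  have hF1 : ∫⁻ a, F a < ⊤ := by
    rw [hF, lintegral_indicator measurableSet_Ioc]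
    have h := (intervalIntegral.intervalIntegrable_rpow' (a := 0) (b := Real.pi) hτ).1
    exact h.lintegral_lt_top
  have hF2 : Measurable F := by
    refine Measurable.indicator ?_ measurableSet_Ioc
    fun_prop
  have h1 : ∫⁻ y : Torus, ‖y‖ₑ ^ τ < ⊤ := by
    rw [← AddCircle.lintegral_preimage (2 * Real.pi) (-Real.pi)]
    refine lt_of_le_of_lt (b := ∫⁻ a, (F a + F (-a))) ?_ ?_
    · rw [← lintegral_indicator measurableSet_Ioc]
      have h0 : ∀ᵐ a : ℝ, a ≠ 0 := by simp [ae_iff]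
      refine lintegral_mono_ae ?_
      filter_upwards [h0] with a ha
      refine indicator_apply_le' (fun hmem => ?_) (fun _ => zero_le)
      have hle : |a| ≤ Real.pi := abs_le.2 ⟨hmem.1.le, by linarith [hmem.2]⟩
      have hn : ‖(a : Torus)‖ = |a| := by
        rw [AddCircle.norm_coe_eq_abs_iff _ Real.two_pi_pos.ne', abs_of_pos Real.two_pi_pos]
        linarith
      have hpos := abs_pos.2 ha
      have hFa : ‖(a : Torus)‖ₑ ^ τ = F |a| := by
        rw [hF, indicator_of_mem (show |a| ∈ Ioc 0 Real.pi from ⟨hpos, hle⟩), ← ENNReal.ofReal_rpow_of_pos hpos, ← hn,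
          ofReal_norm]
      rw [hFa]
      rcases abs_choice a with h | h <;> rw [h]
      · exact le_self_add
      · exact le_add_self
    · rw [lintegral_add_left hF2, lintegral_neg_eq_self F]
      exact ENNReal.add_lt_top.2 ⟨hF1, hF1⟩
  rw [AddCircle.volume_eq_smul_haarAddCircle, lintegral_smul_measure, smul_eq_mul] at h1
  exact ENNReal.lt_top_of_mul_ne_top_right h1.ne (by simp [Real.pi_pos])

theorem lintegral_edist_rpow (τ : ℝ) (x : Torus) :
    ∫⁻ y, edist x y ^ τ ∂haar = ∫⁻ y : Torus, ‖y‖ₑ ^ τ ∂haar := by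
  rw [← lintegral_sub_left_eq_self _ x]
  simp only [edist_eq_enorm_sub, sub_sub_cancel]

/-- Multiplication by a Hölder continuous function of exponent `θ > s` is bounded on `W^{s,q}`. -/
theorem exists_sobolevNorm_mul_le {s θ q : ℝ} (hsθ : s < θ) (hq : 1 ≤ q) :
    ∃ C : ℝ, 0 ≤ C ∧ ∀ (f z : Torus → ℂ) (A : ℝ), 0 ≤ A → AEStronglyMeasurable f haar →
      (∀ x, ‖z x‖ ≤ A) → (∀ x y, ‖z x - z y‖ ≤ A * dist x y ^ θ) →
      sobolevNorm s q (fun x => f x * z x) ≤ ENNReal.ofReal (C * A) * sobolevNorm s q f := by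
  have hq0 : 0 < q := by linarith
  set K : ℝ≥0∞ := ∫⁻ y : Torus, ‖y‖ₑ ^ ((θ - s) * q - 1) ∂haar with hK
  have hKlt : K < ⊤ := lintegral_enorm_rpow_lt_top (by nlinarith)
  set C₀ : ℝ≥0∞ := 1 + 2 ^ (q - 1) * (1 + K) with hC₀
  have hC₀lt : C₀ < ⊤ := by
    refine ENNReal.add_lt_top.2 ⟨ENNReal.one_lt_top, ENNReal.mul_lt_top ?_ ?_⟩
    · exact ENNReal.rpow_lt_top_of_nonneg (by linarith) (by simp)
    · exact ENNReal.add_lt_top.2 ⟨ENNReal.one_lt_top, hKlt⟩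
  have hC₁lt : C₀ ^ (1 / q) < ⊤ := ENNReal.rpow_lt_top_of_nonneg (by positivity) hC₀lt.ne
  refine ⟨(C₀ ^ (1 / q)).toReal, ENNReal.toReal_nonneg, fun f z A hA hf hz hzθ => ?_⟩
  set a : ℝ≥0∞ := ENNReal.ofReal A with ha
  set I : ℝ≥0∞ := ∫⁻ x, ‖f x‖ₑ ^ q ∂haar with hI
  set G : ℝ≥0∞ := ∫⁻ x, ∫⁻ y, ‖f x - f y‖ₑ ^ q / edist x y ^ (1 + s * q) ∂haar ∂haar with hG
  have hz' : ∀ x, ‖z x‖ₑ ≤ a := fun x => by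
    rw [ha, ← ofReal_norm]; exact ENNReal.ofReal_le_ofReal (hz x)
  have hzθ' : ∀ x y, x ≠ y → ‖z x - z y‖ₑ ≤ a * edist x y ^ θ := fun x y hxy => by
    rw [ha, edist_dist, ENNReal.ofReal_rpow_of_pos (dist_pos.2 hxy), ← ENNReal.ofReal_mul hA,
      ← ofReal_norm]
    exact ENNReal.ofReal_le_ofReal (hzθ x y)
  have h1 : ∫⁻ x, ‖f x * z x‖ₑ ^ q ∂haar ≤ a ^ q * I := by
    have haq : a ^ q ≠ ⊤ := (ENNReal.rpow_lt_top_of_nonneg hq0.le ENNReal.ofReal_ne_top).ne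
    rw [hI, ← lintegral_const_mul' _ _ haq]
    refine lintegral_mono fun x => ?_
    rw [enorm_mul, ENNReal.mul_rpow_of_nonneg _ _ hq0.le, mul_comm]
    exact mul_le_mul' (ENNReal.rpow_le_rpow (hz' x) hq0.le) le_rfl
  have h2 : ∫⁻ x, ∫⁻ y, ‖f x * z x - f y * z y‖ₑ ^ q / edist x y ^ (1 + s * q) ∂haar ∂haar ≤
      2 ^ (q - 1) * a ^ q * (G + I * K) := by
    set b : ℝ≥0∞ := 2 ^ (q - 1) * a ^ q with hb
    have hbt : b ≠ ⊤ := (ENNReal.mul_lt_top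
      (ENNReal.rpow_lt_top_of_nonneg (by linarith) (by simp))
      (ENNReal.rpow_lt_top_of_nonneg hq0.le ENNReal.ofReal_ne_top)).ne
    -- Leibniz rule for differences; the Hölder bound on `z` leaves an integrable singularity
    have hpt : ∀ x y, ‖f x * z x - f y * z y‖ₑ ^ q / edist x y ^ (1 + s * q) ≤
        b * (‖f x - f y‖ₑ ^ q / edist x y ^ (1 + s * q) +
          ‖f x‖ₑ ^ q * edist x y ^ ((θ - s) * q - 1)) := by
      intro x y
      rcases eq_or_ne x y with rfl | hxy
      · simp [ENNReal.zero_rpow_of_pos hq0]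
      have hd0 : edist x y ≠ 0 := (edist_pos.2 hxy).ne'
      have hdt : edist x y ≠ ⊤ := edist_ne_top x y
      have e1 : f x * z x - f y * z y = (f x - f y) * z y + f x * (z x - z y) := by ring
      have e2 : ‖f x * z x - f y * z y‖ₑ ^ q ≤
          b * (‖f x - f y‖ₑ ^ q + ‖f x‖ₑ ^ q * edist x y ^ (θ * q)) := by
        have : ‖f x * z x - f y * z y‖ₑ ≤
            a * ‖f x - f y‖ₑ + a * (‖f x‖ₑ * edist x y ^ θ) := by
          rw [e1]
          refine (enorm_add_le _ _).trans (add_le_add ?_ ?_)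
          · rw [enorm_mul, mul_comm]; exact mul_le_mul' (hz' y) le_rfl
          · rw [enorm_mul, mul_left_comm]; exact mul_le_mul' le_rfl (hzθ' x y hxy)
        refine (ENNReal.rpow_le_rpow this hq0.le).trans
          ((ENNReal.rpow_add_le_mul_rpow_add_rpow _ _ hq).trans (le_of_eq ?_))
        rw [ENNReal.mul_rpow_of_nonneg _ _ hq0.le, ENNReal.mul_rpow_of_nonneg _ _ hq0.le,
          ENNReal.mul_rpow_of_nonneg _ _ hq0.le, ← ENNReal.rpow_mul, hb]
        ring
      refine (ENNReal.div_le_div_right e2 _).trans (le_of_eq ?_)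
      have e3 : edist x y ^ ((θ - s) * q - 1) = edist x y ^ (θ * q) / edist x y ^ (1 + s * q) := by
        rw [← ENNReal.rpow_sub _ _ hd0 hdt]; congr 1; ring
      rw [e3]
      simp only [div_eq_mul_inv]
      ring
    have hin : ∀ x, ∫⁻ y, ‖f x * z x - f y * z y‖ₑ ^ q / edist x y ^ (1 + s * q) ∂haar ≤
        b * ((∫⁻ y, ‖f x - f y‖ₑ ^ q / edist x y ^ (1 + s * q) ∂haar) + ‖f x‖ₑ ^ q * K) := by
      intro x
      refine (lintegral_mono (hpt x)).trans (le_of_eq ?_)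
      have hm : Measurable fun y => edist x y ^ ((θ - s) * q - 1) := by fun_prop
      rw [lintegral_const_mul' _ _ hbt, lintegral_add_right _ (hm.const_mul _),
        lintegral_const_mul _ hm, lintegral_edist_rpow]
    refine (lintegral_mono hin).trans (le_of_eq ?_)
    have hm : AEMeasurable (fun x => ‖f x‖ₑ ^ q) haar := hf.enorm.pow_const q
    rw [lintegral_const_mul' _ _ hbt, lintegral_add_right' _ (hm.mul_const _),
      lintegral_mul_const'' _ hm]
  have h3 : (∫⁻ x, ‖f x * z x‖ₑ ^ q ∂haar) +
      ∫⁻ x, ∫⁻ y, ‖f x * z x - f y * z y‖ₑ ^ q / edist x y ^ (1 + s * q) ∂haar ∂haar ≤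
      C₀ * a ^ q * (I + G) := by
    refine (add_le_add h1 h2).trans ?_
    have e : C₀ * a ^ q * (I + G) = (a ^ q * I + 2 ^ (q - 1) * a ^ q * (G + I * K)) +
        (a ^ q * G + 2 ^ (q - 1) * a ^ q * (I + G * K)) := by rw [hC₀]; ring
    rw [e]
    exact le_self_add
  rw [sobolevNorm, sobolevNorm]
  refine (ENNReal.rpow_le_rpow h3 (by positivity)).trans (le_of_eq ?_)
  rw [ENNReal.mul_rpow_of_nonneg _ _ (by positivity), ENNReal.mul_rpow_of_nonneg _ _ (by positivity),
    ← ENNReal.rpow_mul, mul_one_div_cancel hq0.ne', ENNReal.rpow_one,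
    ENNReal.ofReal_mul ENNReal.toReal_nonneg, ENNReal.ofReal_toReal hC₁lt.ne]

theorem sobolevNorm_one {s q : ℝ} (hq : 0 < q) : sobolevNorm s q (fun _ => 1) = 1 := by
  simp [sobolevNorm, ENNReal.zero_rpow_of_pos hq]

/-- Bounded Hölder continuous functions of exponent `θ > s` belong to `W^{s,q}`. -/
theorem exists_sobolevNorm_le_of_holder {s θ q : ℝ} (hsθ : s < θ) (hq : 1 ≤ q) :
    ∃ C : ℝ, 0 ≤ C ∧ ∀ (z : Torus → ℂ) (A : ℝ), 0 ≤ A → (∀ x, ‖z x‖ ≤ A) →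
      (∀ x y, ‖z x - z y‖ ≤ A * dist x y ^ θ) → sobolevNorm s q z ≤ ENNReal.ofReal (C * A) := by
  obtain ⟨C, hC, h⟩ := exists_sobolevNorm_mul_le hsθ hq
  refine ⟨C, hC, fun z A hA hz hzθ => ?_⟩
  have := h (fun _ => 1) z A hA aestronglyMeasurable_const hz hzθ
  simpa only [one_mul, sobolevNorm_one (by linarith : 0 < q), mul_one] using this

/-! ### Fourier synthesis of `H¹` functions -/

theorem hasSum_normSq_fourierCoeff {f : Torus → ℂ} (hf : MemLp f 2 haar) :
    HasSum (fun n => ‖fourierCoeff f n‖ ^ 2) (∫ x, ‖f x‖ ^ 2 ∂haar) := by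
  have h := hasSum_sq_fourierCoeff (hf.toLp f)
  rw [fourierCoeff_congr_ae hf.coeFn_toLp] at h
  have e : ∫ x, ‖f x‖ ^ 2 ∂haar = ∫ x, ‖hf.toLp f x‖ ^ 2 ∂haar :=
    integral_congr_ae (hf.coeFn_toLp.mono fun x hx => by simp only [hx])
  rwa [e]

theorem ae_eq_of_fourierCoeff {f g : Torus → ℂ} (hf : MemLp f 2 haar) (hg : MemLp g 2 haar)
    (h : ∀ n, fourierCoeff f n = fourierCoeff g n) : f =ᵐ[haar] g := by
  rw [← MemLp.toLp_eq_toLp_iff hf hg]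
  apply fourierBasis.repr.injective
  ext n
  rw [fourierBasis_repr, fourierBasis_repr, fourierCoeff_congr_ae hf.coeFn_toLp,
    fourierCoeff_congr_ae hg.coeFn_toLp, h]

/-- The sequence of Fourier coefficients of a square integrable function. -/
def fourierSeq {f : Torus → ℂ} (hf : MemLp f 2 haar) : Seq :=
  ⟨fourierCoeff f, memlp_two_iff.2 (hasSum_normSq_fourierCoeff hf).summable⟩

theorem eLpNorm_two_sq {f : Torus → ℂ} (hf : MemLp f 2 haar) :
    eLpNorm f 2 haar ^ 2 = ENNReal.ofReal (∫ x, ‖f x‖ ^ 2 ∂haar) := by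
  rw [← ENNReal.rpow_natCast, eLpNorm_eq_lintegral_rpow_enorm_toReal (by norm_num) (by norm_num),
    ← ENNReal.rpow_mul, ofReal_integral_eq_lintegral_ofReal hf.integrable_norm_pow'
      (Eventually.of_forall fun x => by positivity)]
  simp only [ENNReal.toReal_ofNat, Nat.cast_ofNat, one_div]
  rw [inv_mul_cancel₀ (by norm_num), ENNReal.rpow_one]
  refine lintegral_congr fun x => ?_
  rw [ENNReal.ofReal_pow (norm_nonneg _), ofReal_norm, ENNReal.rpow_two]

theorem memlp_evalKer (x : Torus) :
    Memℓp (fun n : ℤ => (jap n : ℂ)⁻¹ * (starRingEnd ℂ) (fourier n x)) 2 := by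
  refine memlp_two_iff.2 (summable_jap_zpow_neg_two.congr fun n => ?_)
  rw [norm_mul, RCLike.norm_conj, norm_fourier_apply, mul_one, norm_inv, Complex.norm_real,
    Real.norm_of_nonneg (jap_pos n).le, inv_pow]

/-- The vector representing evaluation at `x` of the `H¹` function with coefficients
`c n / ⟨n⟩`. -/
def evalKer (x : Torus) : Seq := ⟨_, memlp_evalKer x⟩

theorem evalKer_apply (x : Torus) (n : ℤ) :
    evalKer x n = (jap n : ℂ)⁻¹ * (starRingEnd ℂ) (fourier n x) := rfl

/-- The function `∑ₙ ⟨n⟩⁻¹ c n exp(i n ·)`; its `H¹` norm is the norm of `c`. -/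
def synth (c : Seq) (x : Torus) : ℂ := inner ℂ (evalKer x) c

theorem synth_add (c d : Seq) (x : Torus) : synth (c + d) x = synth c x + synth d x :=
  inner_add_right _ _ _

theorem synth_sub (c d : Seq) (x : Torus) : synth (c - d) x = synth c x - synth d x :=
  inner_sub_right _ _ _

theorem synth_smul (a : ℂ) (c : Seq) (x : Torus) : synth (a • c) x = a * synth c x :=
  inner_smul_right _ _ _

/-- Interpolation between the Lipschitz bound for the exponential and its boundedness. -/
theorem norm_fourier_sub_le_rpow {θ : ℝ} (h0 : 0 ≤ θ) (h1 : θ ≤ 1) (n : ℤ) (x y : Torus) :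
    ‖(fourier n x : ℂ) - fourier n y‖ ≤ 2 * (jap n ^ θ * dist x y ^ θ) := by
  rw [← Real.mul_rpow (jap_pos n).le dist_nonneg]
  have hnn : 0 ≤ jap n * dist x y := mul_nonneg (jap_pos n).le dist_nonneg
  rcases le_total (jap n * dist x y) 1 with h | h
  · have h2 : jap n * dist x y ≤ (jap n * dist x y) ^ θ := by
      simpa using Real.rpow_le_rpow_of_exponent_ge_of_imp hnn h h1 (by intro _ h; simp at h)
    have h3 := (norm_fourier_sub_le n x y).trans
      (mul_le_mul_of_nonneg_right (abs_le_jap n) dist_nonneg)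
    linarith
  · have h2 : 1 ≤ (jap n * dist x y) ^ θ := Real.one_le_rpow h h0
    have h3 := norm_sub_le (fourier n x : ℂ) (fourier n y)
    rw [norm_fourier_apply, norm_fourier_apply] at h3
    linarith

/-- `H¹` functions are bounded and Hölder continuous of every exponent below `1/2`, stated for the
evaluation functionals. -/
theorem exists_norm_evalKer_le {θ : ℝ} (h0 : 0 ≤ θ) (h1 : θ < 1 / 2) :
    ∃ A : ℝ, 0 ≤ A ∧ (∀ x, ‖evalKer x‖ ≤ A) ∧
      ∀ x y, ‖evalKer x - evalKer y‖ ≤ A * dist x y ^ θ := by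
  have hs : Summable fun n : ℤ => 4 * jap n ^ (-(2 - 2 * θ)) :=
    (summable_jap_rpow (by linarith)).mul_left 4
  set σ := ∑' n : ℤ, 4 * jap n ^ (-(2 - 2 * θ)) with hσ
  have e : ∀ n : ℤ, jap n ^ (-(2 - 2 * θ)) = (jap n ^ 2)⁻¹ * (jap n ^ θ) ^ 2 := fun n => by
    rw [neg_sub, Real.rpow_sub (jap_pos n), Real.rpow_two, ← Real.rpow_mul_natCast (jap_pos n).le,
      Nat.cast_ofNat, mul_comm 2 θ, div_eq_inv_mul]
  have hσ0 : 0 ≤ σ := tsum_nonneg fun n => by have := jap_pos n; positivity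
  refine ⟨√σ, Real.sqrt_nonneg _, fun x => ?_, fun x y => ?_⟩
  · refine Real.le_sqrt_of_sq_le ?_
    refine hasSum_le (fun n => ?_) (hasSum_normSq_seq (evalKer x)) hs.hasSum
    rw [evalKer_apply, norm_mul, RCLike.norm_conj, norm_fourier_apply, mul_one, norm_inv,
      Complex.norm_real, Real.norm_of_nonneg (jap_pos n).le, inv_pow, e]
    have h2 : 1 ≤ jap n ^ θ := Real.one_le_rpow (one_le_jap n) h0
    have h3 : 0 < (jap n ^ 2)⁻¹ := by have := jap_pos n; positivity
    nlinarith [mul_le_mul_of_nonneg_left (one_le_pow₀ h2 (n := 2)) h3.le]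
  · have hd : 0 ≤ dist x y ^ θ := Real.rpow_nonneg dist_nonneg _
    refine abs_le_of_sq_le_sq' ?_ (by positivity) |>.2
    rw [mul_pow, Real.sq_sqrt hσ0]
    refine hasSum_le (fun n => ?_) (hasSum_normSq_seq (evalKer x - evalKer y))
      (hs.hasSum.mul_right ((dist x y ^ θ) ^ 2))
    rw [lp.coeFn_sub, Pi.sub_apply, evalKer_apply, evalKer_apply, ← mul_sub, ← map_sub, norm_mul,
      RCLike.norm_conj, norm_inv, Complex.norm_real, Real.norm_of_nonneg (jap_pos n).le, mul_pow,
      inv_pow, e]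
    have h3 : 0 ≤ (jap n ^ 2)⁻¹ := by have := jap_pos n; positivity
    have h4 := pow_le_pow_left₀ (norm_nonneg _) (norm_fourier_sub_le_rpow h0 (by linarith) n x y) 2
    calc (jap n ^ 2)⁻¹ * ‖(fourier n x : ℂ) - fourier n y‖ ^ 2
        ≤ (jap n ^ 2)⁻¹ * (2 * (jap n ^ θ * dist x y ^ θ)) ^ 2 := mul_le_mul_of_nonneg_left h4 h3
      _ = _ := by ring

theorem continuous_evalKer : Continuous evalKer := by
  obtain ⟨A, hA, -, h⟩ := exists_norm_evalKer_le (θ := 1 / 4) (by norm_num) (by norm_num)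
  refine continuous_iff_continuousAt.2 fun x => ?_
  rw [ContinuousAt, tendsto_iff_norm_sub_tendsto_zero]
  refine squeeze_zero (fun _ => norm_nonneg _) (fun y => h y x) ?_
  have : Continuous fun y => A * dist y x ^ (1 / 4 : ℝ) :=
    continuous_const.mul ((continuous_id.dist continuous_const).rpow_const fun _ => Or.inr
      (by norm_num))
  have h2 := this.tendsto x
  rwa [dist_self, Real.zero_rpow (by norm_num), mul_zero] at h2

theorem continuous_synth_uncurry : Continuous fun p : Seq × Torus => synth p.1 p.2 :=
  (continuous_evalKer.comp continuous_snd).inner continuous_fst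

theorem continuous_synth (c : Seq) : Continuous (synth c) :=
  continuous_synth_uncurry.comp (Continuous.prodMk_right c)

theorem hasSum_synth (c : Seq) (x : Torus) :
    HasSum (fun n => invJap c n * fourier n x) (synth c x) := by
  have h := lp.hasSum_inner (𝕜 := ℂ) (evalKer x) c
  refine h.congr_fun fun n => ?_
  rw [evalKer_apply, invJap_apply, RCLike.inner_apply, map_mul, map_inv₀, Complex.conj_ofReal,
    Complex.conj_conj]
  ring

theorem integral_fourier_smul_evalKer (n : ℤ) :
    ∫ x, (fourier n x : ℂ) • evalKer x ∂haar = (jap n : ℂ)⁻¹ • (lp.single 2 n (1 : ℂ) : Seq) := by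
  have hint : Integrable (fun x => (fourier n x : ℂ) • evalKer x) haar :=
    integrable_of_continuous ((map_continuous (fourier n)).smul continuous_evalKer)
  ext m
  rw [← inner_single_one m (∫ x, (fourier n x : ℂ) • evalKer x ∂haar), ← integral_inner hint]
  have e : ∀ x, inner ℂ (lp.single 2 m (1 : ℂ) : Seq) ((fourier n x : ℂ) • evalKer x) =
      (jap m : ℂ)⁻¹ * ((fourier (-m) x : ℂ) • (fourier n x : ℂ)) := fun x => by
    rw [inner_single_one, lp.coeFn_smul, Pi.smul_apply, evalKer_apply, fourier_neg]
    simp only [smul_eq_mul]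
    ring
  simp only [e]
  rw [integral_const_mul]
  change _ * fourierCoeff (fun x => (fourier n x : ℂ)) m = _
  rw [show (fun x => (fourier n x : ℂ)) = ⇑(fourier n) from rfl, fourierCoeff_fourier]
  rw [lp.coeFn_smul, Pi.smul_apply, lp.single_apply, smul_eq_mul]
  rcases eq_or_ne m n with rfl | hmn
  · simp
  · simp [hmn]

theorem fourierCoeff_synth (c : Seq) (n : ℤ) : fourierCoeff (synth c) n = invJap c n := by
  have hint : Integrable (fun x => (fourier n x : ℂ) • evalKer x) haar :=
    integrable_of_continuous ((map_continuous (fourier n)).smul continuous_evalKer)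
  have e : ∀ x, (fourier (-n) x : ℂ) • synth c x =
      (starRingEnd ℂ) (inner ℂ c ((fourier n x : ℂ) • evalKer x)) := fun x => by
    rw [inner_conj_symm, inner_smul_left, fourier_neg, synth, smul_eq_mul]
  rw [fourierCoeff]
  simp only [e]
  rw [integral_conj, integral_inner hint, integral_fourier_smul_evalKer, inner_conj_symm,
    inner_smul_left, inner_single_one, map_inv₀, Complex.conj_ofReal, invJap_apply]

theorem memLp_synth (c : Seq) : MemLp (synth c) 2 haar := by
  obtain ⟨A, hA, h, -⟩ := exists_norm_evalKer_le (θ := 0) le_rfl (by norm_num)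
  exact MemLp.of_bound (continuous_synth c).aestronglyMeasurable (A * ‖c‖)
    (Eventually.of_forall fun x => (norm_inner_le_norm _ _).trans
      (mul_le_mul_of_nonneg_right (h x) (norm_nonneg _)))

theorem integral_normSq_synth (c : Seq) : ∫ x, ‖synth c x‖ ^ 2 ∂haar = ‖invJap c‖ ^ 2 := by
  refine (hasSum_normSq_fourierCoeff (memLp_synth c)).unique ?_
  simp only [fourierCoeff_synth]
  exact hasSum_normSq_seq _

theorem eLpNorm_synth (c : Seq) : eLpNorm (synth c) 2 haar = ENNReal.ofReal ‖invJap c‖ := by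
  have h := eLpNorm_two_sq (memLp_synth c)
  rw [integral_normSq_synth, ENNReal.ofReal_pow (norm_nonneg _)] at h
  exact (ENNReal.pow_right_strictMono two_ne_zero).injective h

theorem hOneNormSq_synth (c : Seq) : hOneNormSq (synth c) = ENNReal.ofReal (‖c‖ ^ 2) := by
  have h1 := hasSum_normSq_seq (invJap c)
  have h2 := hasSum_normSq_seq c
  have h3 := h2.sub h1
  have e : ∀ n, ‖c n‖ ^ 2 - ‖invJap c n‖ ^ 2 = (n : ℝ) ^ 2 * ‖invJap c n‖ ^ 2 := fun n => by
    have hj := jap_pos n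
    rw [invJap_apply, norm_mul, norm_inv, Complex.norm_real, Real.norm_of_nonneg hj.le, mul_pow,
      inv_pow]
    have := jap_sq n
    field_simp
    rw [this]
    ring
  simp only [e] at h3
  have h4 : ∑' n : ℤ, ENNReal.ofReal ((n : ℝ) ^ 2) * ‖fourierCoeff (synth c) n‖ₑ ^ 2 =
      ENNReal.ofReal (‖c‖ ^ 2 - ‖invJap c‖ ^ 2) := by
    rw [← h3.tsum_eq, ENNReal.ofReal_tsum_of_nonneg (fun n => by positivity) h3.summable]
    refine tsum_congr fun n => ?_
    rw [ENNReal.ofReal_mul (by positivity), fourierCoeff_synth, ENNReal.ofReal_pow (norm_nonneg _),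
      ofReal_norm]
  rw [hOneNormSq, h4, eLpNorm_synth, ← ENNReal.ofReal_pow (norm_nonneg _),
    ← ENNReal.ofReal_add (by positivity)]
  · congr 1; ring
  · exact sub_nonneg.2 (pow_le_pow_left₀ (norm_nonneg _) (norm_invJap_le c) 2)

/-! ### Truncation of sequences -/

/-- The restriction of a sequence to the indices `|n| ≤ M`. -/
def trunc (M : ℕ) (c : Seq) : Seq := ∑ n ∈ Finset.Icc (-(M : ℤ)) M, lp.single 2 n (c n)

theorem tendsto_Icc_atTop : Tendsto (fun M : ℕ => Finset.Icc (-(M : ℤ)) M) atTop atTop := by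
  refine tendsto_atTop_finset_of_monotone (fun M N h => ?_) fun n => ⟨n.natAbs, ?_⟩
  · exact Finset.Icc_subset_Icc (by omega) (by omega)
  · rw [Finset.mem_Icc]; omega

theorem tendsto_trunc (c : Seq) : Tendsto (fun M => trunc M c) atTop (𝓝 c) := by
  have h := lp.hasSum_single (by norm_num) c
  rw [HasSum, SummationFilter.unconditional_filter] at h
  exact h.comp tendsto_Icc_atTop

theorem synth_trunc (c : Seq) (M : ℕ) : synth (trunc M c) = trig (fun n => invJap c n) M := by
  ext x
  rw [synth, trunc, inner_sum, trig]
  refine Finset.sum_congr rfl fun n _ => ?_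
  rw [← inner_conj_symm, ← mul_one (c n), ← smul_eq_mul, lp.single_smul, inner_smul_left,
    inner_single_one, evalKer_apply, invJap_apply]
  simp only [map_mul, map_inv₀, Complex.conj_ofReal, Complex.conj_conj]
  ring

/-! ### Multiplication by a distribution as an operator on sequences -/

section Holder

variable {θ A : ℝ}

theorem norm_synth_le (h : ∀ x, ‖evalKer x‖ ≤ A) (c : Seq) (x : Torus) : ‖synth c x‖ ≤ A * ‖c‖ :=
  (norm_inner_le_norm _ _).trans (mul_le_mul_of_nonneg_right (h x) (norm_nonneg _))

theorem norm_synth_sub_le (h : ∀ x y, ‖evalKer x - evalKer y‖ ≤ A * dist x y ^ θ) (c : Seq)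
    (x y : Torus) : ‖synth c x - synth c y‖ ≤ A * ‖c‖ * dist x y ^ θ := by
  rw [synth, synth, ← inner_sub_left]
  refine (norm_inner_le_norm _ _).trans
    ((mul_le_mul_of_nonneg_right (h x y) (norm_nonneg _)).trans (le_of_eq ?_))
  ring

end Holder

/-- The product of the conjugate of one `H¹` function with another one. -/
def conjMul (d c : Seq) (x : Torus) : ℂ := (starRingEnd ℂ) (synth d x) * synth c x

theorem continuous_conjMul (d c : Seq) : Continuous (conjMul d c) :=
  (Complex.continuous_conj.comp (continuous_synth d)).mul (continuous_synth c)

/-- Products of `H¹` functions belong to `W^{s,q}` for `s < 1/2`, being Hölder continuous of an exponent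
strictly between `s` and `1/2`. -/
theorem exists_sobolevNorm_conjMul_le {s q : ℝ} (h0 : 0 < s) (hs : s < 1 / 2) (hq : 1 ≤ q) :
    ∃ C : ℝ, 0 ≤ C ∧ ∀ d c, sobolevNorm s q (conjMul d c) ≤ ENNReal.ofReal (C * (‖d‖ * ‖c‖)) := by
  obtain ⟨A, hA, hk, hk'⟩ := exists_norm_evalKer_le (θ := (s + 1 / 2) / 2) (by linarith)
    (by linarith)
  obtain ⟨C, hC, h⟩ := exists_sobolevNorm_le_of_holder (s := s) (θ := (s + 1 / 2) / 2)
    (by linarith) hq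
  refine ⟨C * (2 * A ^ 2), by positivity, fun d c => ?_⟩
  have h1 := h (conjMul d c) (2 * A ^ 2 * (‖d‖ * ‖c‖)) (by positivity) (fun x => ?_) fun x y => ?_
  · rwa [← mul_assoc] at h1
  · rw [conjMul, norm_mul, RCLike.norm_conj]
    refine (mul_le_mul (norm_synth_le hk d x) (norm_synth_le hk c x) (norm_nonneg _)
      (by positivity)).trans ?_
    have : 0 ≤ A ^ 2 * (‖d‖ * ‖c‖) := by positivity
    nlinarith
  · have e : conjMul d c x - conjMul d c y =
        (starRingEnd ℂ) (synth d x) * (synth c x - synth c y) +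
        (starRingEnd ℂ) (synth d x - synth d y) * synth c y := by
      rw [conjMul, conjMul, map_sub]; ring
    rw [e]
    refine (norm_add_le _ _).trans ?_
    rw [norm_mul, norm_mul, RCLike.norm_conj, RCLike.norm_conj]
    have hd : 0 ≤ dist x y ^ ((s + 1 / 2) / 2) := Real.rpow_nonneg dist_nonneg _
    have h2 := mul_le_mul (norm_synth_le hk d x) (norm_synth_sub_le hk' c x y) (norm_nonneg _)
      (by positivity)
    have h3 := mul_le_mul (norm_synth_sub_le hk' d x y) (norm_synth_le hk c y) (norm_nonneg _)
      (by positivity)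
    linarith

theorem tendsto_pairing {α s q : ℝ} (h : Admissible α s q) {u : SmoothFn →ₗ[ℂ] ℂ}
    (hu : besovNorm α 1 u < ⊤) {g : Torus → ℂ} (hgm : AEStronglyMeasurable g haar)
    (hg : sobolevNorm s q g < ⊤) :
    Tendsto (fun N => ∫ x, lowFreq u N x * g x ∂haar) atTop (𝓝 (pairing u g)) := by
  obtain ⟨C, r, -, -, -, hC⟩ := exists_pairing_bound h
  exact (hC u hu g hgm hg).1

/-- The operator `B` represents the sesquilinear form `(d, c) ↦ ⟨u, conj d · c⟩` on `H¹`. It is the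
multiplication by `u`, from `H¹` into its dual, and is determined by `u`. -/
def IsFormOf (u : SmoothFn →ₗ[ℂ] ℂ) (B : Seq →L[ℂ] Seq) : Prop :=
  ∀ d c, inner ℂ d (B c) = pairing u (conjMul d c)

section Form

variable {α s q : ℝ} {u : SmoothFn →ₗ[ℂ] ℂ}

theorem tendsto_pairing_conjMul (h : Admissible α s q) (hu : besovNorm α 1 u < ⊤) (d c : Seq) :
    Tendsto (fun N => ∫ x, lowFreq u N x * conjMul d c x ∂haar) atTop
      (𝓝 (pairing u (conjMul d c))) := by
  obtain ⟨C, hC, hCb⟩ := exists_sobolevNorm_conjMul_le h.s_pos h.s_lt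
    (by linarith [h.two_le] : 1 ≤ q)
  exact tendsto_pairing h hu (continuous_conjMul d c).aestronglyMeasurable
    ((hCb d c).trans_lt ENNReal.ofReal_lt_top)

/-- Multiplication by `u ∈ B^α_{1,∞}` is bounded from `H¹` into its dual. -/
theorem exists_isFormOf (h : Admissible α s q) (hu : besovNorm α 1 u < ⊤) : ∃ B, IsFormOf u B := by
  have hq : 1 ≤ q := by linarith [h.two_le]
  obtain ⟨C₁, hC₁, hCb⟩ := exists_sobolevNorm_conjMul_le h.s_pos h.s_lt hq
  obtain ⟨C₂, r, hC₂, -, -, hP⟩ := exists_pairing_bound h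
  have hint : ∀ N d c, Integrable (fun x => lowFreq u N x * conjMul d c x) haar := fun N d c =>
    integrable_of_continuous ((continuous_lowFreq u N).mul (continuous_conjMul d c))
  have hT := tendsto_pairing_conjMul h hu
  have hbound : ∀ d c, ‖pairing u (conjMul d c)‖ ≤
      (C₂ * (besovNorm α 1 u).toReal * C₁) * ‖d‖ * ‖c‖ := by
    intro d c
    have hfin := (hCb d c).trans_lt ENNReal.ofReal_lt_top
    refine ((hP u hu _ (continuous_conjMul d c).aestronglyMeasurable hfin).2.1).trans ?_
    have h1 := ENNReal.toReal_mono ENNReal.ofReal_ne_top (hCb d c)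
    rw [ENNReal.toReal_ofReal (by positivity)] at h1
    refine (mul_le_mul_of_nonneg_left h1 (by positivity)).trans (le_of_eq ?_)
    ring
  let b : Seq →ₗ⋆[ℂ] Seq →ₗ[ℂ] ℂ := LinearMap.mk₂'ₛₗ (starRingEnd ℂ) (RingHom.id ℂ)
    (fun d c => pairing u (conjMul d c))
    (fun d₁ d₂ c => tendsto_nhds_unique (hT (d₁ + d₂) c) <| by
      refine ((hT d₁ c).add (hT d₂ c)).congr fun N => ?_
      rw [← integral_add (hint N d₁ c) (hint N d₂ c)]
      congr 1; ext x; rw [conjMul, conjMul, conjMul, synth_add, map_add]; ring)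
    (fun a d c => tendsto_nhds_unique (hT (a • d) c) <| by
      refine ((hT d c).const_mul ((starRingEnd ℂ) a)).congr fun N => ?_
      rw [← integral_const_mul]
      congr 1; ext x; rw [conjMul, conjMul, synth_smul, map_mul]; ring)
    (fun d c₁ c₂ => tendsto_nhds_unique (hT d (c₁ + c₂)) <| by
      refine ((hT d c₁).add (hT d c₂)).congr fun N => ?_
      rw [← integral_add (hint N d c₁) (hint N d c₂)]
      congr 1; ext x; rw [conjMul, conjMul, conjMul, synth_add]; ring)
    (fun a d c => tendsto_nhds_unique (hT d (a • c)) <| by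
      refine ((hT d c).const_mul a).congr fun N => ?_
      rw [← integral_const_mul]
      congr 1; ext x; rw [conjMul, conjMul, synth_smul]; ring)
  let b' : Seq →L⋆[ℂ] Seq →L[ℂ] ℂ := b.mkContinuous₂ _ hbound
  refine ⟨ContinuousLinearMap.adjoint (InnerProductSpace.continuousLinearMapOfBilin b'),
    fun d c => ?_⟩
  rw [ContinuousLinearMap.adjoint_inner_right, InnerProductSpace.continuousLinearMapOfBilin_apply]
  rfl

/-- The form of a real distribution is Hermitian. -/
theorem IsFormOf.im_inner_self (h : Admissible α s q) (hu : besovNorm α 1 u < ⊤)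
    (hur : IsRealDistribution u) {B : Seq →L[ℂ] Seq} (hB : IsFormOf u B) (c : Seq) :
    (inner ℂ c (B c)).im = 0 := by
  rw [hB]
  have h1 := (Complex.continuous_im.tendsto _).comp (tendsto_pairing_conjMul h hu c c)
  refine tendsto_nhds_unique h1 (tendsto_const_nhds.congr fun N => ?_)
  have e : ∀ x, lowFreq u N x * conjMul c c x =
      (((lowFreq u N x).re * ‖synth c x‖ ^ 2 : ℝ) : ℂ) := fun x => by
    rw [conjMul, ← Complex.normSq_eq_conj_mul_self, Complex.normSq_eq_norm_sq]
    apply Complex.ext <;> simp [im_lowFreq hur]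
  simp only [Function.comp_apply, e]
  rw [integral_complex_ofReal, Complex.ofReal_im]

end Form

/-- The complex conjugate of a smooth function. -/
def smoothConj (φ : SmoothFn) : SmoothFn :=
  ⟨fun x => (starRingEnd ℂ) ((φ : Torus → ℂ) x),
    Complex.conjCLE.contDiff.comp (smoothFn_contDiff φ)⟩

theorem pairing_smooth {u : SmoothFn →ₗ[ℂ] ℂ} (hu : IsDistribution u) (φ : SmoothFn) :
    pairing u (φ : Torus → ℂ) = u φ :=
  (tendsto_integral_lowFreq hu φ).limUnder_eq

theorem exists_smooth_conjMul_trunc (d c : Seq) (M : ℕ) :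
    ∃ φ : SmoothFn, (φ : Torus → ℂ) = conjMul (trunc M d) (trunc M c) := by
  refine ⟨smoothMul (smoothConj (smoothTrig (fun n => invJap d n) M))
    (smoothTrig (fun n => invJap c n) M), ?_⟩
  ext x
  rw [conjMul, synth_trunc, synth_trunc, ← smoothTrig_coe, ← smoothTrig_coe]
  rfl

theorem norm_apply_le_negSobolevNorm {s p : ℝ} {w : SmoothFn →ₗ[ℂ] ℂ}
    (hw : negSobolevNorm s p w < ⊤) {φ : SmoothFn}
    (hφ : sobolevNorm (-s) (p / (p - 1)) (φ : Torus → ℂ) ≤ 1) :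
    ‖w φ‖ ≤ (negSobolevNorm s p w).toReal := by
  have h : ‖w φ‖ₑ ≤ negSobolevNorm s p w := le_iSup₂ (f := fun (φ : SmoothFn)
    (_ : sobolevNorm (-s) (p / (p - 1)) (φ : Torus → ℂ) ≤ 1) => ‖w φ‖ₑ) φ hφ
  have h2 := ENNReal.toReal_mono hw.ne h
  rwa [toReal_enorm] at h2

/-- The forms depend on the distribution continuously with respect to negative Sobolev norms. -/
theorem exists_norm_inner_sub_le {σ p : ℝ} (h0 : 0 < -σ) (hs : -σ < 1 / 2) (hq : 1 ≤ p / (p - 1)) :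
    ∃ C : ℝ, 0 ≤ C ∧ ∀ (u v : SmoothFn →ₗ[ℂ] ℂ) (B₁ B₂ : Seq →L[ℂ] Seq), IsDistribution u →
      IsDistribution v → IsFormOf u B₁ → IsFormOf v B₂ → negSobolevNorm σ p (v - u) < ⊤ →
      ∀ d c, ‖inner ℂ d (B₂ c) - inner ℂ d (B₁ c)‖ ≤
        C * (negSobolevNorm σ p (v - u)).toReal * (‖d‖ * ‖c‖) := by
  obtain ⟨C, hC, hCb⟩ := exists_sobolevNorm_conjMul_le h0 hs hq
  refine ⟨C, hC, fun u v B₁ B₂ hu hv h₁ h₂ hfin d c => ?_⟩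
  set η := (negSobolevNorm σ p (v - u)).toReal with hη
  -- by homogeneity it suffices to treat sequences of finite support, of small norm
  have key : ∀ M d c, C * (‖trunc M d‖ * ‖trunc M c‖) ≤ 1 →
      ‖inner ℂ (trunc M d) (B₂ (trunc M c)) - inner ℂ (trunc M d) (B₁ (trunc M c))‖ ≤ η := by
    intro M d c hle
    obtain ⟨φ, hφ⟩ := exists_smooth_conjMul_trunc d c M
    rw [h₁, h₂, ← hφ, pairing_smooth hu, pairing_smooth hv, ← LinearMap.sub_apply]
    refine norm_apply_le_negSobolevNorm hfin ?_
    rw [hφ]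
    refine (hCb _ _).trans ?_
    rw [← ENNReal.ofReal_one]
    exact ENNReal.ofReal_le_ofReal hle
  -- the summand `δ` avoids a division by zero in the rescaling
  have key2 : ∀ M, ∀ δ > 0,
      ‖inner ℂ (trunc M d) (B₂ (trunc M c)) - inner ℂ (trunc M d) (B₁ (trunc M c))‖ ≤
        (C * (‖trunc M d‖ * ‖trunc M c‖) + δ) * η := by
    intro M δ hδ
    set K := C * (‖trunc M d‖ * ‖trunc M c‖) + δ with hK
    have hK0 : 0 < K := by positivity
    have hsm : trunc M (((K⁻¹ : ℝ) : ℂ) • c) = ((K⁻¹ : ℝ) : ℂ) • trunc M c := by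
      rw [trunc, trunc, Finset.smul_sum]
      refine Finset.sum_congr rfl fun n _ => ?_
      rw [lp.coeFn_smul, Pi.smul_apply, lp.single_smul]
    have hn : ‖((K⁻¹ : ℝ) : ℂ)‖ = K⁻¹ := by
      rw [Complex.norm_real, Real.norm_of_nonneg (by positivity)]
    have h3 := key M d (((K⁻¹ : ℝ) : ℂ) • c) (by
      rw [hsm, norm_smul, hn]
      have : C * (‖trunc M d‖ * (K⁻¹ * ‖trunc M c‖)) = (K - δ) * K⁻¹ := by rw [hK]; ring
      rw [this, sub_mul, mul_inv_cancel₀ hK0.ne']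
      have : 0 < δ * K⁻¹ := by positivity
      linarith)
    rw [hsm, map_smul, map_smul, inner_smul_right, inner_smul_right, ← mul_sub, norm_mul, hn,
      inv_mul_le_iff₀ hK0] at h3
    exact h3
  have hd := tendsto_trunc d
  have hc := tendsto_trunc c
  have h4 : ∀ M, ‖inner ℂ (trunc M d) (B₂ (trunc M c)) - inner ℂ (trunc M d) (B₁ (trunc M c))‖ ≤
      C * η * (‖trunc M d‖ * ‖trunc M c‖) := by
    intro M
    refine le_of_forall_pos_le_add fun δ hδ => ?_
    have h5 := key2 M (δ / (η + 1)) (by positivity)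
    have hη0 : 0 ≤ η := ENNReal.toReal_nonneg
    have h6 : δ / (η + 1) * η ≤ δ := by
      rw [div_mul_eq_mul_div, div_le_iff₀ (by positivity)]; nlinarith
    nlinarith
  refine le_of_tendsto_of_tendsto' (b := atTop) ?_ ?_ h4
  · exact ((hd.inner ((B₂.continuous.tendsto c).comp hc)).sub
      (hd.inner ((B₁.continuous.tendsto c).comp hc))).norm
  · exact (hd.norm.mul hc.norm).const_mul _

/-- The approximations `S_n u` of a real distribution `u` by real smooth functions converge in
negative Sobolev spaces. -/
theorem exists_smooth_approx {α σ p : ℝ} (h : Admissible α (-σ) (p / (p - 1)))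
    {u : SmoothFn →ₗ[ℂ] ℂ} (hu : MemBesov α 1 u) (hur : IsRealDistribution u) :
    ∃ v : ℕ → SmoothFn, (∀ n x, ((v n : Torus → ℂ) x).im = 0) ∧
      Tendsto (fun n => negSobolevNorm σ p (ofSmooth (v n) - u)) atTop (𝓝 0) := by
  obtain ⟨C, r, hC, hr0, hr1, hP⟩ := exists_pairing_bound h
  set v : ℕ → SmoothFn := fun N =>
    smoothTrig (fun n => (cutoff ((n : ℝ) / 2 ^ N) : ℂ) * distCoeff u n) (2 ^ (N + 1)) with hv
  have hvl : ∀ N, (v N : Torus → ℂ) = lowFreq u N := fun N => by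
    rw [lowFreq_eq_trig u le_rfl, ← smoothTrig_coe]
  refine ⟨v, fun n x => by rw [hvl]; exact im_lowFreq hur n x, ?_⟩
  have hb : ∀ N, negSobolevNorm σ p (ofSmooth (v N) - u) ≤
      ENNReal.ofReal (C * (besovNorm α 1 u).toReal * r ^ N) := by
    intro N
    refine iSup₂_le fun φ hφ => ?_
    have h1 := (hP u hu.2 φ (smoothFn_continuous φ).aestronglyMeasurable
      (hφ.trans_lt ENNReal.one_lt_top)).2.2 N
    rw [pairing_smooth hu.1, ← hvl] at h1
    rw [← ofReal_norm]
    refine ENNReal.ofReal_le_ofReal (h1.trans ?_)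
    have h2 := ENNReal.toReal_mono ENNReal.one_ne_top hφ
    rw [ENNReal.toReal_one] at h2
    have h3 : 0 ≤ C * (besovNorm α 1 u).toReal * r ^ N := by positivity
    nlinarith
  refine tendsto_of_tendsto_of_tendsto_of_le_of_le tendsto_const_nhds ?_ (fun _ => zero_le) hb
  have h1 := (tendsto_pow_atTop_nhds_zero_of_lt_one hr0 hr1).const_mul
    (C * (besovNorm α 1 u).toReal)
  rw [mul_zero] at h1
  simpa using ENNReal.tendsto_ofReal h1

/-! ### From weak solutions to the sequence model -/

theorem pairing_congr {u : SmoothFn →ₗ[ℂ] ℂ} {g g' : Torus → ℂ} (h : g =ᵐ[haar] g') :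
    pairing u g = pairing u g' := by
  unfold pairing
  congr 1
  ext N
  exact integral_congr_ae (h.mono fun x hx => by simp only [hx])

/-- `W^{s,q}` is a module over `H¹` for `s < 1/2`. -/
theorem exists_sobolevNorm_conj_synth_mul_le {s q : ℝ} (h0 : 0 < s) (hs : s < 1 / 2) (hq : 1 ≤ q) :
    ∃ C : ℝ, 0 ≤ C ∧ ∀ (d : Seq) (g : Torus → ℂ), AEStronglyMeasurable g haar →
      sobolevNorm s q (fun x => (starRingEnd ℂ) (synth d x) * g x) ≤
        ENNReal.ofReal (C * ‖d‖) * sobolevNorm s q g := by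
  obtain ⟨A, hA, hk, hk'⟩ := exists_norm_evalKer_le (θ := (s + 1 / 2) / 2) (by linarith)
    (by linarith)
  obtain ⟨C, hC, h⟩ := exists_sobolevNorm_mul_le (s := s) (θ := (s + 1 / 2) / 2)
    (by linarith) hq
  refine ⟨C * A, by positivity, fun d g hg => ?_⟩
  have h1 := h g (fun x => (starRingEnd ℂ) (synth d x)) (A * ‖d‖) (by positivity) hg
    (fun x => by rw [RCLike.norm_conj]; exact norm_synth_le hk d x)
    (fun x y => by rw [← map_sub, RCLike.norm_conj]; exact norm_synth_sub_le hk' d x y)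
  rw [← mul_assoc] at h1
  simpa only [mul_comm (g _)] using h1

theorem aestronglyMeasurable_conj_synth_mul (d : Seq) {g : Torus → ℂ}
    (hg : AEStronglyMeasurable g haar) :
    AEStronglyMeasurable (fun x => (starRingEnd ℂ) (synth d x) * g x) haar :=
  (Complex.continuous_conj.comp (continuous_synth d)).aestronglyMeasurable.mul hg

/-- The product of a distribution `u` and a function `g` in the Sobolev space is a functional on
`H¹`, of norm controlled by the Sobolev norm of `g`. -/
theorem exists_dualSeq {α s q : ℝ} (h : Admissible α s q) {u : SmoothFn →ₗ[ℂ] ℂ}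
    (hu : besovNorm α 1 u < ⊤) :
    ∃ C : ℝ, 0 ≤ C ∧ ∀ g : Torus → ℂ, AEStronglyMeasurable g haar → sobolevNorm s q g < ⊤ →
      ∃ p : Seq, ‖p‖ ≤ C * (sobolevNorm s q g).toReal ∧
        ∀ d, inner ℂ d p = pairing u fun x => (starRingEnd ℂ) (synth d x) * g x := by
  have hq : 1 ≤ q := by linarith [h.two_le]
  obtain ⟨C₁, hC₁, hCb⟩ := exists_sobolevNorm_conj_synth_mul_le h.s_pos h.s_lt hq
  obtain ⟨C₂, r, hC₂, -, -, hP⟩ := exists_pairing_bound h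
  refine ⟨C₂ * (besovNorm α 1 u).toReal * C₁, by positivity, fun g hgm hg => ?_⟩
  set G : Seq → Torus → ℂ := fun d x => (starRingEnd ℂ) (synth d x) * g x with hG
  have hGm : ∀ d, AEStronglyMeasurable (G d) haar :=
    fun d => aestronglyMeasurable_conj_synth_mul d hgm
  have hfin : ∀ d, sobolevNorm s q (G d) < ⊤ := fun d =>
    (hCb d g hgm).trans_lt (ENNReal.mul_lt_top ENNReal.ofReal_lt_top hg)
  have hT : ∀ d, Tendsto (fun N => ∫ x, lowFreq u N x * G d x ∂haar) atTop
      (𝓝 (pairing u (G d))) := fun d => (hP u hu _ (hGm d) (hfin d)).1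
  have hint : ∀ N d, Integrable (fun x => lowFreq u N x * G d x) haar := fun N d => by
    obtain ⟨K, hK⟩ := isCompact_univ.exists_bound_of_continuousOn
      (continuous_lowFreq u N).continuousOn
    exact (integrable_of_sobolevNorm hq (hGm d) (hfin d)).bdd_mul (c := K)
      (continuous_lowFreq u N).aestronglyMeasurable
      (Eventually.of_forall fun x => hK x (mem_univ x))
  have hbound : ∀ d, ‖pairing u (G d)‖ ≤
      C₂ * (besovNorm α 1 u).toReal * C₁ * (sobolevNorm s q g).toReal * ‖d‖ := by
    intro d
    refine ((hP u hu _ (hGm d) (hfin d)).2.1).trans ?_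
    have h1 := ENNReal.toReal_mono (ENNReal.mul_lt_top ENNReal.ofReal_lt_top hg).ne (hCb d g hgm)
    rw [ENNReal.toReal_mul, ENNReal.toReal_ofReal (by positivity)] at h1
    refine (mul_le_mul_of_nonneg_left h1 (by positivity)).trans (le_of_eq ?_)
    ring
  let l : Seq →ₗ[ℂ] ℂ :=
    { toFun := fun d => (starRingEnd ℂ) (pairing u (G d))
      map_add' := fun d₁ d₂ => by
        rw [← map_add]
        congr 1
        refine tendsto_nhds_unique (hT (d₁ + d₂)) (((hT d₁).add (hT d₂)).congr fun N => ?_)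
        rw [← integral_add (hint N d₁) (hint N d₂)]
        congr 1; ext x; simp only [hG]; rw [synth_add, map_add]; ring
      map_smul' := fun a d => by
        rw [RingHom.id_apply, smul_eq_mul, ← Complex.conj_conj a, ← map_mul, Complex.conj_conj]
        congr 1
        refine tendsto_nhds_unique (hT (a • d)) (((hT d).const_mul ((starRingEnd ℂ) a)).congr
          fun N => ?_)
        rw [← integral_const_mul]
        congr 1; ext x; simp only [hG]; rw [synth_smul, map_mul]; ring }
  have hl : ∀ d, ‖l d‖ ≤ C₂ * (besovNorm α 1 u).toReal * C₁ * (sobolevNorm s q g).toReal * ‖d‖ :=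
    fun d => by
      change ‖(starRingEnd ℂ) (pairing u (G d))‖ ≤ _
      rw [RCLike.norm_conj]
      exact hbound d
  refine ⟨(InnerProductSpace.toDual ℂ Seq).symm (l.mkContinuous _ hl), ?_, fun d => ?_⟩
  · rw [LinearIsometryEquiv.norm_map]
    exact LinearMap.mkContinuous_norm_le _ (by positivity) _
  · rw [← inner_conj_symm, InnerProductSpace.toDual_symm_apply]
    change (starRingEnd ℂ) ((starRingEnd ℂ) (pairing u (G d))) = _
    rw [Complex.conj_conj]

theorem synth_single (n : ℤ) (x : Torus) :
    synth (lp.single 2 n (1 : ℂ)) x = (jap n : ℂ)⁻¹ * fourier n x := by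
  rw [synth, ← inner_conj_symm, inner_single_one, evalKer_apply, map_mul, Complex.conj_conj,
    map_inv₀, Complex.conj_ofReal]

/-- A path in `Seq` is measurable if its coordinates are, as the limit of its truncations. -/
theorem aestronglyMeasurable_seq {X : Type*} [MeasurableSpace X] {μ : Measure X} {c : X → Seq}
    (h : ∀ n, AEStronglyMeasurable (fun t => c t n) μ) : AEStronglyMeasurable c μ := by
  refine aestronglyMeasurable_of_tendsto_ae atTop (f := fun M t => trunc M (c t)) (fun M => ?_)
    (Eventually.of_forall fun t => tendsto_trunc (c t))
  unfold trunc
  refine Finset.aestronglyMeasurable_fun_sum _ fun n _ => ?_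
  have e : (fun t => (lp.single 2 n (c t n) : Seq)) =
      fun t => c t n • (lp.single 2 n (1 : ℂ) : Seq) := by
    ext1 t
    rw [← lp.single_smul, smul_eq_mul, mul_one]
  rw [e]
  exact (h n).smul_const _

/-- The energy estimate for one Fourier mode. Here `p` is the coordinate of the product of the velocity
and the solution as a functional on `H¹`; summed over `n`, the estimate bounds the norm in
`L²(0,T;H¹)`, so that weak solutions gain the regularity that the energy identity requires. -/
theorem mode_estimate {ν T : ℝ} (hT : 0 ≤ T) (hν : 0 < ν) {a p : ℝ → ℂ} {a₀ : ℂ} (n : ℤ)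
    (ha : MemLp a 2 (volume.restrict (Ioo 0 T))) (hp : MemLp p 2 (volume.restrict (Ioo 0 T)))
    (h : ∀ᵐ t ∂(volume.restrict (Ioo 0 T)), a t =
      a₀ - ∫ s in (0 : ℝ)..t, ((ν * n ^ 2 : ℝ) * a s + Complex.I * ((jap n : ℂ) * p s))) :
    ν * jap n ^ 2 * ∫ t in Ioo 0 T, ‖a t‖ ^ 2 ≤
      ‖a₀‖ ^ 2 + 2 * ν * (∫ t in Ioo 0 T, ‖a t‖ ^ 2) + ν⁻¹ * ∫ t in Ioo 0 T, ‖p t‖ ^ 2 := by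
  set g : ℝ → ℂ := fun s => (ν * n ^ 2 : ℝ) * a s + Complex.I * ((jap n : ℂ) * p s) with hg
  have h12 : (1 : ℝ≥0∞) ≤ 2 := by norm_num
  have hgi : IntegrableOn g (Ioo 0 T) := ((ha.integrable h12).const_mul _).add
    (((hp.integrable h12).const_mul _).const_mul _)
  have hgi' : IntegrableOn g (Ioc 0 T) := by
    rwa [integrableOn_Ioc_iff_integrableOn_Ioo]
  have h1 := normSq_primitive hT a₀ hgi'
  rw [integral_Ioc_eq_integral_Ioo] at h1
  have h2 : ∫ s in Ioo 0 T, ((starRingEnd ℂ) (a₀ - ∫ r in (0 : ℝ)..s, g r) * g s).re =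
      ∫ s in Ioo 0 T, ((starRingEnd ℂ) (a s) * g s).re :=
    integral_congr_ae (h.mono fun s hs => by simp only [hs])
  have ha2 : IntegrableOn (fun s => ‖a s‖ ^ 2) (Ioo 0 T) := ha.integrable_norm_pow'
  have hp2 : IntegrableOn (fun s => ‖p s‖ ^ 2) (Ioo 0 T) := hp.integrable_norm_pow'
  have hmul : IntegrableOn (fun s => ((starRingEnd ℂ) (a s) * g s).re) (Ioo 0 T) := by
    have hgL : MemLp g 2 (volume.restrict (Ioo 0 T)) :=
      (ha.const_mul _).add ((hp.const_mul _).const_mul _)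
    have hst : MemLp (fun s => (starRingEnd ℂ) (a s)) 2 (volume.restrict (Ioo 0 T)) := by
      refine ha.of_le (Complex.continuous_conj.comp_aestronglyMeasurable ha.1)
        (Eventually.of_forall fun s => ?_)
      rw [RCLike.norm_conj]
    exact (hst.integrable_mul hgL).re
  have h3 : ∫ s in Ioo 0 T, ((ν * n ^ 2 - ν * jap n ^ 2 / 2) * ‖a s‖ ^ 2 - ν⁻¹ / 2 * ‖p s‖ ^ 2) ≤
      ∫ s in Ioo 0 T, ((starRingEnd ℂ) (a s) * g s).re := by
    refine integral_mono ((ha2.const_mul _).sub (hp2.const_mul _)) hmul fun s => ?_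
    have e : ((starRingEnd ℂ) (a s) * g s).re = ν * n ^ 2 * ‖a s‖ ^ 2 +
        ((starRingEnd ℂ) (a s) * (Complex.I * ((jap n : ℂ) * p s))).re := by
      rw [hg, mul_add, Complex.add_re, mul_left_comm, ← Complex.normSq_eq_conj_mul_self,
        Complex.normSq_eq_norm_sq, Complex.re_ofReal_mul, Complex.ofReal_re]
    have h4 : -(‖a s‖ * (jap n * ‖p s‖)) ≤
        ((starRingEnd ℂ) (a s) * (Complex.I * ((jap n : ℂ) * p s))).re := by
      have := (abs_le.1 (Complex.abs_re_le_norm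
        ((starRingEnd ℂ) (a s) * (Complex.I * ((jap n : ℂ) * p s))))).1
      rwa [norm_mul, norm_mul, norm_mul, RCLike.norm_conj, Complex.norm_I, one_mul,
        Complex.norm_real, Real.norm_of_nonneg (jap_pos n).le] at this
    have h5 : 2 * (‖a s‖ * (jap n * ‖p s‖)) ≤ ν * jap n ^ 2 * ‖a s‖ ^ 2 + ν⁻¹ * ‖p s‖ ^ 2 := by
      have h6 : 0 ≤ ν⁻¹ * (ν * (jap n * ‖a s‖) - ‖p s‖) ^ 2 := by positivity
      have h7 : ν⁻¹ * (ν * (jap n * ‖a s‖) - ‖p s‖) ^ 2 = ν * jap n ^ 2 * ‖a s‖ ^ 2 +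
          ν⁻¹ * ‖p s‖ ^ 2 - 2 * (‖a s‖ * (jap n * ‖p s‖)) := by field_simp; ring
      linarith
    simp only
    rw [e]
    linarith
  rw [integral_sub (ha2.const_mul _) (hp2.const_mul _), integral_const_mul,
    integral_const_mul] at h3
  rw [h2] at h1
  have h8 := sq_nonneg ‖a₀ - ∫ s in (0 : ℝ)..T, g s‖
  rw [h1] at h8
  rw [jap_sq] at h3 ⊢
  linarith

/-! ### Measurability in time -/

theorem sobolevNorm_congr {s q : ℝ} {g g' : Torus → ℂ} (h : g =ᵐ[haar] g') :
    sobolevNorm s q g = sobolevNorm s q g' := by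
  unfold sobolevNorm
  congr 2
  · exact lintegral_congr_ae (h.mono fun x hx => by simp only [hx])
  · refine lintegral_congr_ae (h.mono fun x hx => ?_)
    exact lintegral_congr_ae (h.mono fun y hy => by simp only [hx, hy])

theorem ae_ae_eq_mk {μ : Measure ℝ} [SFinite μ] {f : ℝ → Torus → ℂ}
    (hf : AEStronglyMeasurable (Function.uncurry f) (μ.prod haar)) :
    ∀ᵐ t ∂μ, f t =ᵐ[haar] fun x => hf.mk _ (t, x) :=
  Measure.ae_ae_of_ae_prod hf.ae_eq_mk

theorem ae_aestronglyMeasurable {μ : Measure ℝ} [SFinite μ] {f : ℝ → Torus → ℂ}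
    (hf : AEStronglyMeasurable (Function.uncurry f) (μ.prod haar)) :
    ∀ᵐ t ∂μ, AEStronglyMeasurable (f t) haar :=
  (ae_ae_eq_mk hf).mono fun t ht => ⟨fun x => hf.mk _ (t, x),
    hf.stronglyMeasurable_mk.comp_measurable measurable_prodMk_left, ht⟩

theorem aemeasurable_sobolevNorm {μ : Measure ℝ} [SFinite μ] {f : ℝ → Torus → ℂ}
    (hf : AEStronglyMeasurable (Function.uncurry f) (μ.prod haar)) (s q : ℝ) :
    AEMeasurable (fun t => sobolevNorm s q (f t)) μ := by
  set F := hf.mk _ with hF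
  have hFm : Measurable F := hf.stronglyMeasurable_mk.measurable
  refine ⟨fun t => sobolevNorm s q fun x => F (t, x), ?_,
    (ae_ae_eq_mk hf).mono fun t ht => sobolevNorm_congr ht⟩
  unfold sobolevNorm
  refine (Measurable.add ?_ ?_).pow_const _
  · exact Measurable.lintegral_prod_right' (f := fun z : ℝ × Torus => ‖F z‖ₑ ^ q) (by fun_prop)
  · refine Measurable.lintegral_prod_right' (f := fun z : ℝ × Torus =>
      ∫⁻ y, ‖F (z.1, z.2) - F (z.1, y)‖ₑ ^ q / edist z.2 y ^ (1 + s * q) ∂haar) ?_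
    exact Measurable.lintegral_prod_right' (f := fun z : (ℝ × Torus) × Torus =>
      ‖F (z.1.1, z.1.2) - F (z.1.1, z.2)‖ₑ ^ q / edist z.1.2 z.2 ^ (1 + s * q)) (by fun_prop)

theorem aestronglyMeasurable_integral_mul {μ : Measure ℝ} [SFinite μ] {f : ℝ → Torus → ℂ}
    (hf : AEStronglyMeasurable (Function.uncurry f) (μ.prod haar)) {z : Torus → ℂ}
    (hz : Continuous z) : AEStronglyMeasurable (fun t => ∫ x, z x * f t x ∂haar) μ := by
  have h : AEStronglyMeasurable (fun p : ℝ × Torus => z p.2 * f p.1 p.2) (μ.prod haar) :=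
    (hz.comp continuous_snd).aestronglyMeasurable.mul hf
  exact h.integral_prod_right'

theorem integral_normSq_le_sobolevNorm {s q : ℝ} (hq : 2 ≤ q) {g : Torus → ℂ}
    (hgm : AEStronglyMeasurable g haar) (hg : sobolevNorm s q g < ⊤) :
    MemLp g 2 haar ∧ ∫ x, ‖g x‖ ^ 2 ∂haar ≤ (sobolevNorm s q g).toReal ^ 2 := by
  have h2q : (2 : ℝ≥0∞) ≤ ENNReal.ofReal q := by
    rw [← ENNReal.ofReal_ofNat]; exact ENNReal.ofReal_le_ofReal hq
  have hg2 : MemLp g 2 haar := (memLp_of_sobolevNorm (by linarith) hgm hg).mono_exponent h2q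
  refine ⟨hg2, ?_⟩
  have h1 : eLpNorm g 2 haar ≤ sobolevNorm s q g :=
    (eLpNorm_le_eLpNorm_of_exponent_le h2q hgm).trans (eLpNorm_le_sobolevNorm (by linarith) g)
  have h3 := ENNReal.toReal_mono (ENNReal.pow_lt_top hg).ne (pow_le_pow_left' h1 2)
  rwa [eLpNorm_two_sq hg2, ENNReal.toReal_ofReal (integral_nonneg fun x => by positivity),
    ENNReal.toReal_pow] at h3

/-- Coordinates dominated in `ℓ²` by a square integrable function are square summable in
`L²`. -/
theorem summable_integral_normSq {μ : Measure ℝ} [IsFiniteMeasure μ] {a : ℤ → ℝ → ℂ} {m : ℝ → ℝ}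
    (hm : MemLp m 2 μ) (ham : ∀ n, AEStronglyMeasurable (a n) μ)
    (h : ∀ᵐ t ∂μ, ∀ F : Finset ℤ, ∑ n ∈ F, ‖a n t‖ ^ 2 ≤ m t ^ 2) :
    (∀ n, MemLp (a n) 2 μ) ∧ Summable fun n => ∫ t, ‖a n t‖ ^ 2 ∂μ := by
  have hL : ∀ n, MemLp (a n) 2 μ := fun n => by
    refine hm.of_le (ham n) (h.mono fun t ht => ?_)
    have := ht {n}
    rw [Finset.sum_singleton] at this
    rw [Real.norm_eq_abs]
    exact Real.le_sqrt_of_sq_le this |>.trans (le_of_eq (Real.sqrt_sq_eq_abs _))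
  refine ⟨hL, summable_of_sum_le (c := ∫ t, m t ^ 2 ∂μ) (fun n => integral_nonneg fun t => by
    positivity) fun F => ?_⟩
  rw [← integral_finsetSum _ fun n _ => (hL n).integrable_norm_pow']
  exact integral_mono_ae (integrable_finsetSum _ fun n _ => (hL n).integrable_norm_pow')
    hm.integrable_sq (h.mono fun t ht => ht F)

/-- Square summable coordinates are the coordinates of a square integrable path. -/
theorem exists_seq_of_summable {μ : Measure ℝ} [IsFiniteMeasure μ] {a : ℤ → ℝ → ℂ}
    (ha : ∀ n, MemLp (a n) 2 μ) (hs : Summable fun n => ∫ t, ‖a n t‖ ^ 2 ∂μ) :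
    ∃ c : ℝ → Seq, MemLp c 2 μ ∧ ∀ᵐ t ∂μ, ∀ n, c t n = a n t := by
  classical
  set c : ℝ → Seq := fun t => if h : Memℓp (fun n => a n t) 2 then ⟨_, h⟩ else 0 with hc
  have hint : ∀ n, ∫⁻ t, ‖a n t‖ₑ ^ 2 ∂μ = ENNReal.ofReal (∫ t, ‖a n t‖ ^ 2 ∂μ) := fun n => by
    rw [ofReal_integral_eq_lintegral_ofReal (ha n).integrable_norm_pow'
      (Eventually.of_forall fun t => by positivity)]
    refine lintegral_congr fun t => ?_
    rw [ENNReal.ofReal_pow (norm_nonneg _), ofReal_norm]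
  have hm : ∀ n, AEMeasurable (fun t => ‖a n t‖ₑ ^ 2) μ := fun n => (ha n).1.enorm.pow_const 2
  have hlt : ∫⁻ t, ∑' n, ‖a n t‖ₑ ^ 2 ∂μ < ⊤ := by
    rw [lintegral_tsum hm]
    simp only [hint]
    rw [← ENNReal.ofReal_tsum_of_nonneg (fun n => integral_nonneg fun t => by positivity) hs]
    exact ENNReal.ofReal_lt_top
  have hmem : ∀ᵐ t ∂μ, Memℓp (fun n => a n t) 2 := by
    filter_upwards [ae_lt_top' (AEMeasurable.tsum hm) hlt.ne] with t ht
    rw [memlp_two_iff]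
    have h1 := ENNReal.summable_toReal ht.ne
    simpa only [ENNReal.toReal_pow, toReal_enorm] using h1
  have hcoord : ∀ᵐ t ∂μ, ∀ n, c t n = a n t := hmem.mono fun t ht n => by
    simp only [hc]
    rw [dif_pos ht]
  have hcm : AEStronglyMeasurable c μ := aestronglyMeasurable_seq fun n =>
    (ha n).1.congr (hcoord.mono fun t ht => (ht n).symm)
  refine ⟨c, ?_, hcoord⟩
  rw [memLp_two_iff_integrable_sq_norm hcm]
  refine ⟨hcm.norm.pow 2, ?_⟩
  refine lt_of_le_of_lt (le_of_eq (lintegral_congr_ae (hcoord.mono fun t ht => ?_))) hlt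
  have h1 := hasSum_normSq_seq (c t)
  simp only [ht] at h1
  simp only
  rw [← ofReal_norm, Real.norm_of_nonneg (by positivity), ← h1.tsum_eq,
    ENNReal.ofReal_tsum_of_nonneg (fun n => by positivity) h1.summable]
  refine tsum_congr fun n => ?_
  rw [ENNReal.ofReal_pow (norm_nonneg _), ofReal_norm]

theorem integrable_continuous_mul {T : ℝ} {θ a : ℝ → ℂ} (hθ : Continuous θ)
    (ha : IntegrableOn a (Ioo 0 T)) : IntegrableOn (fun t => θ t * a t) (Ioo 0 T) := by
  obtain ⟨K, hK⟩ := isCompact_Icc.exists_bound_of_continuousOn (s := Icc 0 T) hθ.continuousOn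
  refine Integrable.bdd_mul (c := K) ha hθ.aestronglyMeasurable ?_
  filter_upwards [ae_restrict_mem measurableSet_Ioo] with t ht
  exact hK t (Ioo_subset_Icc_self ht)

theorem torusDeriv_const_mul_fourier (a : ℂ) (n : ℤ) :
    torusDeriv (fun x => a * (fourier n x : ℂ)) = fun x => a * (Complex.I * n) * fourier n x := by
  ext x
  have h : torusDeriv (fun x => a * (fourier n x : ℂ)) x =
      a * torusDeriv (fun x => (fourier n x : ℂ)) x := deriv_const_mul_field _
  rw [h, torusDeriv_fourier]
  ring

/-! ### The Fourier coefficients of weak solutions -/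

theorem isTestFunction_mul_fourier {T : ℝ} {θ : ℝ → ℝ} (hθ : IsTimeTest T θ) (n : ℤ) :
    IsTestFunction T fun t x => (θ t : ℂ) * fourier n x := by
  obtain ⟨h1, T', hT', h2⟩ := hθ
  refine ⟨?_, T', hT', fun t ht x => by simp only [h2 t ht, Complex.ofReal_zero, zero_mul]⟩
  have e1 : ContDiff ℝ ∞ fun q : ℝ × ℝ => ((θ q.1 : ℝ) : ℂ) :=
    Complex.ofRealCLM.contDiff.comp (h1.comp contDiff_fst)
  exact e1.mul ((smoothFn_contDiff (expFn n)).comp contDiff_snd)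

theorem jap_mul_ellip_apply (ν : ℝ) (B : Seq →L[ℂ] Seq) (x : Seq) (n : ℤ) :
    (jap n : ℂ) * ellip ν B x n =
      (ν * n ^ 2 : ℝ) * invJap x n + Complex.I * ((jap n : ℂ) * B x n) := by
  rw [ellip_apply]
  simp only [lp.coeFn_add, lp.coeFn_sub, lp.coeFn_smul, Pi.add_apply, Pi.sub_apply, Pi.smul_apply,
    smul_eq_mul, invJap_apply]
  have hj := jap_ne_zero n
  have hj2 : (jap n : ℂ) ^ 2 = 1 + (n : ℂ) ^ 2 := by exact_mod_cast jap_sq n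
  push_cast
  field_simp
  linear_combination (ν * x n : ℂ) * hj2

/-- Testing the weak formulation with `θ(t) exp(-i n ·)` gives the equation of the `n`-th Fourier
coefficient in the sense of distributions in time; `P t` stands for the `n`-th coefficient of `u f(t)`. -/
theorem weak_mode {T ν : ℝ} {u : SmoothFn →ₗ[ℂ] ℂ} {f₀ : Torus → ℂ} {f : ℝ → Torus → ℂ}
    (hf : ∀ φ : ℝ → Torus → ℂ, IsTestFunction T φ →
      (∫ t in Ioo 0 T, ∫ x, f t x *
          (deriv (fun s => φ s x) t + (ν : ℂ) * torusDeriv (torusDeriv (φ t)) x) ∂haar) +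
        (∫ x, f₀ x * φ 0 x ∂haar) =
      Complex.I * ∫ t in Ioo 0 T, pairing u (fun x => f t x * φ t x))
    (n : ℤ) {P : ℝ → ℂ} (hP : ∀ᵐ t ∂(volume.restrict (Ioo 0 T)), ∀ κ : ℂ,
      pairing u (fun x => κ * ((fourier (-n) x : ℂ) * f t x)) = κ * P t)
    (ha : IntegrableOn (fun t => fourierCoeff (f t) n) (Ioo 0 T)) (hPi : IntegrableOn P (Ioo 0 T))
    {θ : ℝ → ℝ} (hθ : IsTimeTest T θ) :
    (∫ t in Ioo 0 T, ((deriv θ t : ℝ) : ℂ) * fourierCoeff (f t) n) +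
        (θ 0 : ℂ) * fourierCoeff f₀ n =
      ∫ t in Ioo 0 T, (θ t : ℂ) *
        ((ν * n ^ 2 : ℝ) * fourierCoeff (f t) n + Complex.I * P t) := by
  have h := hf _ (isTestFunction_mul_fourier hθ (-n))
  have hd : ∀ (t : ℝ) (x : Torus), deriv (fun s => (θ s : ℂ) * (fourier (-n) x : ℂ)) t =
      ((deriv θ t : ℝ) : ℂ) * fourier (-n) x := by
    intro t x
    have hdiff : DifferentiableAt ℝ θ t := hθ.1.differentiable (by simp) t
    exact (hdiff.hasDerivAt.ofReal_comp.mul_const _).deriv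
  simp only [hd, torusDeriv_const_mul_fourier] at h
  have e1 : ∀ t, ∫ x, f t x * (((deriv θ t : ℝ) : ℂ) * fourier (-n) x +
      (ν : ℂ) * ((θ t : ℂ) * (Complex.I * ((-n : ℤ) : ℂ)) * (Complex.I * ((-n : ℤ) : ℂ)) *
        fourier (-n) x)) ∂haar =
      (((deriv θ t : ℝ) : ℂ) - (θ t : ℂ) * (ν * n ^ 2 : ℝ)) * fourierCoeff (f t) n := by
    intro t
    rw [fourierCoeff, ← integral_const_mul]
    congr 1
    ext x
    rw [smul_eq_mul]
    push_cast
    linear_combination ((θ t : ℂ) * ν * n ^ 2 * fourier (-n) x * f t x) * Complex.I_sq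
  have e2 : ∫ x, f₀ x * ((θ 0 : ℂ) * fourier (-n) x) ∂haar = (θ 0 : ℂ) * fourierCoeff f₀ n := by
    rw [fourierCoeff, ← integral_const_mul]
    congr 1
    ext x
    rw [smul_eq_mul]
    ring
  have e3 : ∫ t in Ioo 0 T, pairing u (fun x => f t x * ((θ t : ℂ) * fourier (-n) x)) =
      ∫ t in Ioo 0 T, (θ t : ℂ) * P t := by
    refine integral_congr_ae (hP.mono fun t ht => ?_)
    simp only
    rw [← ht (θ t)]
    congr 1
    ext x
    ring
  simp only [e1, e2, e3] at h
  have c1 : Continuous fun t => ((deriv θ t : ℝ) : ℂ) :=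
    Complex.continuous_ofReal.comp (hθ.1.continuous_deriv (by simp))
  have c2 : Continuous fun t => (θ t : ℂ) := Complex.continuous_ofReal.comp hθ.1.continuous
  have i1 := integrable_continuous_mul c1 ha
  have i2 := integrable_continuous_mul c2 ha
  have i3 := integrable_continuous_mul c2 hPi
  have e4 : ∀ t, (((deriv θ t : ℝ) : ℂ) - (θ t : ℂ) * (ν * n ^ 2 : ℝ)) * fourierCoeff (f t) n =
      ((deriv θ t : ℝ) : ℂ) * fourierCoeff (f t) n -
        ((ν * n ^ 2 : ℝ) : ℂ) * ((θ t : ℂ) * fourierCoeff (f t) n) := fun t => by ring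
  have e5 : ∀ t, (θ t : ℂ) * ((ν * n ^ 2 : ℝ) * fourierCoeff (f t) n + Complex.I * P t) =
      ((ν * n ^ 2 : ℝ) : ℂ) * ((θ t : ℂ) * fourierCoeff (f t) n) +
        Complex.I * ((θ t : ℂ) * P t) := fun t => by ring
  simp only [e4] at h
  simp only [e5]
  rw [integral_sub i1 (i2.const_mul _), integral_const_mul] at h
  rw [integral_add (i2.const_mul _) (i3.const_mul _), integral_const_mul, integral_const_mul]
  linear_combination h

/-- A weak solution has values in `H¹`, and its Fourier coefficients solve the evolution equation in
the sequence model. -/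
theorem exists_modeEq_of_isWeakSolution {α ν T : ℝ} (hα : α < 0) (hν : 0 < ν) (hT : 0 < T)
    {u : SmoothFn →ₗ[ℂ] ℂ} (hu : besovNorm α 1 u < ⊤) {B : Seq →L[ℂ] Seq} (hB : IsFormOf u B)
    {f₀ : Torus → ℂ} (hf₀ : MemLp f₀ 2 haar) {f : ℝ → Torus → ℂ}
    (hf : IsWeakSolution α ν T u f₀ f) :
    ∃ c : ℝ → Seq, MemLp c 2 (volume.restrict (Ioo 0 T)) ∧
      ModeEq T (fourierSeq hf₀) c (fun t => ellip ν B (c t)) ∧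
      ∀ᵐ t ∂(volume.restrict (Ioo 0 T)), f t =ᵐ[haar] synth (c t) := by
  obtain ⟨hfm, ⟨ε, hε0, hε1, hfin⟩, htest⟩ := hf
  have hadm := admissible_of_pos hα hε0 hε1
  set s := -α + ε with hs
  set q := (1 + ε) / ε with hq
  have hq2 : 2 ≤ q := hadm.two_le
  set μ : Measure ℝ := volume.restrict (Ioo 0 T) with hμ
  have h12 : (1 : ℝ≥0∞) ≤ 2 := by norm_num
  -- the Sobolev norm as a square integrable function of time
  have hDm := aemeasurable_sobolevNorm hfm s q
  have hD2 : ∫⁻ t, sobolevNorm s q (f t) ^ 2 ∂μ < ⊤ := by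
    by_contra hcon
    rw [not_lt_top_iff] at hcon
    rw [normL2W, hcon, ENNReal.top_rpow_of_pos (by norm_num)] at hfin
    exact lt_irrefl _ hfin
  have hDfin : ∀ᵐ t ∂μ, sobolevNorm s q (f t) < ⊤ :=
    (ae_lt_top' (hDm.pow_const 2) hD2.ne).mono fun t ht => by
      by_contra hcon
      rw [not_lt_top_iff] at hcon
      rw [hcon] at ht
      simp at ht
  have hmeas := ae_aestronglyMeasurable hfm
  set m : ℝ → ℝ := fun t => (sobolevNorm s q (f t)).toReal with hm
  have hmm : AEStronglyMeasurable m μ := hDm.ennreal_toReal.aestronglyMeasurable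
  have hmL : MemLp m 2 μ := by
    rw [memLp_two_iff_integrable_sq hmm]
    refine ⟨hmm.pow 2, lt_of_le_of_lt (lintegral_mono fun t => ?_) hD2⟩
    rw [enorm_pow, hm]
    simp only
    refine pow_le_pow_left' ?_ 2
    rw [Real.enorm_of_nonneg ENNReal.toReal_nonneg]
    exact ENNReal.ofReal_toReal_le
  -- the product of `u` and `f t` as a functional on `H¹`
  obtain ⟨C, hC, hdual⟩ := exists_dualSeq hadm hu
  have hex : ∀ t, ∃ p : Seq, AEStronglyMeasurable (f t) haar → sobolevNorm s q (f t) < ⊤ →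
      ‖p‖ ≤ C * m t ∧ ∀ d, inner ℂ d p = pairing u fun x => (starRingEnd ℂ) (synth d x) * f t x := by
    intro t
    by_cases h1 : AEStronglyMeasurable (f t) haar
    · by_cases h2 : sobolevNorm s q (f t) < ⊤
      · obtain ⟨p, hp⟩ := hdual (f t) h1 h2
        exact ⟨p, fun _ _ => hp⟩
      · exact ⟨0, fun _ h => absurd h h2⟩
    · exact ⟨0, fun h => absurd h h1⟩
  choose p hp using hex
  have hpn : ∀ᵐ t ∂μ, ‖p t‖ ≤ C * m t := by
    filter_upwards [hmeas, hDfin] with t h1 h2 using (hp t h1 h2).1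
  have hpd : ∀ᵐ t ∂μ, ∀ d, inner ℂ d (p t) =
      pairing u fun x => (starRingEnd ℂ) (synth d x) * f t x := by
    filter_upwards [hmeas, hDfin] with t h1 h2 using (hp t h1 h2).2
  have hpm : ∀ n, AEStronglyMeasurable (fun t => p t n) μ := by
    intro n
    set z : Torus → ℂ := fun x => (starRingEnd ℂ) (synth (lp.single 2 n (1 : ℂ)) x) with hz
    have hzc : Continuous z := Complex.continuous_conj.comp (continuous_synth _)
    refine aestronglyMeasurable_of_tendsto_ae atTop
      (f := fun N t => ∫ x, lowFreq u N x * z x * f t x ∂haar)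
      (fun N => aestronglyMeasurable_integral_mul hfm ((continuous_lowFreq u N).mul hzc)) ?_
    obtain ⟨C₁, hC₁, hCb⟩ := exists_sobolevNorm_conj_synth_mul_le hadm.s_pos hadm.s_lt
      (by linarith : 1 ≤ q)
    filter_upwards [hmeas, hDfin, hpd] with t h1 h2 h3
    rw [← inner_single_one n (p t), h3]
    have h4 := tendsto_pairing hadm hu (aestronglyMeasurable_conj_synth_mul (lp.single 2 n 1) h1)
      ((hCb _ _ h1).trans_lt (ENNReal.mul_lt_top ENNReal.ofReal_lt_top h2))
    simpa only [mul_assoc] using h4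
  have hpL := summable_integral_normSq (a := fun n t => p t n) (hmL.const_mul C) hpm
    (hpn.mono fun t ht F => ((hasSum_normSq_seq (p t)).summable.sum_le_tsum F
      (fun _ _ => by positivity)).trans (by
        rw [(hasSum_normSq_seq (p t)).tsum_eq]
        exact pow_le_pow_left₀ (norm_nonneg _) ht 2))
  -- the Fourier coefficients of the solution
  have ham : ∀ n, AEStronglyMeasurable (fun t => fourierCoeff (f t) n) μ := fun n =>
    aestronglyMeasurable_integral_mul hfm (map_continuous (fourier (-n)))
  have hf2 : ∀ᵐ t ∂μ, MemLp (f t) 2 haar ∧ ∫ x, ‖f t x‖ ^ 2 ∂haar ≤ m t ^ 2 := by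
    filter_upwards [hmeas, hDfin] with t h1 h2 using integral_normSq_le_sobolevNorm hq2 h1 h2
  have haL := summable_integral_normSq (a := fun n t => fourierCoeff (f t) n) hmL ham
    (hf2.mono fun t ht F => ((hasSum_normSq_fourierCoeff ht.1).summable.sum_le_tsum F
      (fun _ _ => by positivity)).trans (by
        rw [(hasSum_normSq_fourierCoeff ht.1).tsum_eq]; exact ht.2))
  have hpair : ∀ n : ℤ, ∀ᵐ t ∂μ, ∀ κ : ℂ,
      pairing u (fun x => κ * ((fourier (-n) x : ℂ) * f t x)) = κ * ((jap n : ℂ) * p t n) := by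
    intro n
    filter_upwards [hpd] with t ht κ
    have h1 := ht (((starRingEnd ℂ) κ * jap n) • lp.single 2 n (1 : ℂ))
    rw [inner_smul_left, inner_single_one, map_mul, Complex.conj_conj, Complex.conj_ofReal] at h1
    rw [← mul_assoc, h1]
    congr 1
    ext x
    rw [synth_smul, synth_single, map_mul, map_mul, map_mul, Complex.conj_conj, map_inv₀,
      Complex.conj_ofReal, fourier_neg]
    have := jap_ne_zero n
    field_simp
  have hmode : ∀ n : ℤ, ∀ᵐ t ∂μ, fourierCoeff (f t) n = fourierCoeff f₀ n - ∫ r in (0 : ℝ)..t,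
      ((ν * n ^ 2 : ℝ) * fourierCoeff (f r) n + Complex.I * ((jap n : ℂ) * p r n)) := by
    intro n
    have i1 : IntegrableOn (fun t => fourierCoeff (f t) n) (Ioo 0 T) := (haL.1 n).integrable h12
    have i2 : IntegrableOn (fun t => (jap n : ℂ) * p t n) (Ioo 0 T) :=
      ((hpL.1 n).integrable h12).const_mul _
    exact ae_eq_primitive_of_forall_timeTest hT _ i1 ((i1.const_mul _).add (i2.const_mul _))
      fun θ hθ => weak_mode htest n (hpair n) i1 i2 hθ
  -- regularity of the solution, from the energy estimate of each mode
  have hsum : Summable fun n : ℤ => ∫ t, ‖(jap n : ℂ) * fourierCoeff (f t) n‖ ^ 2 ∂μ := by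
    have h1 := (hasSum_normSq_fourierCoeff hf₀).summable
    refine Summable.of_nonneg_of_le (fun n => integral_nonneg fun t => by positivity) (fun n => ?_)
      (((h1.add (haL.2.mul_left (2 * ν))).add (hpL.2.mul_left ν⁻¹)).mul_left ν⁻¹)
    have h2 := mode_estimate hT.le hν n (haL.1 n) (hpL.1 n) (hmode n)
    simp only [norm_mul, mul_pow, Complex.norm_real, Real.norm_of_nonneg (jap_pos n).le]
    rw [integral_const_mul, le_inv_mul_iff₀ hν, ← mul_assoc]
    exact h2
  obtain ⟨c, hc, hca⟩ := exists_seq_of_summable (fun n => (haL.1 n).const_mul (jap n : ℂ)) hsum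
  have hinv : ∀ᵐ t ∂μ, ∀ n, invJap (c t) n = fourierCoeff (f t) n := hca.mono fun t ht n => by
    rw [invJap_apply, ht, inv_mul_cancel_left₀ (jap_ne_zero n)]
  have hsynth : ∀ᵐ t ∂μ, f t =ᵐ[haar] synth (c t) := by
    filter_upwards [hf2, hinv] with t h1 h2
    exact ae_eq_of_fourierCoeff h1.1 (memLp_synth _) fun n => by rw [fourierCoeff_synth, h2]
  refine ⟨c, hc, fun n => ?_, hsynth⟩
  have hpB : ∀ᵐ t ∂μ, p t = B (c t) := by
    filter_upwards [hpd, hsynth] with t h1 h2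
    refine ext_inner_left ℂ fun d => ?_
    rw [h1, hB]
    exact pairing_congr (h2.mono fun x hx => by simp only [conjMul, hx])
  have hΓ : ∀ᵐ t ∂μ, (ν * n ^ 2 : ℝ) * fourierCoeff (f t) n + Complex.I * ((jap n : ℂ) * p t n) =
      (jap n : ℂ) * ellip ν B (c t) n := by
    filter_upwards [hpB, hca] with t h1 h2
    rw [jap_mul_ellip_apply, invJap_apply, h2, inv_mul_cancel_left₀ (jap_ne_zero n), h1]
  filter_upwards [hinv, hmode n, ae_restrict_mem measurableSet_Ioo] with t h1 h2 ht
  rw [h1, h2]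
  congr 1
  refine intervalIntegral.integral_congr_ae ?_
  rw [uIoc_of_le ht.1.le]
  have h3 := (ae_restrict_iff' measurableSet_Ioo).1 hΓ
  filter_upwards [h3] with r hr hrt
  exact hr ⟨hrt.1, hrt.2.trans_lt ht.2⟩

/-! ### Smooth functions of time and space -/

/-- Functions of time and space whose lift to `ℝ × ℝ` is smooth. -/
def JointSmooth (F : ℝ → Torus → ℂ) : Prop :=
  ContDiff ℝ ∞ fun q : ℝ × ℝ => F q.1 (q.2 : Torus)

namespace JointSmooth

variable {F : ℝ → Torus → ℂ}

theorem contDiff_slice (hF : JointSmooth F) (t : ℝ) :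
    ContDiff ℝ ∞ fun y : ℝ => F t (y : Torus) :=
  ContDiff.comp (g := fun q : ℝ × ℝ => F q.1 (q.2 : Torus)) hF
    (contDiff_const.prodMk contDiff_id)

/-- The function at a fixed time. -/
def slice (hF : JointSmooth F) (t : ℝ) : SmoothFn := ⟨F t, hF.contDiff_slice t⟩

theorem hasDerivAt_time (hF : JointSmooth F) (t y : ℝ) :
    HasDerivAt (fun s => F s (y : Torus))
      (fderiv ℝ (fun q : ℝ × ℝ => F q.1 (q.2 : Torus)) (t, y) (1, 0)) t := by
  have h1 : HasFDerivAt (fun q : ℝ × ℝ => F q.1 (q.2 : Torus)) _ (t, y) :=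
    (ContDiff.differentiable hF (by simp) (t, y)).hasFDerivAt
  exact h1.comp_hasDerivAt t ((hasDerivAt_id t).prodMk (hasDerivAt_const t y))

theorem hasDerivAt_space (hF : JointSmooth F) (t y : ℝ) :
    HasDerivAt (fun z : ℝ => F t (z : Torus))
      (fderiv ℝ (fun q : ℝ × ℝ => F q.1 (q.2 : Torus)) (t, y) (0, 1)) y := by
  have h1 : HasFDerivAt (fun q : ℝ × ℝ => F q.1 (q.2 : Torus)) _ (t, y) :=
    (ContDiff.differentiable hF (by simp) (t, y)).hasFDerivAt
  exact h1.comp_hasDerivAt y ((hasDerivAt_const y t).prodMk (hasDerivAt_id y))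

theorem contDiff_fderiv_apply (hF : JointSmooth F) (v : ℝ × ℝ) :
    ContDiff ℝ ∞ fun q : ℝ × ℝ => fderiv ℝ (fun q : ℝ × ℝ => F q.1 (q.2 : Torus)) q v :=
  (ContDiff.fderiv_right hF (by simp)).clm_apply contDiff_const

theorem time_deriv (hF : JointSmooth F) : JointSmooth fun t x => deriv (fun s => F s x) t := by
  unfold JointSmooth
  simp only [fun t y => (hF.hasDerivAt_time t y).deriv]
  exact hF.contDiff_fderiv_apply _

theorem space_deriv (hF : JointSmooth F) : JointSmooth fun t => torusDeriv (F t) := by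
  unfold JointSmooth
  simp only [torusDeriv_coe, fun t y => (hF.hasDerivAt_space t y).deriv]
  exact hF.contDiff_fderiv_apply _

theorem continuous (hF : JointSmooth F) : Continuous fun q : ℝ × Torus => F q.1 q.2 := by
  have hq : IsOpenQuotientMap (Prod.map id ((↑) : ℝ → Torus) : ℝ × ℝ → ℝ × Torus) :=
    IsOpenQuotientMap.id.prodMap QuotientAddGroup.isOpenQuotientMap_mk
  exact hq.isQuotientMap.continuous_iff.2 (ContDiff.continuous hF)

theorem exists_bound (hF : JointSmooth F) (a b : ℝ) :
    ∃ K, ∀ t ∈ Icc a b, ∀ x, ‖F t x‖ ≤ K := by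
  obtain ⟨K, hK⟩ := ((isCompact_Icc (a := a) (b := b)).prod
    (isCompact_univ (X := Torus))).exists_bound_of_continuousOn hF.continuous.continuousOn
  exact ⟨K, fun t ht x => hK (t, x) ⟨ht, mem_univ x⟩⟩

theorem continuous_fourierCoeff (hF : JointSmooth F) (n : ℤ) :
    Continuous fun t => fourierCoeff (F t) n := by
  have h : Continuous fun q : ℝ × Torus => (fourier (-n) q.2 : ℂ) • F q.1 q.2 :=
    ((map_continuous (fourier (-n))).comp continuous_snd).smul hF.continuous
  have h1 := continuous_parametric_integral_of_continuous (μ := haar)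
    (f := fun t x => (fourier (-n) x : ℂ) • F t x) h isCompact_univ
  simp only [Measure.restrict_univ] at h1
  exact h1

/-- Differentiation under the integral. -/
theorem hasDerivAt_fourierCoeff (hF : JointSmooth F) (n : ℤ) (t : ℝ) :
    HasDerivAt (fun t => fourierCoeff (F t) n)
      (fourierCoeff (fun x => deriv (fun s => F s x) t) n) t := by
  obtain ⟨K, hK⟩ := hF.time_deriv.exists_bound (t - 1) (t + 1)
  have hc : ∀ s, Continuous (F s) := fun s => smoothFn_continuous (hF.slice s)
  have hc' : Continuous fun x => deriv (fun s => F s x) t :=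
    smoothFn_continuous (hF.time_deriv.slice t)
  refine (hasDerivAt_integral_of_dominated_loc_of_deriv_le (bound := fun _ => K)
    (F' := fun s x => (fourier (-n) x : ℂ) • deriv (fun s => F s x) s)
    (Icc_mem_nhds (by linarith : t - 1 < t) (by linarith : t < t + 1))
    (Eventually.of_forall fun s =>
      ((map_continuous (fourier (-n))).smul (hc s)).aestronglyMeasurable)
    (integrable_of_continuous ((map_continuous (fourier (-n))).smul (hc t)))
    ((map_continuous (fourier (-n))).smul hc').aestronglyMeasurable
    (Eventually.of_forall fun x s hs => ?_) (integrable_const K)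
    (Eventually.of_forall fun x s _ => ?_)).2
  · rw [norm_smul, norm_fourier_apply, one_mul]
    exact hK s hs x
  · obtain ⟨y, rfl, -⟩ := exists_coe_eq_norm x
    have h1 := hF.hasDerivAt_time s y
    rw [h1.deriv]
    exact h1.const_smul _

theorem contDiff_fourierCoeff (hF : JointSmooth F) (n : ℤ) :
    ContDiff ℝ 1 fun t => fourierCoeff (F t) n := by
  rw [contDiff_one_iff_deriv]
  refine ⟨fun t => (hF.hasDerivAt_fourierCoeff n t).differentiableAt, ?_⟩
  have e : deriv (fun t => fourierCoeff (F t) n) =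
      fun t => fourierCoeff (fun x => deriv (fun s => F s x) t) n :=
    funext fun t => (hF.hasDerivAt_fourierCoeff n t).deriv
  rw [e]
  exact hF.time_deriv.continuous_fourierCoeff n

/-- Parseval's identity bounds the Fourier coefficients in `ℓ²`, uniformly in time. -/
theorem summable_integral (hF : JointSmooth F) (T : ℝ) :
    (∀ n, MemLp (fun t => fourierCoeff (F t) n) 2 (volume.restrict (Ioo 0 T))) ∧
      Summable fun n : ℤ => ∫ t in Ioo 0 T, ‖fourierCoeff (F t) n‖ ^ 2 := by
  obtain ⟨K, hK⟩ := hF.exists_bound 0 T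
  refine summable_integral_normSq (m := fun _ => K) (memLp_const K)
    (fun n => (hF.continuous_fourierCoeff n).aestronglyMeasurable) ?_
  filter_upwards [ae_restrict_mem measurableSet_Ioo] with t ht S
  have hcont := smoothFn_continuous (hF.slice t)
  have hL : MemLp (F t) 2 haar := MemLp.of_bound hcont.aestronglyMeasurable K
    (Eventually.of_forall fun x => hK t (Ioo_subset_Icc_self ht) x)
  have h1 := hasSum_normSq_fourierCoeff hL
  refine (h1.summable.sum_le_tsum S fun _ _ => by positivity).trans ?_
  rw [h1.tsum_eq]
  have h2 : ∫ x, ‖F t x‖ ^ 2 ∂haar ≤ ∫ _ : Torus, K ^ 2 ∂haar :=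
    integral_mono hL.integrable_norm_pow' (integrable_const _) fun x =>
      pow_le_pow_left₀ (norm_nonneg _) (hK t (Ioo_subset_Icc_self ht) x) 2
  simpa using h2

end JointSmooth

/-! ### From the sequence model to weak solutions -/

/-- Integration of an absolutely convergent Fourier series against an integrable function. -/
theorem hasSum_integral_mul_of_hasSum {b : ℤ → ℂ} {h g : Torus → ℂ} (hb : Summable fun n => ‖b n‖)
    (hh : ∀ x, HasSum (fun n => b n * fourier n x) (h x)) (hg : Integrable g haar) :
    HasSum (fun n => b n * fourierCoeff g (-n)) (∫ x, h x * g x ∂haar) := by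
  have hi : ∀ n : ℤ, Integrable (fun x => (fourier n x : ℂ) * g x) haar := fun n =>
    hg.bdd_mul (c := 1) (map_continuous _).aestronglyMeasurable
      (Eventually.of_forall fun x => (norm_fourier_apply n x).le)
  have h1 := hasSum_integral_of_summable_integral_norm (μ := haar)
    (F := fun n x => b n * ((fourier n x : ℂ) * g x)) (fun n => (hi n).const_mul _) (by
      simp only [norm_mul, norm_fourier_apply, one_mul]
      simp only [integral_const_mul]
      exact hb.mul_right _)
  have e1 : ∀ n, ∫ x, b n * ((fourier n x : ℂ) * g x) ∂haar = b n * fourierCoeff g (-n) :=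
    fun n => by rw [integral_const_mul, fourierCoeff, neg_neg]; rfl
  have e2 : ∀ x, ∑' n, b n * ((fourier n x : ℂ) * g x) = h x * g x := fun x => by
    simp only [← mul_assoc]
    rw [tsum_mul_right, (hh x).tsum_eq]
  simpa only [e1, e2] using h1

theorem summable_norm_invJap (c : Seq) : Summable fun n => ‖invJap c n‖ := by
  refine Summable.of_nonneg_of_le (fun n => norm_nonneg _) (fun n => ?_)
    (summable_jap_zpow_neg_two.add (hasSum_normSq_seq c).summable)
  rw [invJap_apply, norm_mul, norm_inv, Complex.norm_real, Real.norm_of_nonneg (jap_pos n).le,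
    ← inv_pow]
  nlinarith [sq_nonneg ((jap n)⁻¹ - ‖c n‖), sq_nonneg ((jap n)⁻¹ + ‖c n‖)]

/-- Parseval's identity for the bilinear pairing of an `H¹` function with an integrable one. -/
theorem hasSum_integral_synth_mul (c : Seq) {g : Torus → ℂ} (hg : Integrable g haar) :
    HasSum (fun n => invJap c n * fourierCoeff g (-n)) (∫ x, synth c x * g x ∂haar) :=
  hasSum_integral_mul_of_hasSum (summable_norm_invJap c) (hasSum_synth c) hg

theorem hasSum_integral_mul_smooth {g : Torus → ℂ} (hg : Integrable g haar) (φ : SmoothFn) :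
    HasSum (fun n => fourierCoeff g n * fourierCoeff (φ : Torus → ℂ) (-n))
      (∫ x, g x * (φ : Torus → ℂ) x ∂haar) := by
  have h := hasSum_integral_mul_of_hasSum (summable_fourierCoeff φ).norm (hasSum_fourier_smooth φ) hg
  rw [← (Equiv.neg ℤ).hasSum_iff] at h
  have e : ∀ x, g x * (φ : Torus → ℂ) x = (φ : Torus → ℂ) x * g x := fun x => mul_comm _ _
  simp only [e]
  refine h.congr_fun fun n => ?_
  simp only [Function.comp_apply, Equiv.neg_apply, neg_neg]
  ring

theorem fourierCoeff_conj (g : Torus → ℂ) (n : ℤ) :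
    fourierCoeff (fun x => (starRingEnd ℂ) (g x)) n = (starRingEnd ℂ) (fourierCoeff g (-n)) := by
  rw [fourierCoeff, fourierCoeff, ← integral_conj]
  congr 1
  ext x
  rw [smul_eq_mul, smul_eq_mul, map_mul, neg_neg, fourier_neg]

/-- The pairing of a distribution with the product of an `H¹` function and a smooth one. -/
theorem hasSum_pairing_synth_mul {u : SmoothFn →ₗ[ℂ] ℂ} {B : Seq →L[ℂ] Seq} (hB : IsFormOf u B)
    (c : Seq) (φ : SmoothFn) :
    HasSum (fun n => B c n * ((jap n : ℂ) * fourierCoeff (φ : Torus → ℂ) (-n)))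
      (pairing u fun x => synth c x * (φ : Torus → ℂ) x) := by
  set ψ := smoothConj φ with hψ
  have hmem : Memℓp (fun n : ℤ => (jap n : ℂ) * fourierCoeff (ψ : Torus → ℂ) n) 2 := by
    rw [memlp_two_iff]
    refine Summable.of_nonneg_of_le (fun n => by positivity) (fun n => ?_)
      ((summable_jap_pow_mul_fourierCoeff ψ 2).mul_right (∫ x, ‖(ψ : Torus → ℂ) x‖ ∂haar))
    rw [norm_mul, Complex.norm_real, Real.norm_of_nonneg (jap_pos n).le, mul_pow, sq ‖_‖,
      ← mul_assoc]
    exact mul_le_mul_of_nonneg_left (norm_fourierCoeff_le _ n)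
      (mul_nonneg (by have := jap_pos n; positivity) (norm_nonneg _))
  set d : Seq := ⟨_, hmem⟩ with hd
  have hdn : ∀ n, d n = (jap n : ℂ) * fourierCoeff (ψ : Torus → ℂ) n := fun n => rfl
  have hds : ∀ x, synth d x = (ψ : Torus → ℂ) x := fun x => by
    refine (hasSum_synth d x).unique ((hasSum_fourier_smooth ψ x).congr_fun fun n => ?_)
    rw [invJap_apply, hdn, inv_mul_cancel_left₀ (jap_ne_zero n)]
  have e1 : (fun x => synth c x * (φ : Torus → ℂ) x) = conjMul d c := by
    ext x
    rw [conjMul, hds]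
    change _ = (starRingEnd ℂ) ((starRingEnd ℂ) ((φ : Torus → ℂ) x)) * synth c x
    rw [Complex.conj_conj, mul_comm]
  rw [e1, ← hB]
  refine (lp.hasSum_inner (𝕜 := ℂ) d (B c)).congr_fun fun n => ?_
  have e2 : fourierCoeff (ψ : Torus → ℂ) n =
      (starRingEnd ℂ) (fourierCoeff (φ : Torus → ℂ) (-n)) := fourierCoeff_conj _ n
  rw [RCLike.inner_apply, hdn, e2, map_mul, Complex.conj_conj, Complex.conj_ofReal]

/-- Summation and integration may be exchanged for products of square summable families of square
integrable functions. -/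
theorem hasSum_integral_mul {μ : Measure ℝ} [IsFiniteMeasure μ] {a b : ℤ → ℝ → ℂ}
    (ha : ∀ n, MemLp (a n) 2 μ) (sa : Summable fun n => ∫ t, ‖a n t‖ ^ 2 ∂μ)
    (hb : ∀ n, MemLp (b n) 2 μ) (sb : Summable fun n => ∫ t, ‖b n t‖ ^ 2 ∂μ) {S : ℝ → ℂ}
    (hS : ∀ᵐ t ∂μ, HasSum (fun n => a n t * b n t) (S t)) :
    HasSum (fun n => ∫ t, a n t * b n t ∂μ) (∫ t, S t ∂μ) := by
  have h1 : ∫ t, S t ∂μ = ∫ t, ∑' n, a n t * b n t ∂μ :=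
    integral_congr_ae (hS.mono fun t ht => ht.tsum_eq.symm)
  rw [h1]
  refine hasSum_integral_of_summable_integral_norm (fun n => (ha n).integrable_mul (hb n)) ?_
  refine Summable.of_nonneg_of_le (fun n => integral_nonneg fun t => norm_nonneg _) (fun n => ?_)
    (sa.add sb)
  have ia : Integrable (fun t => ‖a n t‖ ^ 2) μ := (ha n).integrable_norm_pow'
  have ib : Integrable (fun t => ‖b n t‖ ^ 2) μ := (hb n).integrable_norm_pow'
  rw [← integral_add ia ib]
  refine integral_mono ((ha n).integrable_mul (hb n)).norm (ia.add ib) fun t => ?_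
  simp only
  rw [norm_mul]
  nlinarith [sq_nonneg (‖a n t‖ - ‖b n t‖), sq_nonneg ‖a n t‖, sq_nonneg ‖b n t‖]

theorem memLp_clm_comp {T : ℝ} {c : ℝ → Seq} (hc : MemLp c 2 (volume.restrict (Ioo 0 T)))
    (L : Seq →L[ℂ] Seq) : MemLp (fun t => L (c t)) 2 (volume.restrict (Ioo 0 T)) :=
  L.comp_memLp' hc

theorem summable_integral_seq {T : ℝ} {c : ℝ → Seq} (hc : MemLp c 2 (volume.restrict (Ioo 0 T))) :
    (∀ n, MemLp (fun t => c t n) 2 (volume.restrict (Ioo 0 T))) ∧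
      Summable fun n : ℤ => ∫ t in Ioo 0 T, ‖c t n‖ ^ 2 :=
  summable_integral_normSq (a := fun n t => c t n) hc.norm (fun n => (memLp_coord hc n).1)
    (Eventually.of_forall fun t F => ((hasSum_normSq_seq (c t)).summable.sum_le_tsum F
      (fun _ _ => by positivity)).trans (hasSum_normSq_seq (c t)).tsum_eq.le)

theorem aestronglyMeasurable_uncurry_synth {T : ℝ} {c : ℝ → Seq}
    (hc : AEStronglyMeasurable c (volume.restrict (Ioo 0 T))) :
    AEStronglyMeasurable (Function.uncurry fun t => synth (c t)) (spaceTime T) := by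
  have h1 : AEStronglyMeasurable (fun p : ℝ × Torus => evalKer p.2) (spaceTime T) :=
    (continuous_evalKer.comp continuous_snd).aestronglyMeasurable
  have h2 : AEStronglyMeasurable (fun p : ℝ × Torus => c p.1) (spaceTime T) := hc.comp_fst
  exact h1.inner h2

/-- A solution in the sequence model is a weak solution. -/
theorem isWeakSolution_synth {α ν T : ℝ} (hα : -(1 / 2) < α) (hα' : α < 0) (hT : 0 < T)
    {u : SmoothFn →ₗ[ℂ] ℂ} {B : Seq →L[ℂ] Seq} (hB : IsFormOf u B)
    {f₀ : Torus → ℂ} (hf₀ : MemLp f₀ 2 haar) {c : ℝ → Seq}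
    (hc : MemLp c 2 (volume.restrict (Ioo 0 T)))
    (hmode : ModeEq T (fourierSeq hf₀) c fun t => ellip ν B (c t)) :
    IsWeakSolution α ν T u f₀ fun t => synth (c t) := by
  have h12 : (1 : ℝ≥0∞) ≤ 2 := by norm_num
  refine ⟨?_, ?_, fun φ hφ => ?_⟩
  · exact aestronglyMeasurable_uncurry_synth hc.1
  · -- `L²(0,T;H¹)` embeds in all the spaces of the definition; `θ = (s + 1/2) / 2` is a Hölder
    -- exponent of `H¹` above `s`
    refine ⟨(1 / 2 + α) / 2, by linarith, by linarith, ?_⟩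
    have hadm := admissible_of_pos hα' (ε := (1 / 2 + α) / 2) (by linarith) (by linarith)
    set s := -α + (1 / 2 + α) / 2
    set q := (1 + (1 / 2 + α) / 2) / ((1 / 2 + α) / 2)
    have h0 := hadm.s_pos
    have h1 := hadm.s_lt
    obtain ⟨A, hA, hk, hk'⟩ := exists_norm_evalKer_le (θ := (s + 1 / 2) / 2) (by linarith)
      (by linarith)
    obtain ⟨C, hC, h⟩ := exists_sobolevNorm_le_of_holder (s := s) (θ := (s + 1 / 2) / 2)
      (by linarith) (by linarith [hadm.two_le] : 1 ≤ q)
    have hle : ∀ t, sobolevNorm s q (synth (c t)) ^ 2 ≤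
        ENNReal.ofReal ((C * A) ^ 2 * ‖c t‖ ^ 2) := fun t => by
      have h2 := h (synth (c t)) (A * ‖c t‖) (by positivity) (norm_synth_le hk _)
        (norm_synth_sub_le hk' _)
      refine (pow_le_pow_left' h2 2).trans (le_of_eq ?_)
      rw [← ENNReal.ofReal_pow (by positivity)]
      congr 1
      ring
    refine ENNReal.rpow_lt_top_of_nonneg (by norm_num) (lt_of_le_of_lt (lintegral_mono hle) ?_).ne
    exact (hc.integrable_norm_pow'.const_mul _).lintegral_lt_top
  · obtain ⟨hsm, T', hT', hvan⟩ := hφ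
    have hJ : JointSmooth φ := hsm
    set ψ : ℝ → Torus → ℂ := fun t x =>
      deriv (fun s => φ s x) t + (ν : ℂ) * torusDeriv (torusDeriv (φ t)) x with hψ
    have hJψ : JointSmooth ψ :=
      ContDiff.add hJ.time_deriv (contDiff_const.mul hJ.space_deriv.space_deriv)
    have hψc : ∀ t n, fourierCoeff (ψ t) n = fourierCoeff (fun x => deriv (fun s => φ s x) t) n -
        (ν * n ^ 2 : ℝ) * fourierCoeff (φ t) n := by
      intro t n
      have e1 : ψ t = (fun x => deriv (fun s => φ s x) t) +
        fun x => (ν : ℂ) * torusDeriv (torusDeriv (φ t)) x := rfl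
      have c1 : Continuous fun x => deriv (fun s => φ s x) t :=
        smoothFn_continuous (hJ.time_deriv.slice t)
      have c2 : Continuous fun x => torusDeriv (torusDeriv (φ t)) x :=
        smoothFn_continuous (hJ.space_deriv.space_deriv.slice t)
      have e2 := fourierCoeff_iterate_smoothDeriv (hJ.slice t) 2 n
      have e3 : (smoothDeriv^[2] (hJ.slice t) : Torus → ℂ) =
        fun x => torusDeriv (torusDeriv (φ t)) x := rfl
      have e4 : ((hJ.slice t : SmoothFn) : Torus → ℂ) = φ t := rfl
      rw [e3, e4] at e2
      rw [e1, fourierCoeff.add (integrable_of_continuous c1)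
        ((integrable_of_continuous c2).const_mul _), Pi.add_apply, fourierCoeff.const_mul, e2]
      push_cast
      linear_combination (ν * n ^ 2 * fourierCoeff (φ t) n : ℂ) * Complex.I_sq
    -- the three terms of the weak formulation as sums over the Fourier modes
    have hca := summable_integral_seq (memLp_clm_comp hc invJap)
    have hcB := summable_integral_seq (memLp_clm_comp hc B)
    have hneg : ∀ {F : ℝ → Torus → ℂ}, JointSmooth F →
        Summable fun n : ℤ => ∫ t in Ioo 0 T, ‖fourierCoeff (F t) (-n)‖ ^ 2 := fun hF =>
      (Equiv.neg ℤ).summable_iff.2 (hF.summable_integral T).2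
    have H1 : HasSum (fun n => ∫ t in Ioo 0 T, invJap (c t) n * fourierCoeff (ψ t) (-n))
        (∫ t in Ioo 0 T, ∫ x, synth (c t) x * ψ t x ∂haar) :=
      hasSum_integral_mul (a := fun n t => invJap (c t) n)
        (b := fun n t => fourierCoeff (ψ t) (-n)) hca.1 hca.2
        (fun n => (hJψ.summable_integral T).1 (-n)) (hneg hJψ)
        (Eventually.of_forall fun t => hasSum_integral_synth_mul (c t)
          (integrable_of_continuous (smoothFn_continuous (hJψ.slice t))))
    have H2 : HasSum (fun n => fourierCoeff f₀ n * fourierCoeff (φ 0) (-n))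
        (∫ x, f₀ x * φ 0 x ∂haar) :=
      hasSum_integral_mul_smooth (hf₀.integrable h12) (hJ.slice 0)
    have H3 : HasSum (fun n => ∫ t in Ioo 0 T,
          B (c t) n * ((jap n : ℂ) * fourierCoeff (φ t) (-n)))
        (∫ t in Ioo 0 T, pairing u fun x => synth (c t) x * φ t x) := by
      refine hasSum_integral_mul (a := fun n t => B (c t) n)
        (b := fun n t => (jap n : ℂ) * fourierCoeff (φ t) (-n)) hcB.1 hcB.2
        (fun n => ((hJ.summable_integral T).1 (-n)).const_mul _) ?_
        (Eventually.of_forall fun t => hasSum_pairing_synth_mul hB (c t) (hJ.slice t))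
      refine ((hneg hJ).add (hneg hJ.space_deriv)).congr fun n => ?_
      rw [← integral_add ((hJ.summable_integral T).1 (-n)).integrable_norm_pow'
        ((hJ.space_deriv.summable_integral T).1 (-n)).integrable_norm_pow']
      congr 1
      ext t
      have e1 : fourierCoeff (torusDeriv (φ t)) (-n) =
          Complex.I * ((-n : ℤ) : ℂ) * fourierCoeff (φ t) (-n) :=
        fourierCoeff_smoothDeriv (hJ.slice t) (-n)
      rw [e1, norm_mul, norm_mul, norm_mul, Complex.norm_I, one_mul, Complex.norm_intCast,
        Complex.norm_real, Real.norm_of_nonneg (jap_pos n).le, mul_pow, mul_pow, sq_abs, jap_sq]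
      push_cast
      ring
    -- the equation for each mode
    have hn : ∀ n : ℤ, (∫ t in Ioo 0 T, invJap (c t) n * fourierCoeff (ψ t) (-n)) +
        fourierCoeff f₀ n * fourierCoeff (φ 0) (-n) = Complex.I *
        ∫ t in Ioo 0 T, B (c t) n * ((jap n : ℂ) * fourierCoeff (φ t) (-n)) := by
      intro n
      set θ : ℝ → ℂ := fun t => fourierCoeff (φ t) (-n) with hθ
      have hθ1 : ContDiff ℝ 1 θ := hJ.contDiff_fourierCoeff (-n)
      have hθd : ∀ t, deriv θ t = fourierCoeff (fun x => deriv (fun s => φ s x) t) (-n) :=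
        fun t => (hJ.hasDerivAt_fourierCoeff (-n) t).deriv
      have hθT : θ T = 0 := by
        have : φ T = fun _ => 0 := funext fun x => hvan T hT'.le x
        simp [hθ, this, fourierCoeff]
      have hgi : IntegrableOn (fun t => (jap n : ℂ) * ellip ν B (c t) n) (Ioo 0 T) :=
        (integrable_coord (memLp_clm_comp hc (ellip ν B)) n).const_mul _
      have h1 := integral_deriv_mul_primitive hT.le (fourierCoeff f₀ n) hθ1 hθT hgi
      have h2 : ∫ t in Ioo 0 T, deriv θ t * (fourierCoeff f₀ n - ∫ s in (0 : ℝ)..t,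
          (jap n : ℂ) * ellip ν B (c s) n) = ∫ t in Ioo 0 T, deriv θ t * invJap (c t) n :=
        integral_congr_ae ((hmode n).mono fun t ht => by simp only [ht]; rfl)
      rw [h2] at h1
      have ia : IntegrableOn (fun t => invJap (c t) n) (Ioo 0 T) := (hca.1 n).integrable h12
      have ib : IntegrableOn (fun t => B (c t) n) (Ioo 0 T) := (hcB.1 n).integrable h12
      have i1 := integrable_continuous_mul hθ1.continuous ia
      have i2 := integrable_continuous_mul hθ1.continuous ib
      have i3 := integrable_continuous_mul (hθ1.continuous_deriv le_rfl) ia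
      have e1 : ∀ t, θ t * ((jap n : ℂ) * ellip ν B (c t) n) =
          ((ν * n ^ 2 : ℝ) : ℂ) * (θ t * invJap (c t) n) +
            Complex.I * jap n * (θ t * B (c t) n) := fun t => by
        rw [jap_mul_ellip_apply]; ring
      have e2 : ∀ t, invJap (c t) n * fourierCoeff (ψ t) (-n) = deriv θ t * invJap (c t) n -
          ((ν * n ^ 2 : ℝ) : ℂ) * (θ t * invJap (c t) n) := fun t => by
        rw [hψc, hθd]; push_cast; ring
      have e3 : ∀ t, B (c t) n * ((jap n : ℂ) * fourierCoeff (φ t) (-n)) =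
          (jap n : ℂ) * (θ t * B (c t) n) := fun t => by ring
      simp only [e1] at h1
      simp only [e2, e3]
      rw [integral_add (i1.const_mul _) (i2.const_mul _), integral_const_mul,
        integral_const_mul] at h1
      rw [integral_sub i3 (i1.const_mul _), integral_const_mul, integral_const_mul]
      linear_combination h1
    have H4 := H1.add H2
    simp only [hn] at H4
    exact H4.unique (H3.mul_left Complex.I)

/-! ### Norms in space and time -/

theorem hOneNormSq_congr {g g' : Torus → ℂ} (h : g =ᵐ[haar] g') : hOneNormSq g = hOneNormSq g' := by
  rw [hOneNormSq, hOneNormSq, eLpNorm_congr_ae h, fourierCoeff_congr_ae h]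

theorem normL2H1_eq {T : ℝ} {G : ℝ → Torus → ℂ} {e : ℝ → Seq}
    (he : MemLp e 2 (volume.restrict (Ioo 0 T)))
    (h : ∀ᵐ t ∂(volume.restrict (Ioo 0 T)), G t =ᵐ[haar] synth (e t)) :
    normL2H1 T G = ENNReal.ofReal (timeNorm T e) := by
  have h1 : ∫⁻ t in Ioo 0 T, hOneNormSq (G t) = ∫⁻ t in Ioo 0 T, ENNReal.ofReal (‖e t‖ ^ 2) :=
    lintegral_congr_ae (h.mono fun t ht => by
      simp only
      rw [hOneNormSq_congr ht, hOneNormSq_synth])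
  rw [normL2H1, h1, ← ofReal_integral_eq_lintegral_ofReal he.integrable_norm_pow'
    (Eventually.of_forall fun t => by positivity), ← timeNorm_sq,
    ENNReal.ofReal_rpow_of_nonneg (sq_nonneg _) (by norm_num), ← Real.sqrt_eq_rpow,
    Real.sqrt_sq (show 0 ≤ timeNorm T e from Real.sqrt_nonneg _)]

theorem normLinftyL2_le {T K : ℝ} {G : ℝ → Torus → ℂ} {e : ℝ → Seq}
    (h : ∀ᵐ t ∂(volume.restrict (Ioo 0 T)), G t =ᵐ[haar] synth (e t))
    (hK : ∀ᵐ t ∂(volume.restrict (Ioo 0 T)), ‖invJap (e t)‖ ≤ K) :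
    normLinftyL2 T G ≤ ENNReal.ofReal K := by
  refine essSup_le_of_ae_le _ ?_
  filter_upwards [h, hK] with t h1 h2
  rw [eLpNorm_congr_ae h1, eLpNorm_synth]
  exact ENNReal.ofReal_le_ofReal h2

/-- Equality almost everywhere at almost all times is equality almost everywhere in space-time, for
functions that are measurable in both variables. -/
theorem ae_eq_uncurry {T : ℝ} {f g : ℝ → Torus → ℂ}
    (hf : AEStronglyMeasurable (Function.uncurry f) (spaceTime T))
    (hg : AEStronglyMeasurable (Function.uncurry g) (spaceTime T))
    (h : ∀ᵐ t ∂(volume.restrict (Ioo 0 T)), f t =ᵐ[haar] g t) :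
    Function.uncurry f =ᵐ[spaceTime T] Function.uncurry g := by
  have h1 : hf.mk _ =ᵐ[spaceTime T] hg.mk _ := by
    refine (Measure.ae_prod_iff_ae_ae (measurableSet_eq_fun hf.stronglyMeasurable_mk.measurable
      hg.stronglyMeasurable_mk.measurable)).2 ?_
    filter_upwards [h, ae_ae_eq_mk hf, ae_ae_eq_mk hg] with t h1 h2 h3
    filter_upwards [h1, h2, h3] with x h4 h5 h6
    exact h5.symm.trans (h4.trans h6)
  exact hf.ae_eq_mk.trans (h1.trans hg.ae_eq_mk.symm)

/-- Two solutions in the sequence model with the same operator and initial value agree. -/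
theorem ModeEq.unique {T ν : ℝ} (hT : 0 < T) (hν : 0 < ν) {B : Seq →L[ℂ] Seq}
    (hB : ∀ x, (inner ℂ x (B x)).im = 0) {a₀ : Seq} {c d : ℝ → Seq}
    (hc : MemLp c 2 (volume.restrict (Ioo 0 T))) (hd : MemLp d 2 (volume.restrict (Ioo 0 T)))
    (hce : ModeEq T a₀ c fun t => ellip ν B (c t))
    (hde : ModeEq T a₀ d fun t => ellip ν B (d t)) :
    ∀ᵐ t ∂(volume.restrict (Ioo 0 T)), d t = c t := by
  have h := (stability (η := 0) hT hν hB (fun x y => by simp) hc hd hce hde).1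
  rw [zero_mul, mul_zero] at h
  have h0 : timeNorm T (d - c) = 0 := le_antisymm h (Real.sqrt_nonneg _)
  have h1 := timeNorm_sq T (d - c)
  rw [h0, sq, zero_mul] at h1
  have h2 := (integral_eq_zero_iff_of_nonneg (fun t => by positivity)
    (hd.sub hc).integrable_norm_pow').1 h1.symm
  filter_upwards [h2] with t ht
  exact sub_eq_zero.1 (norm_eq_zero.1 (pow_eq_zero_iff two_ne_zero |>.1 ht))

end RoughShear

end

open RoughShear in
theorem theoremA1 (α : ℝ) (hα : -(1 / 2) < α) (hα' : α < 0)
    (ν : ℝ) (hν : 0 < ν) (T : ℝ) (hT : 0 < T)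
    (f₀ : Torus → ℂ) (hf₀ : MemLp f₀ 2 haar)
    (u : SmoothFn →ₗ[ℂ] ℂ) (hu : MemBesov α 1 u) (hu_real : IsRealDistribution u) :
    ∃ f : ℝ → Torus → ℂ,
      -- existence and uniqueness
      IsWeakSolution α ν T u f₀ f ∧
      (∀ g : ℝ → Torus → ℂ, IsWeakSolution α ν T u f₀ g →
        Function.uncurry g =ᵐ[spaceTime T] Function.uncurry f) ∧
      -- regularity
      normL2H1 T f < ⊤ ∧ normLinftyL2 T f < ⊤ ∧
      -- approximation by smooth velocities
      ∀ ε : ℝ, 0 < ε → ε < 1 / 2 + α →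
        (∃ v : ℕ → SmoothFn, (∀ n x, ((v n : Torus → ℂ) x).im = 0) ∧
          Tendsto (fun n => negSobolevNorm (α - ε) (1 + ε) (ofSmooth (v n) - u)) atTop (𝓝 0)) ∧
        ∀ v : ℕ → SmoothFn, (∀ n x, ((v n : Torus → ℂ) x).im = 0) →
          Tendsto (fun n => negSobolevNorm (α - ε) (1 + ε) (ofSmooth (v n) - u)) atTop (𝓝 0) →
          (∃ F : ℕ → ℝ → Torus → ℂ, ∀ n, IsWeakSolution α ν T (ofSmooth (v n)) f₀ (F n)) ∧
          ∀ F : ℕ → ℝ → Torus → ℂ,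
            (∀ n, IsWeakSolution α ν T (ofSmooth (v n)) f₀ (F n)) →
            Tendsto (fun n => normL2H1 T (F n - f)) atTop (𝓝 0) ∧
            Tendsto (fun n => normLinftyL2 T (F n - f)) atTop (𝓝 0) := by
  -- the operator `B` is determined by `u` alone, so that any exponent `ε` serves to construct it
  have hadm := admissible_of_pos hα' (ε := (1 / 2 + α) / 2) (by linarith) (by linarith)
  obtain ⟨B, hB⟩ := exists_isFormOf hadm hu.2
  have hBim := hB.im_inner_self hadm hu.2 hu_real
  obtain ⟨c, hc, hce⟩ := exists_modeEq hT hν hBim (fourierSeq hf₀)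
  have hweak := isWeakSolution_synth hα hα' hT hB hf₀ hc hce
  have hrefl : ∀ᵐ t ∂(volume.restrict (Ioo 0 T)), synth (c t) =ᵐ[haar] synth (c t) :=
    Eventually.of_forall fun t => EventuallyEq.rfl
  refine ⟨fun t => synth (c t), hweak, fun g hg => ?_, ?_, ?_, fun ε hε0 hε1 => ⟨?_, ?_⟩⟩
  · obtain ⟨d, hd, hde, hgd⟩ := exists_modeEq_of_isWeakSolution hα' hν hT hu.2 hB hf₀ hg
    refine ae_eq_uncurry hg.1 hweak.1 ?_
    filter_upwards [hgd, ModeEq.unique hT hν hBim hc hd hce hde] with t h1 h2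
    rw [← h2]
    exact h1
  · rw [normL2H1_eq hc hrefl]
    exact ENNReal.ofReal_lt_top
  · exact (normLinftyL2_le hrefl (ae_norm_invJap_le hν.le hBim hc hce)).trans_lt
      ENNReal.ofReal_lt_top
  · have h := admissible_of_pos hα' hε0 hε1
    refine exists_smooth_approx ?_ hu hu_real
    rwa [neg_sub', sub_neg_eq_add, add_sub_cancel_left]
  · intro v hv hlim
    have h := admissible_of_pos hα' hε0 hε1
    have hvB := fun n => memBesov_ofSmooth hα' (v n)
    have hvr := fun n => isRealDistribution_ofSmooth (hv n)
    choose b hb using fun n => exists_isFormOf hadm (hvB n).2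
    have hbim := fun n => (hb n).im_inner_self hadm (hvB n).2 (hvr n)
    refine ⟨?_, fun F hF => ?_⟩
    · choose d hd hde using fun n => exists_modeEq hT hν (hbim n) (fourierSeq hf₀)
      exact ⟨fun n t => synth (d n t), fun n =>
        isWeakSolution_synth hα hα' hT (hb n) hf₀ (hd n) (hde n)⟩
    choose d hd hde hFd using fun n =>
      exists_modeEq_of_isWeakSolution hα' hν hT (hvB n).2 (hb n) hf₀ (hF n)
    obtain ⟨C, hC, hdiff⟩ := exists_norm_inner_sub_le (σ := α - ε) (p := 1 + ε)
      (by linarith) (by linarith) (by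
        rw [add_sub_cancel_left]
        linarith [h.two_le])
    -- the difference of the operators is of size `η n` by convergence in the negative Sobolev space;
    -- it is finite from some index on
    set τ : ℝ := timeNorm T c with hτ
    set η : ℕ → ℝ := fun n => C * (negSobolevNorm (α - ε) (1 + ε) (ofSmooth (v n) - u)).toReal
      with hη
    have hη0 : Tendsto η atTop (𝓝 0) := by
      have h1 := (ENNReal.tendsto_toReal ENNReal.zero_ne_top).comp hlim
      simpa using h1.const_mul C
    have hfin : ∀ᶠ n in atTop, negSobolevNorm (α - ε) (1 + ε) (ofSmooth (v n) - u) < ⊤ :=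
      hlim.eventually_lt_const ENNReal.zero_lt_top
    have hsub : ∀ n, ∀ᵐ t ∂(volume.restrict (Ioo 0 T)),
        (F n - fun t => synth (c t)) t =ᵐ[haar] synth ((d n - c) t) := fun n => by
      filter_upwards [hFd n] with t ht
      filter_upwards [ht] with x hx
      rw [Pi.sub_apply, Pi.sub_apply, Pi.sub_apply, synth_sub, hx]
    -- stability around `f`, whose norm `τ` does not depend on `n`
    have hstab : ∀ᶠ n in atTop, timeNorm T (d n - c) ≤ (2 * T + ν⁻¹) * (η n * τ) ∧
        ∀ᵐ t ∂(volume.restrict (Ioo 0 T)), ‖invJap ((d n - c) t)‖ ^ 2 ≤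
          2 * (η n * τ) * timeNorm T (d n - c) := by
      filter_upwards [hfin] with n hn
      exact stability hT hν (hbim n)
        (hdiff u (ofSmooth (v n)) B (b n) hu.1 (hvB n).1 hB (hb n) hn) hc (hd n) hce (hde n)
    have hL1 : Tendsto (fun n => (2 * T + ν⁻¹) * (η n * τ)) atTop (𝓝 0) := by
      simpa using (hη0.mul_const τ).const_mul (2 * T + ν⁻¹)
    constructor
    · refine tendsto_of_tendsto_of_tendsto_of_le_of_le' tendsto_const_nhds
        (h := fun n => ENNReal.ofReal ((2 * T + ν⁻¹) * (η n * τ))) ?_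
        (Eventually.of_forall fun _ => zero_le) ?_
      · simpa using ENNReal.tendsto_ofReal hL1
      · filter_upwards [hstab] with n hn
        rw [normL2H1_eq ((hd n).sub hc) (hsub n)]
        exact ENNReal.ofReal_le_ofReal hn.1
    · refine tendsto_of_tendsto_of_tendsto_of_le_of_le' tendsto_const_nhds
        (h := fun n => ENNReal.ofReal √(2 * (η n * τ) * ((2 * T + ν⁻¹) * (η n * τ)))) ?_
        (Eventually.of_forall fun _ => zero_le) ?_
      · have h1 := (((hη0.mul_const τ).const_mul 2).mul hL1).sqrt
        simpa using ENNReal.tendsto_ofReal h1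
      · filter_upwards [hstab] with n hn
        refine normLinftyL2_le (hsub n) ?_
        filter_upwards [hn.2] with t ht
        refine Real.le_sqrt_of_sq_le (ht.trans (mul_le_mul_of_nonneg_left hn.1 ?_))
        have h1 : 0 ≤ η n := mul_nonneg hC ENNReal.toReal_nonneg
        have h2 : 0 ≤ τ := Real.sqrt_nonneg _
        positivity
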